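/- Let $k$ be an algebraically closed field of characteristic $0$, and let $f:(X,\Lambda_0)\to(Y,\Pi_0)$ be a Poisson morphism of nonsingular Poisson varieties over $k$, with Poisson brackets $\{\cdot,\cdot\}$ on $\mathcal O_X$ and $\mathcal O_Y$. Let $f^*T_Y^\bullet$ be the complex of sheaves on $X$ $$f^*T_Y\xrightarrow{\ \pi\ }\wedge^2f^*T_Y\xrightarrow{\ \pi\ }\wedge^3f^*T_Y\xrightarrow{\ \pi\ }\cdots$$ with $f^*T_Y$ in degree $0$, where a local section of $\wedge^{q}f^*T_Y$ is regarded as an alternating $k$-multiderivation $Q$ of $q$ arguments from $\mathcal O_Y$ to $\mathcal O_X$ (along $f^\#$) and $$\pi(Q)(a_0,\dots,a_q)=(-1)^q\Big(\sum_{i}(-1)^{i}\{Q(\dots,\hat a_i,\dots),f^\#(a_i)\}+\sum_{i<j}(-1)^{i+j-1}Q(\{a_i,a_j\},\dots,\hat a_i,\dots,\hat a_j,\dots)\Big).$$ The hypercohomology $\mathbb H^n(X,f^*T_Y^\bullet)$ is computed by the total complexes of the Čech double complexes $C^p(\mathcal U,\wedge^{q+1}f^*T_Y)$, with differential $\pi+(-1)^{n+1}\delta$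 in total degree $n=p+q$, in the colimit over open covers $\mathcal U$ of $X$. For a local artinian $k$-algebra $A$ with residue field $k$, let $\mathrm{Def}_{(X,\Lambda_0)/f/(Y,\Pi_0)}(A)$ be the set of Poisson morphisms $\Psi:(X\times\mathrm{Spec}\,A,\Lambda_0)\to(Y\times\mathrm{Spec}\,A,\Pi_0)$ over $\mathrm{Spec}\,A$ that induce $f$ on the fibre over the closed point (the brackets being extended $A$-bilinearly). Then: 1. There is a bijection $\mathrm{Def}_{(X,\Lambda_0)/f/(Y,\Pi_0)}(k[\epsilon])\cong\mathbb H^0(X,f^*T_Y^\bullet)$; it sends $\Psi$ to the class of the $v$ with $\Psi^\#=f^\#+\epsilon v$ on $\mathcal O_Y$. 2. Let $0\to(t)\to\tilde A\to A\to0$ be a small extension of local artinian $k$-algebras with residue field $k$ (that is, $\tilde A\to A$ is a surjective homomorphism of $k$-algebras with kernel $(t)$, $t\neq0$ and $t\,\mathfrak m_{\tilde A}=0$), and let $\Psi\in\mathrm{Def}_{(X,\Lambda_0)/f/(Y,\Pi_0)}(A)$. For an open cover $\{U_i\}$ of $X$ and liftings $\tilde\Psi_i:U_i\times\mathrm{Spec}\,\tilde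 A\to Y\times\mathrm{Spec}\,\tilde A$ of $\Psi|_{U_i\times \mathrm{Spec}\,A}$ as morphisms of schemes over $\mathrm{Spec}\,\tilde A$, with $\tilde\Phi_i=\tilde\Psi_i^\#$, define $(\{P_i\},\{\xi_{ij}\})\in C^0(\wedge^2f^*T_Y)\oplus C^1(f^*T_Y)$ by $$tP_i(a,b)=\tilde\Phi_i(\{a,b\})-\{\tilde\Phi_i(a),\tilde\Phi_i(b)\},\qquad t\xi_{ij}(a)=\tilde\Phi_j(a)-\tilde\Phi_i(a)$$ for local sections $a,b$ of $\mathcal O_Y$. Such covers and liftings exist, $(\{P_i\},\{\xi_{ij}\})$ is a cocycle, and its class $o_\Psi\in\mathbb H^1(X,f^*T_Y^\bullet)$ does not depend on the choice of the cover and of the liftings. Moreover $o_\Psi=0$ if and only if $\Psi$ lifts to $\tilde A$, i.e. there is $\tilde\Psi\in\mathrm{Def}_{(X,\Lambda_0)/f/(Y,\Pi_0)}(\tilde A)$ that induces $\Psi$ over $\mathrm{Spec}\,A$. -/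

import Mathlib

universe u
open CategoryTheory CategoryTheory.Limits AlgebraicGeometry TopologicalSpace Opposite
open scoped TensorProduct
noncomputable section
namespace PoissonDef

/-! ### Poisson brackets on commutative rings -/

/-- A Poisson bracket on a commutative ring. -/
structure PoissonBracket (R : Type u) [CommRing R] where
  br : R →ₗ[ℤ] R →ₗ[ℤ] R
  self : ∀ a, br a a = 0
  leibniz : ∀ a b c, br a (b * c) = b * br a c + c * br a b
  jacobi : ∀ a b c, br a (br b c) = br (br a b) c + br b (br a c)

theorem PoissonBracket.skew {R : Type u} [CommRing R] (β : PoissonBracket R) (a b : R) :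
    β.br a b = - β.br b a := by
  have h := β.self (a + b)
  simp only [map_add, LinearMap.add_apply, β.self] at h
  linear_combination h

theorem PoissonBracket.leibniz' {R : Type u} [CommRing R] (β : PoissonBracket R) (a b c : R) :
    β.br (a * b) c = a * β.br b c + b * β.br a c := by
  rw [β.skew, β.leibniz, β.skew c b, β.skew c a]; ring

section Alternating

variable {M N : Type u} [AddCommGroup M] [AddCommGroup N] {n : ℕ}

/-- The map `v ↦ ∑_{i < j} (-1)^(i+j-1) g(v_i, v_j)(v without v_i and v_j)`; the pair `i < j` of
elements of `Fin (n + 2)` is written `(i.castSucc, j.succ)` with `i ≤ j`. -/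
def pairMultilinear (g : M →ₗ[ℤ] M →ₗ[ℤ] M [⋀^Fin n]→ₗ[ℤ] N) :
    MultilinearMap ℤ (fun _ : Fin (n + 2) => M) N :=
  ∑ i : Fin (n + 1), ∑ j ≥ i, (-1 : ℤ) ^ (i + j : ℕ) •
    LinearMap.uncurryMid (R := ℤ) (M := fun _ : Fin (n + 2) => M) i.castSucc
      { toFun := fun x => LinearMap.uncurryMid (R := ℤ) (M := fun _ : Fin (n + 1) => M) j
          (AlternatingMap.toMultilinearMapLM ∘ₗ g x)
        map_add' := fun x y => by ext; simp
        map_smul' := fun c x => by ext; simp }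

theorem pairMultilinear_apply (g : M →ₗ[ℤ] M →ₗ[ℤ] M [⋀^Fin n]→ₗ[ℤ] N) (v : Fin (n + 2) → M) :
    pairMultilinear g v = ∑ i : Fin (n + 1), ∑ j ≥ i, (-1 : ℤ) ^ (i + j : ℕ) •
      g (v i.castSucc) (v j.succ) (j.removeNth <| i.castSucc.removeNth v) := by
  simp only [pairMultilinear, _root_.sum_apply, _root_.smul_apply,
    LinearMap.uncurryMid_apply]
  refine Finset.sum_congr rfl fun i _ => Finset.sum_congr rfl fun j hj => ?_
  have hj : i ≤ j := by simpa using hj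
  have H : i.castSucc.removeNth v j = v j.succ := by
    simp [Fin.removeNth_apply, Fin.succAbove_of_le_castSucc, hj]
  rw [← H]
  rfl

/-- The alternating map `v ↦ ∑_{i < j} (-1)^(i+j-1) g(v_i, v_j)(v without v_i and v_j)`. -/
def pairAlternating (g : M →ₗ[ℤ] M →ₗ[ℤ] M [⋀^Fin n]→ₗ[ℤ] N) (hg : ∀ x, g x x = 0) :
    M [⋀^Fin (n + 2)]→ₗ[ℤ] N where
  toMultilinearMap := pairMultilinear g
  map_eq_zero_of_eq' := by
    intro v a b hab hne
    have skew : ∀ x y, g x y = - g y x := fun x y => by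
      have h := hg (x + y)
      simp only [map_add, LinearMap.add_apply, hg, zero_add, add_zero] at h
      exact eq_neg_of_add_eq_zero_right h
    let r : Fin (n + 2) → Fin (n + 2) := fun i => if i = b then a else i
    have hr : ∀ i, v (r i) = v i := fun i => by
      by_cases h : i = b <;> simp [r, h, hab]
    let L : (Fin (n + 2) →₀ ℤ) →ₗ[ℤ] M := Finsupp.linearCombination ℤ v
    let e := Finsupp.basisSingleOne (R := ℤ) (ι := Fin (n + 2))
    let g' : (Fin (n + 2) →₀ ℤ) →ₗ[ℤ] (Fin (n + 2) →₀ ℤ) →ₗ[ℤ]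
        (Fin (n + 2) →₀ ℤ) [⋀^Fin n]→ₗ[ℤ] N :=
      e.constr ℤ fun i => e.constr ℤ fun j =>
        if i < j then (g (v i) (v j)).compLinearMap L else 0
    have hg' : ∀ i j, g' (e i) (e j) = if i < j then (g (v i) (v j)).compLinearMap L else 0 :=
      fun i j => by simp only [g', Module.Basis.constr_basis]
    let w : Fin (n + 2) → (Fin (n + 2) →₀ ℤ) := fun i => e (r i)
    have hw : ∀ i, L (w i) = v i := fun i => by simp [L, w, e, hr]
    have key := AlternatingMap.alternatizeUncurryFin_alternatizeUncurryFinLM_comp_apply g' w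
    rw [AlternatingMap.map_eq_zero_of_eq _ w (i := a) (j := b) (by simp [w, r]) hne] at key
    change pairMultilinear g v = 0
    rw [pairMultilinear_apply, key]
    refine Finset.sum_congr rfl fun i _ => Finset.sum_congr rfl fun j _ => ?_
    congr 1
    have hL : ∀ u : Fin n → (Fin (n + 2) →₀ ℤ), ∀ p q,
        (g' (w p) (w q) u - g' (w q) (w p) u) = g (v p) (v q) (fun l => L (u l)) := by
      intro u p q
      simp only [w, hg', hr]
      rcases lt_trichotomy (r p) (r q) with h | h | h
      · rw [if_pos h, if_neg (not_lt.2 h.le)]; simp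
      · have : v p = v q := by rw [← hr p, ← hr q, h]
        simp [h, this, hg]
      · rw [if_pos h, if_neg (not_lt.2 h.le), skew (v p)]; simp
    rw [hL]
    congr 1
    funext l
    simp only [Fin.removeNth_apply, hw]

theorem pairAlternating_apply (g : M →ₗ[ℤ] M →ₗ[ℤ] M [⋀^Fin n]→ₗ[ℤ] N) (hg : ∀ x, g x x = 0)
    (v : Fin (n + 2) → M) :
    pairAlternating g hg v = ∑ i : Fin (n + 1), ∑ j ≥ i, (-1 : ℤ) ^ (i + j : ℕ) •
      g (v i.castSucc) (v j.succ) (j.removeNth <| i.castSucc.removeNth v) :=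
  pairMultilinear_apply g v

end Alternating

section Differential

theorem removeNth_succ_vecCons {D : Type u} {n : ℕ} (x : D) (w : Fin (n + 1) → D) (i : Fin (n + 1)) :
    i.succ.removeNth (α := fun _ => D) (Matrix.vecCons x w) = Matrix.vecCons x (i.removeNth w) := by
  funext l
  refine Fin.cases ?_ (fun l => ?_) l <;> simp [Fin.removeNth_apply]

variable {C B : Type u} [CommRing C] [CommRing B] (f : C →+* B)
  (βC : PoissonBracket C) (βB : PoissonBracket B) {n : ℕ}

/-- `a ↦ {Q(-), f a}`. -/
def bracketRight (Q : C [⋀^Fin n]→ₗ[ℤ] B) : C →ₗ[ℤ] C [⋀^Fin n]→ₗ[ℤ] B :=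
  (AddMonoidHom.mk' (fun a => (βB.br.flip (f a)).compAlternatingMap Q)
    (fun a b => by ext; simp)).toIntLinearMap

/-- `(a, b) ↦ Q({a, b}, -)`. -/
def insertBracket (Q : C [⋀^Fin (n + 1)]→ₗ[ℤ] B) : C →ₗ[ℤ] C →ₗ[ℤ] C [⋀^Fin n]→ₗ[ℤ] B :=
  (AddMonoidHom.mk' (fun a => Q.curryLeft ∘ₗ βC.br a) (fun a b => by ext; simp)).toIntLinearMap

/-- The differential `π` on alternating maps: for `Q` with `q = n + 1` arguments,
`π(Q)(a_0, …, a_q) = ∑_i (-1)^(q-i) {Q(…, â_i, …), f(a_i)}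
  - (-1)^(q-1) ∑_{i<j} (-1)^(i+j-1) Q({a_i, a_j}, …, â_i, …, â_j, …)`. -/
def polyDiff (Q : C [⋀^Fin (n + 1)]→ₗ[ℤ] B) : C [⋀^Fin (n + 2)]→ₗ[ℤ] B :=
  (-1 : ℤ) ^ (n + 1) • (AlternatingMap.alternatizeUncurryFin (bracketRight f βB Q) +
    pairAlternating (insertBracket βC Q) (fun x => by ext; simp [insertBracket, βC.self]))

theorem polyDiff_apply (Q : C [⋀^Fin (n + 1)]→ₗ[ℤ] B) (v : Fin (n + 2) → C) :
    polyDiff f βC βB Q v = (-1 : ℤ) ^ (n + 1) • (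
      ∑ i : Fin (n + 2), (-1 : ℤ) ^ (i : ℕ) • βB.br (Q (i.removeNth v)) (f (v i)) +
      ∑ i : Fin (n + 1), ∑ j ≥ i, (-1 : ℤ) ^ (i + j : ℕ) •
        Q (Matrix.vecCons (βC.br (v i.castSucc) (v j.succ))
          (j.removeNth <| i.castSucc.removeNth v))) := by
  simp only [polyDiff, AlternatingMap.smul_apply, AlternatingMap.add_apply,
    AlternatingMap.alternatizeUncurryFin_apply, pairAlternating_apply]
  rfl

theorem polyDiff_add (Q Q' : C [⋀^Fin (n + 1)]→ₗ[ℤ] B) :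
    polyDiff f βC βB (Q + Q') = polyDiff f βC βB Q + polyDiff f βC βB Q' := by
  ext v
  simp only [polyDiff_apply, AlternatingMap.add_apply, map_add, LinearMap.add_apply, smul_add,
    Finset.sum_add_distrib]
  abel

/-- The derivation rule in the first (hence, by alternation, in every) argument. -/
def IsMultiDer (Q : C [⋀^Fin (n + 1)]→ₗ[ℤ] B) : Prop :=
  ∀ a b (v : Fin n → C), Q (Matrix.vecCons (a * b) v) =
    f a * Q (Matrix.vecCons b v) + f b * Q (Matrix.vecCons a v)

theorem map_vecCons_swap {n : ℕ} (Q : C [⋀^Fin (n + 2)]→ₗ[ℤ] B) (a b : C) (v : Fin n → C) :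
    Q (Matrix.vecCons a (Matrix.vecCons b v)) = - Q (Matrix.vecCons b (Matrix.vecCons a v)) := by
  have h := Q.map_swap (Matrix.vecCons b (Matrix.vecCons a v)) (i := 0) (j := 1) (by simp)
  rw [← h]
  congr 1
  funext i
  refine Fin.cases ?_ (fun i => Fin.cases ?_ (fun i => ?_) i) i
  · simp
  · simp
  · rw [Function.comp_apply, Equiv.swap_apply_of_ne_of_ne] <;> simp [Fin.ext_iff]

theorem sum_removeNth_vecCons (Q : C [⋀^Fin (n + 1)]→ₗ[ℤ] B) (w : Fin (n + 1) → C) (x : C) :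
    ∑ i : Fin (n + 2), (-1 : ℤ) ^ (i : ℕ) •
      βB.br (Q (i.removeNth (Matrix.vecCons x w))) (f (Matrix.vecCons x w i)) =
      βB.br (Q w) (f x) - ∑ i : Fin (n + 1), (-1 : ℤ) ^ (i : ℕ) •
          βB.br (Q (Matrix.vecCons x (i.removeNth w))) (f (w i)) := by
  rw [Fin.sum_univ_succ]
  simp only [removeNth_succ_vecCons, Matrix.cons_val_succ, Matrix.cons_val_zero, Fin.val_succ,
    pow_succ, Fin.val_zero, pow_zero, one_smul, mul_neg, mul_one, neg_smul,
    Finset.sum_neg_distrib, ← sub_eq_add_neg]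
  rfl

theorem polyDiff_vecCons_zero (Q : C [⋀^Fin 1]→ₗ[ℤ] B) (w : Fin 1 → C) (x : C) :
    polyDiff f βC βB Q (Matrix.vecCons x w) =
      βB.br (Q ![x]) (f (w 0)) - βB.br (Q w) (f x) - Q ![βC.br x (w 0)] := by
  rw [polyDiff_apply, sum_removeNth_vecCons]
  have h : Fin.tail w = ![] := Subsingleton.elim _ _
  have h' : Finset.Ici (0 : Fin 1) = {0} := rfl
  simp [h', h]
  abel

theorem polyDiff_vecCons_succ (Q : C [⋀^Fin (n + 2)]→ₗ[ℤ] B) (w : Fin (n + 2) → C) (x : C) :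
    polyDiff f βC βB Q (Matrix.vecCons x w) = (-1 : ℤ) ^ n • (
      βB.br (Q w) (f x) +
      ∑ i : Fin (n + 2), (-1 : ℤ) ^ (i : ℕ) •
        (Q (Matrix.vecCons (βC.br x (w i)) (i.removeNth w)) -
          βB.br (Q (Matrix.vecCons x (i.removeNth w))) (f (w i))) -
      ∑ i : Fin (n + 1), ∑ j ≥ i, (-1 : ℤ) ^ (i + j : ℕ) •
        Q (Matrix.vecCons x (Matrix.vecCons (βC.br (w i.castSucc) (w j.succ))
          (j.removeNth <| i.castSucc.removeNth w)))) := by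
  have h2 : ∑ j ≥ (0 : Fin (n + 2)), (-1 : ℤ) ^ ((0 : Fin (n + 2)) + j : ℕ) •
      Q (Matrix.vecCons (βC.br (Matrix.vecCons x w (0 : Fin (n + 2)).castSucc)
        (Matrix.vecCons x w j.succ))
          (j.removeNth <| (0 : Fin (n + 2)).castSucc.removeNth (Matrix.vecCons x w))) =
      ∑ i : Fin (n + 2), (-1 : ℤ) ^ (i : ℕ) •
        Q (Matrix.vecCons (βC.br x (w i)) (i.removeNth w)) := by
    refine Finset.sum_congr (by ext; simp) fun j _ => ?_
    simp
  have h3 : ∀ i : Fin (n + 1), ∑ j ≥ i.succ, (-1 : ℤ) ^ (i.succ + j : ℕ) •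
    Q (Matrix.vecCons (βC.br (Matrix.vecCons x w i.succ.castSucc)
      (Matrix.vecCons x w j.succ))
        (j.removeNth <| i.succ.castSucc.removeNth (Matrix.vecCons x w))) =
      - ∑ j ≥ i, (-1 : ℤ) ^ (i + j : ℕ) •
        Q (Matrix.vecCons x (Matrix.vecCons (βC.br (w i.castSucc) (w j.succ))
          (j.removeNth <| i.castSucc.removeNth w))) := fun i => by
    rw [show Finset.Ici i.succ = Finset.univ.filter (fun j => i.succ ≤ j) by ext; simp,
      show Finset.Ici i = Finset.univ.filter (fun j => i ≤ j) by ext; simp,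
      Finset.sum_filter, Finset.sum_filter, Fin.sum_univ_succ, if_neg (by simp), zero_add,
      ← Finset.sum_neg_distrib]
    refine Finset.sum_congr rfl fun j _ => ?_
    by_cases hij : i ≤ j
    · rw [if_pos (by simpa using hij), if_pos hij]
      have e1 : i.succ.castSucc = i.castSucc.succ := rfl
      rw [e1, removeNth_succ_vecCons, removeNth_succ_vecCons, map_vecCons_swap]
      simp only [Matrix.cons_val_succ, Fin.val_succ, smul_neg]
      rw [show (i : ℕ) + 1 + (j + 1) = i + j + 2 by ring, pow_add]
      simp
    · rw [if_neg (by simpa using hij), if_neg hij, neg_zero]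
  rw [polyDiff_apply, sum_removeNth_vecCons, Fin.sum_univ_succ (n := n + 1) (f := fun i => ∑ j ≥ i, _), h2]
  have h5 : (-1 : ℤ) ^ (n + 1 + 1) = (-1) ^ n := by ring
  rw [h5]
  congr 1
  simp only [h3, smul_sub, Finset.sum_sub_distrib, Finset.sum_neg_distrib]
  abel

theorem polyDiff_vecCons (Q : C [⋀^Fin (n + 1)]→ₗ[ℤ] B) (w : Fin (n + 1) → C) :
    ∃ (ι : Type) (_ : Fintype ι) (c : ι → ℤ) (u : ι → Fin n → C),
    ∀ x, polyDiff f βC βB Q (Matrix.vecCons x w) = (-1 : ℤ) ^ (n + 1) • (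
      βB.br (Q w) (f x) +
      ∑ i : Fin (n + 1), (-1 : ℤ) ^ (i : ℕ) •
        (Q (Matrix.vecCons (βC.br x (w i)) (i.removeNth w)) -
          βB.br (Q (Matrix.vecCons x (i.removeNth w))) (f (w i))) +
      ∑ i, c i • Q (Matrix.vecCons x (u i))) := by
  cases n with
  | zero =>
    refine ⟨Empty, inferInstance, fun _ => 0, fun _ => ![], fun x => ?_⟩
    have h : Fin.tail w = ![] := Subsingleton.elim _ _
    rw [polyDiff_vecCons_zero]
    simp [h]
    abel
  | succ m =>
    refine ⟨Fin (m + 1) × Fin (m + 1), inferInstance,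
      fun p => if p.1 ≤ p.2 then - (-1 : ℤ) ^ (p.1 + p.2 : ℕ) else 0,
      fun p => Matrix.vecCons (βC.br (w p.1.castSucc) (w p.2.succ))
        (p.2.removeNth <| p.1.castSucc.removeNth w), fun x => ?_⟩
    rw [polyDiff_vecCons_succ, Fintype.sum_prod_type, pow_add _ m 2, neg_one_sq, mul_one,
      sub_eq_add_neg, ← Finset.sum_neg_distrib]
    congr 2
    refine Finset.sum_congr rfl fun i _ => ?_
    rw [show Finset.Ici i = Finset.univ.filter (fun j => i ≤ j) by ext; simp, Finset.sum_filter,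
      ← Finset.sum_neg_distrib]
    refine Finset.sum_congr rfl fun j _ => ?_
    dsimp only
    by_cases hij : i ≤ j
    · rw [if_pos hij, if_pos hij, neg_smul]
    · rw [if_neg hij, if_neg hij, neg_zero, zero_smul]

/-- `π` preserves multiderivations when `f` is a homomorphism of Poisson algebras. -/
theorem IsMultiDer.polyDiff (hf : ∀ a b, f (βC.br a b) = βB.br (f a) (f b))
    {Q : C [⋀^Fin (n + 1)]→ₗ[ℤ] B} (hQ : IsMultiDer f Q) :
    IsMultiDer f (polyDiff f βC βB Q) := by
  intro a b w
  obtain ⟨ι, _, c, u, h⟩ := polyDiff_vecCons f βC βB Q w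
  simp only [h, mul_smul_comm, ← smul_add]
  congr 1
  have e1 : ∀ i : Fin (n + 1), (-1 : ℤ) ^ (i : ℕ) •
        (Q (Matrix.vecCons (βC.br (a * b) (w i)) (i.removeNth w)) -
          βB.br (Q (Matrix.vecCons (a * b) (i.removeNth w))) (f (w i))) =
      f a * ((-1 : ℤ) ^ (i : ℕ) • (Q (Matrix.vecCons (βC.br b (w i)) (i.removeNth w)) -
          βB.br (Q (Matrix.vecCons b (i.removeNth w))) (f (w i)))) +
      f b * ((-1 : ℤ) ^ (i : ℕ) • (Q (Matrix.vecCons (βC.br a (w i)) (i.removeNth w)) -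
          βB.br (Q (Matrix.vecCons a (i.removeNth w))) (f (w i)))) := fun i => by
    simp only [mul_smul_comm, ← smul_add]
    congr 1
    have hadd : ∀ (x y : C), Q (Matrix.vecCons (x + y) (i.removeNth w)) =
      Q (Matrix.vecCons x (i.removeNth w)) + Q (Matrix.vecCons y (i.removeNth w)) := fun x y => by
      exact congrArg (fun g => g (i.removeNth w)) (Q.curryLeft.map_add x y)
    rw [βC.leibniz', hadd, hQ, hQ, hQ, map_add, LinearMap.add_apply, βB.leibniz', βB.leibniz', hf,
      hf]
    ring
  have e2 : ∀ i, c i • Q (Matrix.vecCons (a * b) (u i)) =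
      f a * (c i • Q (Matrix.vecCons b (u i))) + f b * (c i • Q (Matrix.vecCons a (u i))) :=
    fun i => by rw [hQ, smul_add, mul_smul_comm, mul_smul_comm]
  simp only [e1, e2, Finset.sum_add_distrib, ← Finset.mul_sum, map_mul, βB.leibniz]
  ring

/-- `π` preserves the vanishing on constants. -/
theorem polyDiff_const {Q : C [⋀^Fin (n + 1)]→ₗ[ℤ] B} {c : C}
    (hQ : ∀ v, Q (Matrix.vecCons c v) = 0) (hc : ∀ a, βC.br c a = 0) (hc' : ∀ a, βB.br (f c) a = 0)
    (w : Fin (n + 1) → C) : polyDiff f βC βB Q (Matrix.vecCons c w) = 0 := by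
  obtain ⟨ι, _, z, u, h⟩ := polyDiff_vecCons f βC βB Q w
  have h0 : ∀ v, Q (Matrix.vecCons 0 v) = 0 := fun v => Q.map_coord_zero 0 rfl
  simp [h, hQ, hc, h0, βB.skew _ (f c), hc']

/-- `π` is compatible with homomorphisms of Poisson algebras. -/
theorem polyDiff_natural {C' B' : Type u} [CommRing C'] [CommRing B'] {f' : C' →+* B'}
    {βC' : PoissonBracket C'} {βB' : PoissonBracket B'} (r : C →+* C') (s : B →+* B')
    (hr : ∀ a b, r (βC.br a b) = βC'.br (r a) (r b))
    (hs : ∀ a b, s (βB.br a b) = βB'.br (s a) (s b)) (hrs : ∀ a, f' (r a) = s (f a))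
    {Q : C [⋀^Fin (n + 1)]→ₗ[ℤ] B} {Q' : C' [⋀^Fin (n + 1)]→ₗ[ℤ] B'}
    (hQ : ∀ v, Q' (fun i => r (v i)) = s (Q v)) (v : Fin (n + 2) → C) :
    polyDiff f' βC' βB' Q' (fun i => r (v i)) = s (polyDiff f βC βB Q v) := by
  have hcons : ∀ (x : C) (u : Fin n → C),
      Q' (Matrix.vecCons (r x) (fun i => r (u i))) = s (Q (Matrix.vecCons x u)) := fun x u => by
    rw [← hQ]
    congr 1
    funext l
    refine Fin.cases ?_ (fun l => ?_) l <;> simp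
  simp only [polyDiff_apply, map_zsmul, map_add, map_sum, hs, ← hrs, ← hcons, hr]
  simp only [← hQ]
  rfl


/-- `Q ↦ ∑_i Q(…, {x, a_i}, …) + {Q(…), f x}`. -/
def lieDer (x : C) (Q : C [⋀^Fin (n + 1)]→ₗ[ℤ] B) : C [⋀^Fin (n + 1)]→ₗ[ℤ] B :=
  AlternatingMap.alternatizeUncurryFin (insertBracket βC Q x) + bracketRight f βB Q x

theorem lieDer_apply (x : C) (Q : C [⋀^Fin (n + 1)]→ₗ[ℤ] B) (w : Fin (n + 1) → C) :
    lieDer f βC βB x Q w = ∑ i : Fin (n + 1), (-1 : ℤ) ^ (i : ℕ) •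
      Q (Matrix.vecCons (βC.br x (w i)) (i.removeNth w)) + βB.br (Q w) (f x) := by
  simp only [lieDer, AlternatingMap.add_apply, AlternatingMap.alternatizeUncurryFin_apply]
  rfl

theorem lieDer_vecCons (x y : C) (Q : C [⋀^Fin (n + 2)]→ₗ[ℤ] B) :
    (lieDer f βC βB x Q).curryLeft y =
      Q.curryLeft (βC.br x y) + lieDer f βC βB x (Q.curryLeft y) := by
  ext w
  simp only [AlternatingMap.curryLeft_apply_apply, AlternatingMap.add_apply, lieDer_apply]
  rw [Fin.sum_univ_succ]
  simp only [removeNth_succ_vecCons, Matrix.cons_val_succ, Matrix.cons_val_zero, Fin.val_succ,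
    pow_succ, Fin.val_zero, pow_zero, one_smul, mul_neg, mul_one, neg_smul, map_vecCons_swap Q _ y,
    smul_neg, neg_neg]
  rw [add_assoc]
  rfl

theorem polyDiff_zsmul (z : ℤ) (Q : C [⋀^Fin (n + 1)]→ₗ[ℤ] B) :
    polyDiff f βC βB (z • Q) = z • polyDiff f βC βB Q :=
  map_zsmul (AddMonoidHom.mk' (polyDiff f βC βB (n := n)) (polyDiff_add f βC βB)) z Q

theorem lieDer_add (x : C) (Q Q' : C [⋀^Fin (n + 1)]→ₗ[ℤ] B) :
    lieDer f βC βB x (Q + Q') = lieDer f βC βB x Q + lieDer f βC βB x Q' := by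
  ext v
  simp only [lieDer_apply, AlternatingMap.add_apply, map_add, LinearMap.add_apply, smul_add,
    Finset.sum_add_distrib]
  abel

theorem lieDer_zsmul (x : C) (z : ℤ) (Q : C [⋀^Fin (n + 1)]→ₗ[ℤ] B) :
    lieDer f βC βB x (z • Q) = z • lieDer f βC βB x Q :=
  map_zsmul (AddMonoidHom.mk' (lieDer f βC βB x (n := n)) (lieDer_add f βC βB x)) z Q

/-- Cartan's formula. -/
theorem polyDiff_curryLeft (Q : C [⋀^Fin (n + 2)]→ₗ[ℤ] B) (x : C) :
    (polyDiff f βC βB Q).curryLeft x =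
      (-1 : ℤ) ^ n • lieDer f βC βB x Q + polyDiff f βC βB (Q.curryLeft x) := by
  ext w
  simp only [AlternatingMap.curryLeft_apply_apply, AlternatingMap.add_apply,
    AlternatingMap.smul_apply, lieDer_apply]
  rw [polyDiff_vecCons_succ, polyDiff_apply]
  simp only [AlternatingMap.curryLeft_apply_apply, pow_succ, mul_neg, mul_one,
    neg_smul, smul_add, smul_sub, Finset.sum_sub_distrib]
  abel

theorem ext_curryLeft {Q Q' : C [⋀^Fin (n + 1)]→ₗ[ℤ] B}
    (h : ∀ x, Q.curryLeft x = Q'.curryLeft x) : Q = Q' := by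
  ext v
  have := congrArg (fun g => g (Matrix.vecTail v)) (h (Matrix.vecHead v))
  simpa using this

theorem lieDer_one (x y : C) (Q : C [⋀^Fin 1]→ₗ[ℤ] B) :
    lieDer f βC βB x Q ![y] = Q ![βC.br x y] + βB.br (Q ![y]) (f x) := by
  have h : Fin.tail ![y] = ![] := Subsingleton.elim _ _
  simp [lieDer_apply, h]

theorem ext_one {Q Q' : C [⋀^Fin 1]→ₗ[ℤ] B} (h : ∀ x, Q ![x] = Q' ![x]) : Q = Q' := by
  ext v
  have : v = ![v 0] := by funext i; fin_cases i; rfl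
  rw [this]
  exact h _

theorem map_one_add (Q : C [⋀^Fin 1]→ₗ[ℤ] B) (x y : C) : Q ![x + y] = Q ![x] + Q ![y] :=
  congrArg (fun g => g ![]) (Q.curryLeft.map_add x y)

variable {f βC βB}

theorem lieDer_comm (hf : ∀ a b, f (βC.br a b) = βB.br (f a) (f b)) (x y : C) :
    ∀ {n : ℕ} (Q : C [⋀^Fin (n + 1)]→ₗ[ℤ] B),
    lieDer f βC βB x (lieDer f βC βB y Q) + lieDer f βC βB (βC.br x y) Q =
      lieDer f βC βB y (lieDer f βC βB x Q)
  | 0, Q => ext_one fun z => by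
    simp only [AlternatingMap.add_apply, lieDer_one, map_add, LinearMap.add_apply, hf]
    rw [βC.jacobi x y z, map_one_add, βB.jacobi _ (f x) (f y), βB.skew (f x)]
    abel
  | n + 1, Q => ext_curryLeft fun z => by
    simp only [AlternatingMap.curryLeft_add, LinearMap.add_apply, lieDer_vecCons, lieDer_add,
      ← lieDer_comm hf x y (Q.curryLeft z), βC.jacobi x y z, map_add]
    abel

theorem polyDiff_lieDer (hf : ∀ a b, f (βC.br a b) = βB.br (f a) (f b)) (x : C) :
    ∀ {n : ℕ} (Q : C [⋀^Fin (n + 1)]→ₗ[ℤ] B),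
    lieDer f βC βB x (polyDiff f βC βB Q) = polyDiff f βC βB (lieDer f βC βB x Q)
  | 0, Q => ext_curryLeft fun y => ext_one fun z => by
    rw [lieDer_vecCons]
    simp only [AlternatingMap.curryLeft_apply_apply, AlternatingMap.add_apply, lieDer_one,
      polyDiff_vecCons_zero, Matrix.cons_val_zero, map_add, map_sub, LinearMap.add_apply,
      LinearMap.sub_apply, hf, map_one_add, βC.jacobi x y z]
    rw [βB.jacobi (Q ![y]), βB.jacobi (Q ![z]), βB.skew (f x) (βB.br (Q ![y]) (f z)),
      βB.skew (f x) (βB.br (Q ![z]) (f y))]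
    ring
  | n + 1, Q => ext_curryLeft fun y => by
    rw [lieDer_vecCons, polyDiff_curryLeft, polyDiff_curryLeft, polyDiff_curryLeft, lieDer_vecCons,
      lieDer_add, lieDer_zsmul, polyDiff_add, polyDiff_lieDer hf x (Q.curryLeft y),
      ← lieDer_comm hf x y Q, smul_add]
    abel

theorem polyDiff_polyDiff (hf : ∀ a b, f (βC.br a b) = βB.br (f a) (f b)) :
    ∀ {n : ℕ} (Q : C [⋀^Fin (n + 1)]→ₗ[ℤ] B), polyDiff f βC βB (polyDiff f βC βB Q) = 0
  | 0, Q => ext_curryLeft fun x => by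
    rw [polyDiff_curryLeft, polyDiff_lieDer hf, ← polyDiff_zsmul, ← polyDiff_add]
    refine ext_curryLeft fun y => ext_one fun z => ?_
    simp [polyDiff_vecCons_zero, lieDer_one, hf]
    rw [βB.jacobi (Q ![x]), βB.skew (f y) (βB.br (Q ![x]) (f z))]
    ring
  | n + 1, Q => ext_curryLeft fun x => by
    rw [polyDiff_curryLeft, polyDiff_curryLeft, polyDiff_add, polyDiff_polyDiff hf (Q.curryLeft x),
      polyDiff_lieDer hf, polyDiff_zsmul, pow_succ]
    simp

end Differential
/-! ### Products with spectra of artinian algebras -/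

/-- A local artinian `k`-algebra with residue field `k`. -/
class IsArtAlg (k A : Type u) [Field k] [CommRing A] [Algebra k A] : Prop extends
    IsLocalRing A, IsArtinianRing A where
  bijective : Function.Bijective (algebraMap k (IsLocalRing.ResidueField A))

section Art
variable (k A : Type u) [Field k] [CommRing A] [Algebra k A] [IsArtAlg k A]

/-- The augmentation `A → A / 𝔪 = k`. -/
def aug : A →ₐ[k] k :=
  (AlgEquiv.ofBijective (Algebra.ofId k (IsLocalRing.ResidueField A))
    IsArtAlg.bijective).symm.toAlgHom.comp
    (Algebra.algHom k A (IsLocalRing.ResidueField A))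

theorem finite_of_isFiniteLength (M : Type u) [AddCommGroup M] [Module A M]
    (h : IsFiniteLength A M) : ∀ [Module k M] [IsScalarTower k A M], Module.Finite k M := by
  induction h with
  | of_subsingleton => intros; infer_instance
  | of_simple_quotient h ih =>
    rename_i M _ _ N hs
    intro _ _
    obtain ⟨m, hm, ⟨e⟩⟩ := isSimpleModule_iff_quot_maximal.mp hs
    obtain rfl := IsLocalRing.eq_maximalIdeal hm
    have h0 : Module.Finite k (A ⧸ IsLocalRing.maximalIdeal A) :=
      Module.Finite.of_surjective (Algebra.linearMap k (A ⧸ IsLocalRing.maximalIdeal A))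
        (IsArtAlg.bijective (k := k) (A := A)).2
    have h1 : Module.Finite k (M ⧸ N.restrictScalars k) :=
      Module.Finite.equiv (M := A ⧸ IsLocalRing.maximalIdeal A)
        ((e.restrictScalars k).symm.trans (Submodule.Quotient.restrictScalarsEquiv k N).symm)
    have h2 : Module.Finite k (N.restrictScalars k) := ih
    exact Module.Finite.of_submodule_quotient (N.restrictScalars k)

instance finite_artAlg : Module.Finite k A :=
  finite_of_isFiniteLength k A A
    ((isArtinianRing_iff_isFiniteLength A).mp inferInstance)

instance finite_dualNumber (k : Type u) [Field k] : Module.Finite k (DualNumber k) :=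
  inferInstanceAs (Module.Finite k (k × k))

instance artAlg_dualNumber (k : Type u) [Field k] : IsArtAlg k (DualNumber k) :=
  { (inferInstance : IsLocalRing (DualNumber k)),
    (IsArtinianRing.of_finite k _ : IsArtinianRing (DualNumber k)) with
    bijective := by
      refine ⟨RingHom.injective _, fun x => ?_⟩
      obtain ⟨x, rfl⟩ := IsLocalRing.residue_surjective x
      refine ⟨x.fst, ?_⟩
      rw [IsScalarTower.algebraMap_apply k (DualNumber k), IsLocalRing.ResidueField.algebraMap_eq,
        ← sub_eq_zero, ← map_sub, IsLocalRing.residue_eq_zero_iff,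
        IsLocalRing.mem_maximalIdeal, mem_nonunits_iff, TrivSqZeroExt.isUnit_iff_isUnit_fst]
      simp [TrivSqZeroExt.algebraMap_eq_inl] }
end Art

section Prod
variable {k : Type u} [Field k] {X : Scheme.{u}} (s : X ⟶ Spec (.of k))
  (A : Type u) [CommRing A] [Algebra k A]

/-- `X × Spec A`. -/
abbrev prodSpec : Scheme.{u} := pullback s (Spec.map (CommRingCat.ofHom (algebraMap k A)))

/-- The projection `X × Spec A ⟶ X`. -/
abbrev prodFst : prodSpec s A ⟶ X := pullback.fst s (Spec.map (CommRingCat.ofHom (algebraMap k A)))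

/-- The projection `X × Spec A ⟶ Spec A`. -/
abbrev prodSnd : prodSpec s A ⟶ Spec (.of A) :=
  pullback.snd s (Spec.map (CommRingCat.ofHom (algebraMap k A)))

/-- The morphism `X × Spec A ⟶ X × Spec A'` induced by `A' → A`. -/
def prodMap {A A' : Type u} [CommRing A] [Algebra k A] [CommRing A'] [Algebra k A']
    (φ : A' →ₐ[k] A) : prodSpec s A ⟶ prodSpec s A' :=
  pullback.lift (prodFst s A) (prodSnd s A ≫ Spec.map (CommRingCat.ofHom φ.toRingHom)) (by
    rw [Category.assoc, ← Spec.map_comp, ← CommRingCat.ofHom_comp, pullback.condition]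
    congr 3
    exact φ.comp_algebraMap.symm)

variable [IsArtAlg k A]

/-- The inclusion `X ⟶ X × Spec A` of the fibre over the closed point. -/
def prodIncl : X ⟶ prodSpec s A :=
  pullback.lift (𝟙 X) (s ≫ Spec.map (CommRingCat.ofHom (aug k A).toRingHom)) (by
    rw [Category.assoc, ← Spec.map_comp, ← CommRingCat.ofHom_comp]
    have : (aug k A).toRingHom.comp (algebraMap k A) = RingHom.id k := (aug k A).comp_algebraMap
    rw [this]
    simp)


theorem prodIncl_fst : prodIncl s A ≫ prodFst s A = 𝟙 X := pullback.lift_fst _ _ _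

theorem prodIncl_isPullback : IsPullback (prodIncl s A) s (prodSnd s A)
    (Spec.map (CommRingCat.ofHom (aug k A).toRingHom)) := by
  have h : Spec.map (CommRingCat.ofHom (aug k A).toRingHom) ≫
      Spec.map (CommRingCat.ofHom (algebraMap k A)) = 𝟙 _ := by
    rw [← Spec.map_comp, ← CommRingCat.ofHom_comp]
    have : (aug k A).toRingHom.comp (algebraMap k A) = RingHom.id k := (aug k A).comp_algebraMap
    rw [this]
    simp
  refine IsPullback.of_right (h₁₂ := prodFst s A) (v₁₃ := s)
    (h₂₂ := Spec.map (CommRingCat.ofHom (algebraMap k A))) ?_ (pullback.lift_snd _ _ _)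
    (IsPullback.of_hasPullback _ _)
  rw [prodIncl_fst, h]
  exact IsPullback.of_id_fst

instance prodIncl_surjective : Surjective (prodIncl s A) := by
  have : Surjective (Spec.map (CommRingCat.ofHom (aug k A).toRingHom)) := by
    constructor
    intro x
    refine ⟨(default : PrimeSpectrum k), ?_⟩
    have : Subsingleton (PrimeSpectrum A) := by infer_instance
    exact Subsingleton.elim (α := PrimeSpectrum A) _ _
  exact MorphismProperty.of_isPullback (prodIncl_isPullback s A).flip this

theorem preimage_preimage (W : (prodSpec s A).Opens) :
    prodFst s A ⁻¹ᵁ (prodIncl s A ⁻¹ᵁ W) = W := by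
  ext x
  obtain ⟨y, rfl⟩ := (prodIncl s A).surjective x
  have : prodFst s A (prodIncl s A y) = y := by
    rw [← Scheme.Hom.comp_apply, prodIncl_fst]; rfl
  change prodIncl s A (prodFst s A (prodIncl s A y)) ∈ W ↔ _
  rw [this]; rfl

end Prod

/-- Restriction of sections. -/
abbrev res (X : Scheme.{u}) {U V : X.Opens} (h : V ≤ U) : Γ(X, U) →+* Γ(X, V) :=
  (X.presheaf.map (homOfLE h).op).hom

/-- The ring homomorphism `Γ(Y, V) → Γ(X, U)` given by `f : X ⟶ Y` with `f(U) ⊆ V`. -/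
abbrev sharp {X Y : Scheme.{u}} (f : X ⟶ Y) {V : Y.Opens} {U : X.Opens} (h : U ≤ f ⁻¹ᵁ V) :
    Γ(Y, V) →+* Γ(X, U) :=
  (f.appLE V U h).hom

theorem le_preimage_top {X Y : Scheme.{u}} (f : X ⟶ Y) (U : X.Opens) : U ≤ f ⁻¹ᵁ ⊤ := by simp

/-- The ring homomorphism `R → Γ(X, U)` given by a morphism `X ⟶ Spec R`. -/
def scal {R : Type u} [CommRing R] {X : Scheme.{u}} (s : X ⟶ Spec (.of R)) (U : X.Opens) :
    R →+* Γ(X, U) :=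
  (sharp s (le_preimage_top s U)).comp (Scheme.ΓSpecIso (.of R)).inv.hom

theorem res_sharp {X Y : Scheme.{u}} (f : X ⟶ Y) {V : Y.Opens} {U U' : X.Opens}
    (h : U ≤ f ⁻¹ᵁ V) (h' : U' ≤ U) (a : Γ(Y, V)) :
    res X h' (sharp f h a) = sharp f (h'.trans h) a := by
  simp only [sharp, res, ← CommRingCat.comp_apply, Scheme.Hom.appLE_map]

theorem sharp_res {X Y : Scheme.{u}} (f : X ⟶ Y) {V V' : Y.Opens} {U : X.Opens}
    (h : U ≤ f ⁻¹ᵁ V') (h' : V' ≤ V) (a : Γ(Y, V)) :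
    sharp f h (res Y h' a) = sharp f (h.trans (f.preimage_mono h')) a := by
  simp only [sharp, res, ← CommRingCat.comp_apply, Scheme.Hom.map_appLE]

theorem sharp_sharp {X Y Z : Scheme.{u}} (f : X ⟶ Y) (g : Y ⟶ Z) {T : Z.Opens} {V : Y.Opens}
    {U : X.Opens} (h : U ≤ f ⁻¹ᵁ V) (h' : V ≤ g ⁻¹ᵁ T) (a : Γ(Z, T)) :
    sharp f h (sharp g h' a) = sharp (f ≫ g) (h.trans (f.preimage_mono h')) a := by
  simp only [sharp, ← CommRingCat.comp_apply, Scheme.Hom.appLE_comp_appLE]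

theorem res_scal {R : Type u} [CommRing R] {X : Scheme.{u}} (s : X ⟶ Spec (.of R))
    {U V : X.Opens} (h : V ≤ U) (a : R) : res X h (scal s U a) = scal s V a := by
  rw [scal, scal, RingHom.comp_apply, RingHom.comp_apply, res_sharp]

theorem sharp_scal {R : Type u} [CommRing R] {X Y : Scheme.{u}} (s : Y ⟶ Spec (.of R)) (f : X ⟶ Y)
    {V : Y.Opens} {U : X.Opens} (h : U ≤ f ⁻¹ᵁ V) (a : R) :
    sharp f h (scal s V a) = scal (f ≫ s) U a := by
  rw [scal, scal, RingHom.comp_apply, RingHom.comp_apply, sharp_sharp]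

theorem sharp_congr {X Y : Scheme.{u}} {f g : X ⟶ Y} (e : f = g) {V : Y.Opens} {U : X.Opens}
    (h : U ≤ f ⁻¹ᵁ V) (h' : U ≤ g ⁻¹ᵁ V) (a : Γ(Y, V)) : sharp f h a = sharp g h' a := by
  subst e; rfl

section ProdSections
variable {k : Type u} [Field k] {X : Scheme.{u}} (s : X ⟶ Spec (.of k))
  (A : Type u) [CommRing A] [Algebra k A]  [IsArtAlg k A]

theorem le_preimage (W : (prodSpec s A).Opens) : W ≤ prodFst s A ⁻¹ᵁ (prodIncl s A ⁻¹ᵁ W) :=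
  (preimage_preimage s A W).ge

theorem isPushout_sections {W : (prodSpec s A).Opens} (hW : IsAffineOpen W) :
    IsPushout (CommRingCat.ofHom (scal s (prodIncl s A ⁻¹ᵁ W)))
      (CommRingCat.ofHom (algebraMap k A))
      ((prodFst s A).appLE (prodIncl s A ⁻¹ᵁ W) W (le_preimage s A W))
      (CommRingCat.ofHom (scal (prodSnd s A) W)) := by
  have haff : IsAffineHom (prodIncl s A) :=
    MorphismProperty.of_isPullback (prodIncl_isPullback s A).flip
      (inferInstanceAs (IsAffineHom (Spec.map (CommRingCat.ofHom (aug k A).toRingHom))))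
  have hU : IsAffineOpen (prodIncl s A ⁻¹ᵁ W) := hW.preimage _
  have h := (isIso_pushoutSection_iff (IsPullback.of_hasPullback s
    (Spec.map (CommRingCat.ofHom (algebraMap k A)))) (US := ⊤) (UT := ⊤)
    (UX := prodIncl s A ⁻¹ᵁ W) (UY := W) le_top le_top
    (by rw [Scheme.Hom.preimage_top, inf_top_eq]; exact (preimage_preimage s A W).symm)).mp
    (isIso_pushoutSection_of_isAffineOpen _ _ _ _ (isAffineOpen_top _) (isAffineOpen_top _) hU)
  refine IsPushout.of_iso h (Scheme.ΓSpecIso (.of k)) (Iso.refl _) (Scheme.ΓSpecIso (.of A))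
    (Iso.refl _) ?_ ?_ ?_ ?_
  · simp [scal]
  · rw [← Scheme.ΓSpecIso_naturality]
    simp [Scheme.Hom.appTop, Scheme.Hom.app_eq_appLE]
  · simp
  · simp [scal]

theorem scal_prod (W : (prodSpec s A).Opens) (c : k) :
    scal (prodSnd s A) W (algebraMap k A c) =
      sharp (prodFst s A) (le_preimage s A W) (scal s (prodIncl s A ⁻¹ᵁ W) c) := by
  rw [sharp_scal, scal, scal, RingHom.comp_apply, RingHom.comp_apply]
  have h : (Scheme.ΓSpecIso (.of A)).inv.hom (algebraMap k A c) =
      sharp (Spec.map (CommRingCat.ofHom (algebraMap k A))) (le_preimage_top _ ⊤)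
        ((Scheme.ΓSpecIso (.of k)).inv.hom c) := by
    have := congr($(Scheme.ΓSpecIso_inv_naturality (CommRingCat.ofHom (algebraMap k A))) c)
    rw [Scheme.Hom.appTop, Scheme.Hom.app_eq_appLE] at this
    exact this
  rw [h, sharp_sharp]
  exact sharp_congr pullback.condition.symm _ _ _

/-- `(x_i) ↦ ∑ b_i x_i`, where `b` is a basis of `A`. -/
def coordSum (W : (prodSpec s A).Opens)
    (x : Fin (Module.finrank k A) → Γ(X, prodIncl s A ⁻¹ᵁ W)) : Γ(prodSpec s A, W) :=
  ∑ i, scal (prodSnd s A) W (Module.finBasis k A i) *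
    sharp (prodFst s A) (le_preimage s A W) (x i)

theorem coordSum_bijective_of_isAffineOpen {W : (prodSpec s A).Opens} (hW : IsAffineOpen W) :
    Function.Bijective (coordSum s A W) := by
  have H := isPushout_sections s A hW
  let _ : Algebra k Γ(X, prodIncl s A ⁻¹ᵁ W) := (scal s (prodIncl s A ⁻¹ᵁ W)).toAlgebra
  have H' := CommRingCat.isPushout_tensorProduct k Γ(X, prodIncl s A ⁻¹ᵁ W) A
  let e := (H'.isoIsPushout _ _ H).commRingCatIsoToRingEquiv
  have e1 : ∀ b, e (b ⊗ₜ 1) = sharp (prodFst s A) (le_preimage s A W) b :=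
    fun b => congr($(H'.inl_isoIsPushout_hom _ _ H) b)
  have e2 : ∀ a, e (1 ⊗ₜ a) = scal (prodSnd s A) W a :=
    fun a => congr($(H'.inr_isoIsPushout_hom _ _ H) a)
  let e' := (TensorProduct.equivFinsuppOfBasisRight (M := Γ(X, prodIncl s A ⁻¹ᵁ W))
    (Module.finBasis k A)).symm
  have h : coordSum s A W = fun x => e (e' (Finsupp.equivFunOnFinite.symm x)) := by
    funext x
    simp only [e', TensorProduct.equivFinsuppOfBasisRight_symm_apply]
    rw [Finsupp.sum_fintype _ _ (by simp), map_sum, coordSum]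
    refine Finset.sum_congr rfl fun i _ => ?_
    rw [← e1, ← e2, ← map_mul, Algebra.TensorProduct.tmul_mul_tmul, one_mul, mul_one]
    rfl
  rw [h]
  exact (e.bijective.comp e'.bijective).comp Finsupp.equivFunOnFinite.symm.bijective

theorem coordSum_sub (W : (prodSpec s A).Opens) (x y) :
    coordSum s A W (x - y) = coordSum s A W x - coordSum s A W y := by
  simp [coordSum, mul_sub]

theorem res_coordSum {W W' : (prodSpec s A).Opens} (h : W' ≤ W) (x) :
    res _ h (coordSum s A W x) = coordSum s A W' (fun i => res X ((prodIncl s A).preimage_mono h) (x i)) := by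
  simp only [coordSum, map_sum, map_mul, res_scal]
  refine Finset.sum_congr rfl fun i _ => ?_
  rw [res_sharp, sharp_res]

theorem le_iSup_affine {Z : Scheme.{u}} (W : Z.Opens) :
    W ≤ ⨆ V : {V : Z.affineOpens // V.1 ≤ W}, V.1.1 := by
  intro x hx
  obtain ⟨_, ⟨V, hV, rfl⟩, hxV, hVW⟩ :=
    Z.isBasis_affineOpens.exists_subset_of_mem_open hx W.2
  exact Opens.mem_iSup.2 ⟨⟨⟨V, hV⟩, hVW⟩, hxV⟩

theorem le_iSup_preimage_affine (W : (prodSpec s A).Opens) :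
    prodIncl s A ⁻¹ᵁ W ≤
      ⨆ V : {V : (prodSpec s A).affineOpens // V.1 ≤ W}, prodIncl s A ⁻¹ᵁ V.1.1 := by
  rw [← Scheme.Hom.preimage_iSup]
  exact (prodIncl s A).preimage_mono (le_iSup_affine W)

theorem coordSum_injective (W : (prodSpec s A).Opens) : Function.Injective (coordSum s A W) := by
  intro x y hxy
  funext i
  refine X.sheaf.eq_of_locally_eq' (fun V : {V : (prodSpec s A).affineOpens // V.1 ≤ W} =>
    prodIncl s A ⁻¹ᵁ V.1.1) _ (fun V => homOfLE ((prodIncl s A).preimage_mono V.2))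
    (le_iSup_preimage_affine s A W) _ _ fun V => ?_
  have := congrArg (res _ V.2) hxy
  rw [res_coordSum, res_coordSum] at this
  exact congrFun ((coordSum_bijective_of_isAffineOpen s A V.1.2).1 this) i

theorem coordSum_bijective (W : (prodSpec s A).Opens) : Function.Bijective (coordSum s A W) := by
  refine ⟨coordSum_injective s A W, fun r => ?_⟩
  choose x hx using fun V : {V : (prodSpec s A).affineOpens // V.1 ≤ W} =>
    (coordSum_bijective_of_isAffineOpen s A V.1.2).2 (res _ V.2 r)
  have res_res : ∀ {Z : Scheme.{u}} {U₁ U₂ U₃ : Z.Opens} (h : U₂ ≤ U₁) (h' : U₃ ≤ U₂) (a),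
      res Z h' (res Z h a) = res Z (h'.trans h) a := fun h h' a => by
    simp only [res, ← CommRingCat.comp_apply, ← Functor.map_comp]; rfl
  have glue := fun i => X.sheaf.existsUnique_gluing'
    (fun V : {V : (prodSpec s A).affineOpens // V.1 ≤ W} => prodIncl s A ⁻¹ᵁ V.1.1) _
    (fun V => homOfLE ((prodIncl s A).preimage_mono V.2)) (le_iSup_preimage_affine s A W)
    (fun V => x V i) (fun V V' => by
      have : coordSum s A (V.1.1 ⊓ V'.1.1)
          (fun i => res X ((prodIncl s A).preimage_mono inf_le_left) (x V i)) =
          coordSum s A (V.1.1 ⊓ V'.1.1)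
          (fun i => res X ((prodIncl s A).preimage_mono inf_le_right) (x V' i)) := by
        rw [← res_coordSum s A inf_le_left, ← res_coordSum s A inf_le_right, hx, hx, res_res,
          res_res]
      exact congrFun (coordSum_injective s A _ this) i)
  choose y hy _ using glue
  refine ⟨y, ?_⟩
  refine (prodSpec s A).sheaf.eq_of_locally_eq'
    (fun V : {V : (prodSpec s A).affineOpens // V.1 ≤ W} => V.1.1) _ (fun V => homOfLE V.2)
    (le_iSup_affine W) _ _ fun V => ?_
  have h1 := res_coordSum s A V.2 y
  refine h1.trans (Eq.trans ?_ (hx V))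
  congr 1
  funext i
  exact hy i V

end ProdSections
section TensorBracket

variable {k A B R : Type u} [CommRing k] [CommRing A] [CommRing B] [CommRing R] [Algebra k A]
  [Algebra k B]

/-- The homomorphism `A ⊗ B → R` given by homomorphisms `A → R` and `B → R` that agree on `k`. -/
def tensorHom (α : A →+* R) (β : B →+* R)
    (h : ∀ c, β (algebraMap k B c) = α (algebraMap k A c)) : A ⊗[k] B →+* R :=
  letI : Algebra k R := (α.comp (algebraMap k A)).toAlgebra
  (Algebra.TensorProduct.lift (⟨α, fun _ => rfl⟩ : A →ₐ[k] R) (⟨β, h⟩ : B →ₐ[k] R)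
    (fun _ _ => Commute.all _ _)).toRingHom

theorem tensorHom_tmul (α : A →+* R) (β : B →+* R)
    (h : ∀ c, β (algebraMap k B c) = α (algebraMap k A c)) (a : A) (b : B) :
    tensorHom α β h (a ⊗ₜ b) = α a * β b := rfl

variable (A)

/-- The `A`-bilinear extension of a `k`-bilinear Poisson bracket on `B` to `A ⊗ B`. -/
def PoissonBracket.tensor (β : PoissonBracket B)
    (hβ : ∀ c b, β.br (algebraMap k B c) b = 0) : PoissonBracket (A ⊗[k] B) :=
  let m : B →ₗ[k] B →ₗ[k] B := LinearMap.mk₂ k (fun x y => β.br x y)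
    (fun x x' y => by simp) (fun c x y => by simp [Algebra.smul_def, β.leibniz', hβ])
    (fun x y y' => by simp)
    (fun c x y => by simp [Algebra.smul_def, β.leibniz, β.skew x (algebraMap k B c), hβ])
  let t : A ⊗[k] B →ₗ[k] A ⊗[k] B →ₗ[k] A ⊗[k] B := TensorProduct.map₂ (LinearMap.mul k A) m
  have ht : ∀ a b a' b', t (a ⊗ₜ b) (a' ⊗ₜ b') = (a * a') ⊗ₜ β.br b b' := fun _ _ _ _ => rfl
  have hskew : ∀ x y, t x y + t y x = 0 := fun x y => by
    induction x with
    | zero => simp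
    | add x x' h h' =>
      rw [map_add, map_add, LinearMap.add_apply, add_add_add_comm, h, h', add_zero]
    | tmul a b =>
      induction y with
      | zero => simp
      | add y y' h h' =>
        rw [map_add, map_add, LinearMap.add_apply, add_add_add_comm, h, h', add_zero]
      | tmul a' b' => rw [ht, ht, mul_comm a' a, ← TensorProduct.tmul_add, β.skew b, neg_add_cancel,
          TensorProduct.tmul_zero]
  { br := t.restrictScalars₁₂ ℤ ℤ
    self := fun x => by
      change t x x = 0
      induction x with
      | zero => simp
      | tmul a b => rw [ht, β.self, TensorProduct.tmul_zero]
      | add x y h h' =>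
        rw [map_add, map_add, LinearMap.add_apply, LinearMap.add_apply, h, h', zero_add, add_zero,
          add_comm, hskew]
    leibniz := fun x y z => by
      change t x (y * z) = y * t x z + z * t x y
      induction x with
      | zero => simp
      | add x x' h h' => simp only [map_add, LinearMap.add_apply, h, h']; ring
      | tmul a b =>
        induction y with
        | zero => simp
        | add y y' h h' => simp only [map_add, add_mul, h, h']; ring
        | tmul a' b' =>
          induction z with
          | zero => simp
          | add y y' h h' => simp only [map_add, mul_add, add_mul, h, h']; ring
          | tmul a'' b'' =>
            simp only [ht, Algebra.TensorProduct.tmul_mul_tmul, β.leibniz, TensorProduct.tmul_add]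
            rw [mul_left_comm a a' a'', mul_left_comm a'' a a', mul_comm a'' a',
              mul_left_comm a a' a'']
    jacobi := fun x y z => by
      change t x (t y z) = t (t x y) z + t y (t x z)
      induction x with
      | zero => simp
      | add x x' h h' => simp only [map_add, LinearMap.add_apply, h, h']; abel
      | tmul a b =>
        induction y with
        | zero => simp
        | add y y' h h' => simp only [map_add, LinearMap.add_apply, h, h']; abel
        | tmul a' b' =>
          induction z with
          | zero => simp
          | add y y' h h' => simp only [map_add, h, h']; abel
          | tmul a'' b'' =>
            simp only [ht]
            rw [mul_left_comm a' a a'', mul_assoc, ← TensorProduct.tmul_add, β.jacobi] }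

theorem PoissonBracket.tensor_tmul (β : PoissonBracket B)
    (hβ : ∀ c b, β.br (algebraMap k B c) b = 0) (a a' : A) (b b' : B) :
    (β.tensor A hβ).br (a ⊗ₜ b) (a' ⊗ₜ b') = (a * a') ⊗ₜ β.br b b' := rfl

/-- Transport of a Poisson bracket along a ring isomorphism. -/
def PoissonBracket.transport {S : Type u} [CommRing S] (β : PoissonBracket S) (e : S ≃+* R) :
    PoissonBracket R where
  br := (AddMonoidHom.mk' (fun r => (AddMonoidHom.mk' (fun r' => e (β.br (e.symm r) (e.symm r')))
    (fun x y => by simp)).toIntLinearMap) (fun x y => by ext; simp)).toIntLinearMap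
  self r := by simp [β.self]
  leibniz a b c := by simp [β.leibniz]
  jacobi a b c := by simp [β.jacobi (e.symm a) (e.symm b) (e.symm c)]

end TensorBracket

/-- A Poisson structure over `S` on a scheme `X` over `S`: Poisson brackets on the rings of sections,
compatible with restriction, for which the sections coming from `S` are Casimir (so that the
brackets are `𝒪_S`-bilinear). -/
structure PoissonStructure {X S : Scheme.{u}} (s : X ⟶ S) where
  bracket : ∀ U : X.Opens, PoissonBracket Γ(X, U)
  res_bracket : ∀ {U V : X.Opens} (h : V ≤ U) (a b : Γ(X, U)),
    res X h ((bracket U).br a b) = (bracket V).br (res X h a) (res X h b)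
  base_bracket : ∀ {T : S.Opens} {U : X.Opens} (h : U ≤ s ⁻¹ᵁ T) (c : Γ(S, T)) (a : Γ(X, U)),
    (bracket U).br (sharp s h c) a = 0

/-- A Poisson scheme over `S`. -/
structure PoissonScheme (S : Scheme.{u}) where
  X : Scheme.{u}
  str : X ⟶ S
  poisson : PoissonStructure str

/-- A morphism of Poisson schemes over `S`. -/
@[ext]
structure PoissonScheme.Hom {S : Scheme.{u}} (X Y : PoissonScheme S) where
  hom : X.X ⟶ Y.X
  w : hom ≫ Y.str = X.str
  sharp_bracket : ∀ {V : Y.X.Opens} {U : X.X.Opens} (h : U ≤ hom ⁻¹ᵁ V) (a b : Γ(Y.X, V)),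
    sharp hom h ((Y.poisson.bracket V).br a b) =
      (X.poisson.bracket U).br (sharp hom h a) (sharp hom h b)

section ProdPoisson

variable {k : Type u} [Field k] {X : Scheme.{u}} {s : X ⟶ Spec (.of k)}
  (Λ : PoissonStructure s) (A : Type u) [CommRing A] [Algebra k A] [IsArtAlg k A]

/-- The canonical map `A ⊗ Γ(X, U) → Γ(X × Spec A, U × Spec A)`, where `U = X ∩ W`. -/
def prodSections (s : X ⟶ Spec (.of k)) (W : (prodSpec s A).Opens) :
    letI : Algebra k Γ(X, prodIncl s A ⁻¹ᵁ W) := (scal s _).toAlgebra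
    A ⊗[k] Γ(X, prodIncl s A ⁻¹ᵁ W) →+* Γ(prodSpec s A, W) :=
  letI : Algebra k Γ(X, prodIncl s A ⁻¹ᵁ W) := (scal s _).toAlgebra
  tensorHom (scal (prodSnd s A) W) (sharp (prodFst s A) (le_preimage s A W))
    (fun c => (scal_prod s A W c).symm)

theorem prodSections_bijective (s : X ⟶ Spec (.of k)) (W : (prodSpec s A).Opens) :
    Function.Bijective (prodSections A s W) := by
  let _ : Algebra k Γ(X, prodIncl s A ⁻¹ᵁ W) := (scal s _).toAlgebra
  let e' := (TensorProduct.equivFinsuppOfBasisLeft (N := Γ(X, prodIncl s A ⁻¹ᵁ W))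
    (Module.finBasis k A)).symm
  let e := Finsupp.equivFunOnFinite.symm.trans e'.toEquiv
  have h : (prodSections A s W) ∘ e = coordSum s A W := by
    funext x
    simp only [e, e', Function.comp_apply, Equiv.trans_apply, LinearEquiv.coe_toEquiv,
      TensorProduct.equivFinsuppOfBasisLeft_symm_apply]
    rw [Finsupp.sum_fintype _ _ (by simp), map_sum, coordSum]
    rfl
  have := coordSum_bijective s A W
  rw [← h] at this
  exact (Function.Bijective.of_comp_iff _ e.bijective).1 this

theorem PoissonStructure.scal_bracket (U : X.Opens) (c : k) (a : Γ(X, U)) :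
    (Λ.bracket U).br (scal s U c) a = 0 :=
  Λ.base_bracket _ _ _

/-- The bracket on `Γ(X × Spec A, W) = A ⊗ Γ(X, X ∩ W)` extending that of `X` bilinearly over `A`. -/
def PoissonStructure.prodBracket (W : (prodSpec s A).Opens) :
    PoissonBracket Γ(prodSpec s A, W) :=
  letI : Algebra k Γ(X, prodIncl s A ⁻¹ᵁ W) := (scal s _).toAlgebra
  ((Λ.bracket (prodIncl s A ⁻¹ᵁ W)).tensor A (Λ.scal_bracket _)).transport
    (RingEquiv.ofBijective (prodSections A s W) (prodSections_bijective A s W))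

theorem PoissonStructure.prodBracket_mul (W : (prodSpec s A).Opens) (a a' : A)
    (x x' : Γ(X, prodIncl s A ⁻¹ᵁ W)) :
    (Λ.prodBracket A W).br
        (scal (prodSnd s A) W a * sharp (prodFst s A) (le_preimage s A W) x)
        (scal (prodSnd s A) W a' * sharp (prodFst s A) (le_preimage s A W) x') =
      scal (prodSnd s A) W (a * a') * sharp (prodFst s A) (le_preimage s A W)
        ((Λ.bracket (prodIncl s A ⁻¹ᵁ W)).br x x') := by
  let _ : Algebra k Γ(X, prodIncl s A ⁻¹ᵁ W) := (scal s _).toAlgebra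
  let e := RingEquiv.ofBijective (prodSections A s W) (prodSections_bijective A s W)
  have he : ∀ a x, scal (prodSnd s A) W a * sharp (prodFst s A) (le_preimage s A W) x =
    e (a ⊗ₜ x) := fun _ _ => rfl
  rw [he, he, he]
  change e (((Λ.bracket (prodIncl s A ⁻¹ᵁ W)).tensor A (Λ.scal_bracket _)).br
    (e.symm (e _)) (e.symm (e _))) = _
  rw [e.symm_apply_apply, e.symm_apply_apply, PoissonBracket.tensor_tmul]

theorem prod_induction {W : (prodSpec s A).Opens} {P : Γ(prodSpec s A, W) → Prop}
    (add : ∀ r r', P r → P r' → P (r + r'))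
    (mul : ∀ a x, P (scal (prodSnd s A) W a * sharp (prodFst s A) (le_preimage s A W) x)) (r) :
    P r := by
  let _ : Algebra k Γ(X, prodIncl s A ⁻¹ᵁ W) := (scal s _).toAlgebra
  obtain ⟨z, rfl⟩ := (prodSections_bijective A s W).2 r
  induction z with
  | zero => simpa using mul 0 0
  | tmul a x => exact mul a x
  | add z z' h h' => rw [map_add]; exact add _ _ h h'

/-- The Poisson structure over `A` on `X × Spec A` extending that of `X`. -/
def PoissonStructure.prod : PoissonStructure (prodSnd s A) where
  bracket := Λ.prodBracket A
  res_bracket {U V} h r r' := by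
    induction r using prod_induction with
    | add r₁ r₂ h₁ h₂ => simp only [map_add, LinearMap.add_apply, h₁, h₂]
    | mul a x =>
      induction r' using prod_induction with
      | add r₁ r₂ h₁ h₂ => simp only [map_add, h₁, h₂]
      | mul a' x' =>
        have e : ∀ a x, res _ h (scal (prodSnd s A) U a *
            sharp (prodFst s A) (le_preimage s A U) x) =
            scal (prodSnd s A) V a * sharp (prodFst s A) (le_preimage s A V)
              (res X ((prodIncl s A).preimage_mono h) x) := fun a x => by
          rw [map_mul, res_scal, res_sharp, sharp_res]
        rw [Λ.prodBracket_mul, e, e, e, Λ.prodBracket_mul, Λ.res_bracket]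
  base_bracket {T U} h c r := by
    have hsub : Subsingleton (Spec (.of A)) := inferInstanceAs (Subsingleton (PrimeSpectrum A))
    by_cases hT : T = ⊤
    · subst hT
      have hc : sharp (prodSnd s A) h c = scal (prodSnd s A) U ((Scheme.ΓSpecIso (.of A)).hom c) *
          sharp (prodFst s A) (le_preimage s A U) 1 := by
        rw [map_one, mul_one, scal, RingHom.comp_apply]
        congr 1
        exact congr($((Scheme.ΓSpecIso (.of A)).hom_inv_id.symm) c)
      induction r using prod_induction with
      | add r₁ r₂ h₁ h₂ => rw [map_add, h₁, h₂, add_zero]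
      | mul a x =>
        have := Λ.scal_bracket (prodIncl s A ⁻¹ᵁ U) 1 x
        rw [map_one] at this
        rw [hc, Λ.prodBracket_mul, this, map_zero, mul_zero]
    · have hU : U = ⊥ := by
        ext x
        simp only [SetLike.mem_coe, Opens.mem_bot, iff_false]
        intro hx
        refine hT (top_le_iff.1 fun y _ => ?_)
        rw [Subsingleton.elim y (prodSnd s A x)]
        exact h hx
      subst hU
      exact Subsingleton.elim _ _

end ProdPoisson

/-- The Poisson scheme `(X × Spec A, Λ₀)` over `Spec A`. -/
abbrev PoissonScheme.prod {k : Type u} [Field k] (X : PoissonScheme (Spec (.of k))) (A : Type u)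
    [CommRing A] [Algebra k A] [IsArtAlg k A] : PoissonScheme (Spec (.of A)) where
  X := prodSpec X.str A
  str := prodSnd X.str A
  poisson := X.poisson.prod A

/-! ### Čech hypercohomology -/

/-- A complex `K⁰ → K¹ → ⋯` of presheaves of abelian groups on a topological space. -/
structure PresheafComplex (T : Type u) [TopologicalSpace T] where
  obj : ℕ → Opens T → Type u
  grp : ∀ q U, AddCommGroup (obj q U)
  res : ∀ q {U V : Opens T}, V ≤ U → (obj q U →+ obj q V)
  res_self : ∀ q {U : Opens T} (x : obj q U), res q le_rfl x = x
  res_res : ∀ q {U V W : Opens T} (h : V ≤ U) (h' : W ≤ V) (x : obj q U),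
    res q h' (res q h x) = res q (h'.trans h) x
  d : ∀ q (U : Opens T), obj q U →+ obj (q + 1) U
  d_d : ∀ q (U : Opens T) (x : obj q U), d (q + 1) U (d q U x) = 0
  d_res : ∀ q {U V : Opens T} (h : V ≤ U) (x : obj q U), d q V (res q h x) = res (q + 1) h (d q U x)

attribute [instance] PresheafComplex.grp

/-- An open cover of `T` indexed by the points of `T`, with `x ∈ 𝒰 x`. -/
structure PointCover (T : Type u) [TopologicalSpace T] where
  nhd : T → Opens T
  mem : ∀ x, x ∈ nhd x

/-- Point covers are ordered by refinement, the finer covers being the larger ones. -/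
instance (T : Type u) [TopologicalSpace T] : Preorder (PointCover T) where
  le 𝒰 𝒱 := ∀ x, 𝒱.nhd x ≤ 𝒰.nhd x
  le_refl _ _ := le_rfl
  le_trans _ _ _ h h' x := (h' x).trans (h x)

instance (T : Type u) [TopologicalSpace T] : Nonempty (PointCover T) := ⟨⟨fun _ => ⊤, fun _ => trivial⟩⟩

instance (T : Type u) [TopologicalSpace T] : IsDirectedOrder (PointCover T) :=
  ⟨fun 𝒰 𝒱 => ⟨⟨fun x => 𝒰.nhd x ⊓ 𝒱.nhd x, fun x => ⟨𝒰.mem x, 𝒱.mem x⟩⟩,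
    fun _ => inf_le_left, fun _ => inf_le_right⟩⟩

section Cech

variable {T : Type u} [TopologicalSpace T]

/-- The intersection of the members of a cover with the indices `s 0, …, s p`. -/
def PointCover.inter (𝒰 : PointCover T) {p : ℕ} (s : Fin (p + 1) → T) : Opens T :=
  ⨅ j, 𝒰.nhd (s j)

theorem PointCover.inter_removeNth (𝒰 : PointCover T) {p : ℕ} (s : Fin (p + 2) → T)
    (j : Fin (p + 2)) : 𝒰.inter s ≤ 𝒰.inter (p := p) (j.removeNth s) :=
  le_iInf fun i => iInf_le (fun j => 𝒰.nhd (s j)) (j.succAbove i)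

theorem PointCover.inter_mono {𝒰 𝒱 : PointCover T} (h : 𝒰 ≤ 𝒱) {p : ℕ} (s : Fin (p + 1) → T) :
    𝒱.inter s ≤ 𝒰.inter s :=
  iInf_mono fun j => h (s j)

namespace PresheafComplex

variable (K : PresheafComplex T) (𝒰 : PointCover T)

/-- The Čech cochains `C^p(𝒰, K^q)`. -/
abbrev Cochain (p q : ℕ) : Type u := ∀ s : Fin (p + 1) → T, K.obj q (𝒰.inter s)

/-- The Čech differential `δ : C^p(𝒰, K^q) → C^(p+1)(𝒰, K^q)`. -/
def cechD (p q : ℕ) : K.Cochain 𝒰 p q →+ K.Cochain 𝒰 (p + 1) q :=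
  AddMonoidHom.mk' (fun c s => ∑ j : Fin (p + 2), (-1 : ℤ) ^ (j : ℕ) •
    K.res q (𝒰.inter_removeNth s j) (c (j.removeNth s)))
    (fun c c' => by funext s; simp [Finset.sum_add_distrib])

/-- The differential `C^p(𝒰, K^q) → C^p(𝒰, K^(q+1))` of `K`. -/
def vertD (p q : ℕ) : K.Cochain 𝒰 p q →+ K.Cochain 𝒰 p (q + 1) :=
  AddMonoidHom.mk' (fun c s => K.d q _ (c s)) (fun c c' => by funext s; simp)

/-- The total complex: `⨁_{p + q = n} C^p(𝒰, K^q)`. -/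
abbrev Tot (n : ℕ) : Type u := ∀ i : {i : ℕ × ℕ // i.1 + i.2 = n}, K.Cochain 𝒰 i.1.1 i.1.2

/-- The part of the total differential given by the differential of `K`. -/
def totVert {n : ℕ} (x : K.Tot 𝒰 n) : ∀ p q : ℕ, p + q = n + 1 → K.Cochain 𝒰 p q
  | _, 0, _ => 0
  | p, q + 1, h => K.vertD 𝒰 p q (x ⟨(p, q), Nat.succ.inj h⟩)

/-- The part of the total differential given by the Čech differential. -/
def totCech {n : ℕ} (x : K.Tot 𝒰 n) : ∀ p q : ℕ, p + q = n + 1 → K.Cochain 𝒰 p q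
  | 0, _, _ => 0
  | p + 1, q, h => K.cechD 𝒰 p q (x ⟨(p, q), by dsimp only; omega⟩)

/-- The total differential `D = d + (-1)^(n+1) δ` in degree `n`. -/
def totD (n : ℕ) : K.Tot 𝒰 n →+ K.Tot 𝒰 (n + 1) :=
  AddMonoidHom.mk' (fun x i => K.totVert 𝒰 x _ _ i.2 + (-1 : ℤ) ^ (n + 1) • K.totCech 𝒰 x _ _ i.2)
    (fun x y => by
      funext ⟨⟨p, q⟩, h⟩
      have h1 : K.totVert 𝒰 (x + y) p q h = K.totVert 𝒰 x p q h + K.totVert 𝒰 y p q h := by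
        cases q <;> simp [totVert]
      have h2 : K.totCech 𝒰 (x + y) p q h = K.totCech 𝒰 x p q h + K.totCech 𝒰 y p q h := by
        cases p <;> simp [totCech]
      simp only [h1, h2, Pi.add_apply, smul_add]
      abel)

/-- The coboundaries of degree `n`. -/
def cobound : ∀ n : ℕ, AddSubgroup (K.Tot 𝒰 n)
  | 0 => ⊥
  | n + 1 => (K.totD 𝒰 n).range

/-- The hypercohomology `ℍ^n(𝒰, K)` of a cover: cocycles modulo coboundaries. -/
abbrev CoverH (n : ℕ) : Type u :=
  (K.totD 𝒰 n).ker ⧸ (K.cobound 𝒰 n).addSubgroupOf (K.totD 𝒰 n).ker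

variable {𝒰}

/-- Restriction of cochains to a finer cover. -/
def totRes {𝒱 : PointCover T} (h : 𝒰 ≤ 𝒱) (n : ℕ) : K.Tot 𝒰 n →+ K.Tot 𝒱 n :=
  AddMonoidHom.mk' (fun x i s => K.res i.1.2 (PointCover.inter_mono h s) (x i s))
    (fun x y => by funext i s; simp)

theorem totD_totRes {𝒱 : PointCover T} (h : 𝒰 ≤ 𝒱) (n : ℕ) (x : K.Tot 𝒰 n) :
    K.totD 𝒱 n (K.totRes h n x) = K.totRes h (n + 1) (K.totD 𝒰 n x) := by
  funext ⟨⟨p, q⟩, e⟩ s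
  simp only [totD, totRes, AddMonoidHom.mk'_apply, Pi.add_apply, Pi.smul_apply, map_add, map_zsmul]
  congr 1
  · cases q with
    | zero => simp [totVert]
    | succ q => exact K.d_res q _ _
  · congr 1
    cases p with
    | zero => simp [totCech]
    | succ p =>
      simp only [totCech, cechD, AddMonoidHom.mk'_apply, map_sum, map_zsmul, K.res_res]

theorem totRes_mem_cobound {𝒱 : PointCover T} (h : 𝒰 ≤ 𝒱) (n : ℕ) (x : K.Tot 𝒰 n)
    (hx : x ∈ K.cobound 𝒰 n) : K.totRes h n x ∈ K.cobound 𝒱 n := by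
  cases n with
  | zero =>
    obtain rfl : x = 0 := hx
    rw [map_zero]
    exact zero_mem _
  | succ n =>
    obtain ⟨y, rfl⟩ := hx
    exact ⟨K.totRes h n y, K.totD_totRes h n y⟩

theorem totRes_mem_ker {𝒱 : PointCover T} (h : 𝒰 ≤ 𝒱) (n : ℕ) (x : K.Tot 𝒰 n)
    (hx : x ∈ (K.totD 𝒰 n).ker) : K.totRes h n x ∈ (K.totD 𝒱 n).ker := by
  rw [AddMonoidHom.mem_ker] at hx ⊢
  rw [K.totD_totRes, hx, map_zero]

/-- The map `ℍ^n(𝒰, K) → ℍ^n(𝒱, K)` for a finer cover `𝒱`. -/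
def coverHMap (n : ℕ) (𝒰 𝒱 : PointCover T) (h : 𝒰 ≤ 𝒱) : K.CoverH 𝒰 n →+ K.CoverH 𝒱 n :=
  QuotientAddGroup.map _ _ (((K.totRes h n).comp (AddSubgroup.subtype _)).codRestrict _
    (fun x => K.totRes_mem_ker h n x.1 x.2)) (fun x hx => K.totRes_mem_cobound h n x.1 hx)

open scoped Classical in
/-- The Čech hypercohomology `ℍ^n(T, K) = colim_𝒰 ℍ^n(𝒰, K)`. -/
def HyperH (n : ℕ) : Type u := AddCommGroup.DirectLimit (fun 𝒰 => K.CoverH 𝒰 n) (K.coverHMap n)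

open scoped Classical in
instance (n : ℕ) : AddCommGroup (K.HyperH n) :=
  inferInstanceAs (AddCommGroup (AddCommGroup.DirectLimit _ (K.coverHMap n)))

open scoped Classical in
/-- The class in `ℍ^n(T, K)` of a cocycle of a cover. -/
def cls (n : ℕ) (𝒰 : PointCover T) (α : (K.totD 𝒰 n).ker) : K.HyperH n :=
  AddCommGroup.DirectLimit.of (fun 𝒰 => K.CoverH 𝒰 n) (K.coverHMap n) 𝒰 (QuotientAddGroup.mk α)

end PresheafComplex

end Cech

/-! ### The complex `f^* T_Y^•` -/

section PolyVector

variable {S : Scheme.{u}} {X Y : PoissonScheme S} (f : PoissonScheme.Hom X Y)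

/-- The pairs of an open subset `V` of `Y` and an open subset `W ⊆ U ∩ f⁻¹(V)` of `X`. -/
structure OpenPair (U : X.X.Opens) where
  V : Y.X.Opens
  W : X.X.Opens
  le : W ≤ U
  maps : W ≤ f.hom ⁻¹ᵁ V

variable {f} in
/-- A pair for `U` as a pair for a larger open subset. -/
abbrev OpenPair.mono {U U' : X.X.Opens} (i : OpenPair f U) (h : U ≤ U') : OpenPair f U' :=
  ⟨i.V, i.W, i.le.trans h, i.maps⟩

/-- The sections of `⋀^(q+1) f^* T_Y` over `U`: alternating multiderivations over `S`, relative to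
`f^♯`, from the sections of `𝒪_Y` over `V` to those of `𝒪_X` over `W`, for `W ⊆ U ∩ f⁻¹(V)`,
compatible with restriction. -/
def polyVec (q : ℕ) (U : X.X.Opens) :
    AddSubgroup (∀ i : OpenPair f U, Γ(Y.X, i.V) [⋀^Fin (q + 1)]→ₗ[ℤ] Γ(X.X, i.W)) where
  carrier := {Q |
    (∀ i, IsMultiDer (sharp f.hom i.maps) (Q i)) ∧
    (∀ i (R : S.Opens) (hR : i.V ≤ Y.str ⁻¹ᵁ R) (c : Γ(S, R)) v,
      Q i (Matrix.vecCons (sharp Y.str hR c) v) = 0) ∧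
    (∀ i j (hV : j.V ≤ i.V) (hW : j.W ≤ i.W) v,
      Q j (fun l => res Y.X hV (v l)) = res X.X hW (Q i v))}
  zero_mem' := ⟨fun i a b v => by simp, fun i R hR c v => by simp, fun i j hV hW v => by simp⟩
  add_mem' {Q Q'} hQ hQ' := by
    refine ⟨fun i a b v => ?_, fun i R hR c v => ?_, fun i j hV hW v => ?_⟩
    · simp only [Pi.add_apply, AlternatingMap.add_apply, hQ.1 i a b v, hQ'.1 i a b v]
      ring
    · simp only [Pi.add_apply, AlternatingMap.add_apply, hQ.2.1 i R hR c v, hQ'.2.1 i R hR c v,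
        add_zero]
    · simp only [Pi.add_apply, AlternatingMap.add_apply, hQ.2.2 i j hV hW v,
        hQ'.2.2 i j hV hW v, map_add]
  neg_mem' {Q} hQ := by
    refine ⟨fun i a b v => ?_, fun i R hR c v => ?_, fun i j hV hW v => ?_⟩
    · simp only [Pi.neg_apply, AlternatingMap.neg_apply, hQ.1 i a b v]
      ring
    · simp only [Pi.neg_apply, AlternatingMap.neg_apply, hQ.2.1 i R hR c v, neg_zero]
    · simp only [Pi.neg_apply, AlternatingMap.neg_apply, hQ.2.2 i j hV hW v, map_neg]

/-- The differential `π : ⋀^(q+1) f^* T_Y → ⋀^(q+2) f^* T_Y`. -/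
def polyVecD (q : ℕ) (U : X.X.Opens) : polyVec f q U →+ polyVec f (q + 1) U :=
  AddMonoidHom.mk' (fun Q => ⟨fun i =>
      polyDiff (sharp f.hom i.maps) (Y.poisson.bracket i.V) (X.poisson.bracket i.W) (Q.1 i), by
    obtain ⟨Q, hQ⟩ := Q
    refine ⟨fun i => ?_, fun i R hR c v => ?_, fun i j hV hW v => ?_⟩
    · exact (hQ.1 i).polyDiff _ _ _ (f.sharp_bracket i.maps)
    · refine polyDiff_const _ _ _ (hQ.2.1 i R hR c) (Y.poisson.base_bracket hR c) (fun a => ?_) v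
      rw [sharp_sharp, sharp_congr f.w _ (by
        rw [← f.w]; exact i.maps.trans (f.hom.preimage_mono hR))]
      exact X.poisson.base_bracket _ c a
    · refine polyDiff_natural _ _ _ (res Y.X hV) (res X.X hW) (Y.poisson.res_bracket hV)
        (X.poisson.res_bracket hW) (fun a => ?_) (hQ.2.2 i j hV hW) v
      rw [sharp_res, res_sharp]⟩)
    (fun Q Q' => by
      refine Subtype.ext ?_
      funext i
      exact polyDiff_add _ _ _ _ _)

/-- The complex `f^* T_Y^• : f^* T_Y → ⋀² f^* T_Y → ⋀³ f^* T_Y → ⋯` of sheaves on `X`. -/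
def polyComplex : PresheafComplex X.X where
  obj q U := polyVec f q U
  grp _ _ := inferInstance
  res _ _ _ h := AddMonoidHom.mk' (fun Q => ⟨fun i => Q.1 (i.mono h),
    fun i => Q.2.1 (i.mono h), fun i => Q.2.2.1 (i.mono h),
    fun i j hV hW v => Q.2.2.2 (i.mono h) (j.mono h) hV hW v⟩)
    (fun _ _ => rfl)
  res_self _ _ _ := rfl
  res_res _ _ _ _ _ _ _ := rfl
  d q U := polyVecD f q U
  d_d _ _ Q := Subtype.ext (funext fun i => polyDiff_polyDiff (f.sharp_bracket i.maps) (Q.1 i))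
  d_res _ _ _ _ _ := rfl

end PolyVector

/-! ### Deformations with fixed domain and target -/

section Deformations

variable {k : Type u} [Field k] {X Y : PoissonScheme (Spec (.of k))} (f : PoissonScheme.Hom X Y)

/-- Infinitesimal deformations of `f` over `A` leaving domain and target fixed: Poisson morphisms
`(X × Spec A, Λ₀) ⟶ (Y × Spec A, Π₀)` over `Spec A` inducing `f` on the closed fibres. -/
def Def (A : Type u) [CommRing A] [Algebra k A] [IsArtAlg k A] : Type u :=
  {Ψ : PoissonScheme.Hom (X.prod A) (Y.prod A) //
    prodIncl X.str A ≫ Ψ.hom = f.hom ≫ prodIncl Y.str A}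

variable {f} {A A' : Type u} [CommRing A] [Algebra k A] [IsArtAlg k A]
  [CommRing A'] [Algebra k A'] [IsArtAlg k A']

/-- The underlying morphism of schemes `X × Spec A ⟶ Y × Spec A` of a deformation. -/
def Def.hom (Ψ : Def f A) : prodSpec X.str A ⟶ prodSpec Y.str A := Ψ.1.hom

theorem Def.incl_hom (Ψ : Def f A) : prodIncl X.str A ≫ Ψ.hom = f.hom ≫ prodIncl Y.str A := Ψ.2

/-- `0 → (t) → A' → A → 0` is a small extension. -/
structure IsSmallExt (φ : A' →ₐ[k] A) (t : A') : Prop where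
  surjective : Function.Surjective φ
  ker : RingHom.ker φ = Ideal.span {t}
  ne_zero : t ≠ 0
  mul : ∀ m ∈ IsLocalRing.maximalIdeal A', m * t = 0

/-- `Ψ'` is a lifting of `Ψ` along `φ : A' → A`. -/
def IsLifting (Ψ : Def f A) (φ : A' →ₐ[k] A) (Ψ' : Def f A') : Prop :=
  prodMap X.str φ ≫ Ψ'.hom = Ψ.hom ≫ prodMap Y.str φ

/-- A lifting of `Ψ` over an open subset `U` of `X`, as a morphism of schemes `U × Spec A' ⟶
Y × Spec A'` over `Spec A'` (not necessarily a Poisson morphism). -/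
structure LocalLift (Ψ : Def f A) (φ : A' →ₐ[k] A) (U : X.X.Opens) where
  hom : ((prodFst X.str A' ⁻¹ᵁ U : (prodSpec X.str A').Opens) : Scheme.{u}) ⟶ prodSpec Y.str A'
  w : hom ≫ prodSnd Y.str A' = (prodFst X.str A' ⁻¹ᵁ U).ι ≫ prodSnd X.str A'
  lift : prodMap X.str φ ∣_ (prodFst X.str A' ⁻¹ᵁ U) ≫ hom =
    (prodMap X.str φ ⁻¹ᵁ (prodFst X.str A' ⁻¹ᵁ U)).ι ≫ Ψ.hom ≫ prodMap Y.str φ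

theorem preimage_eq (Ψ : Def f A) (V : Y.X.Opens) :
    (Ψ.hom ≫ prodFst Y.str A) ⁻¹ᵁ V = prodFst X.str A ⁻¹ᵁ (f.hom ⁻¹ᵁ V) := by
  have h : prodIncl X.str A ≫ Ψ.hom ≫ prodFst Y.str A = f.hom := by
    rw [← Category.assoc, Ψ.incl_hom, Category.assoc, prodIncl_fst, Category.comp_id]
  conv_rhs => rw [← h]
  exact (preimage_preimage X.str A _).symm

theorem aug_comp (φ : A' →ₐ[k] A) : (aug k A).comp φ = aug k A' := by
  ext a
  obtain ⟨c, hc⟩ := (IsArtAlg.bijective (k := k) (A := A')).2 (IsLocalRing.residue A' a)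
  have hm : a - algebraMap k A' c ∈ IsLocalRing.maximalIdeal A' := by
    rw [← IsLocalRing.residue_eq_zero_iff, map_sub, ← hc, sub_eq_zero]
    rfl
  have key : ∀ ψ : A' →ₐ[k] k, ψ (a - algebraMap k A' c) = 0 := fun ψ => by
    obtain ⟨n, hn⟩ := IsArtinianRing.isNilpotent_jacobson_bot (R := A')
    rw [IsLocalRing.jacobson_eq_maximalIdeal ⊥ bot_ne_top] at hn
    have : (a - algebraMap k A' c) ^ n = 0 := by
      have := Ideal.pow_mem_pow hm n
      rwa [hn] at this
    exact eq_zero_of_pow_eq_zero (by rw [← map_pow, this, map_zero])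
  have h : ∀ ψ : A' →ₐ[k] k, ψ a = c := fun ψ => by
    have := key ψ
    rwa [map_sub, AlgHom.commutes, sub_eq_zero] at this
  rw [h, h]

theorem prodIncl_prodMap {X : Scheme.{u}} (s : X ⟶ Spec (.of k)) (φ : A' →ₐ[k] A) :
    prodIncl s A ≫ prodMap s φ = prodIncl s A' := by
  apply pullback.hom_ext
  · rw [Category.assoc, prodIncl_fst]
    exact (congrArg (prodIncl s A ≫ ·) (pullback.lift_fst _ _ _)).trans (prodIncl_fst s A)
  · have h1 : prodMap s φ ≫ prodSnd s A' = prodSnd s A ≫ Spec.map (CommRingCat.ofHom φ.toRingHom) :=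
      pullback.lift_snd _ _ _
    have h2 : ∀ (A : Type u) [CommRing A] [Algebra k A] [IsArtAlg k A], prodIncl s A ≫ prodSnd s A =
        s ≫ Spec.map (CommRingCat.ofHom (aug k A).toRingHom) := fun A => pullback.lift_snd _ _ _
    rw [Category.assoc, h1, reassoc_of% (h2 A), h2 A', ← Spec.map_comp, ← CommRingCat.ofHom_comp,
      ← aug_comp φ]
    rfl

namespace LocalLift

variable {Ψ : Def f A} {φ : A' →ₐ[k] A} {U : X.X.Opens} (L : LocalLift Ψ φ U)

/-- The restriction of a local lifting to `W × Spec A'`, followed by the projection to `Y`. -/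
def toY {W : X.X.Opens} (hW : W ≤ U) :
    ((prodFst X.str A' ⁻¹ᵁ W : (prodSpec X.str A').Opens) : Scheme.{u}) ⟶ Y.X :=
  (prodSpec X.str A').homOfLE ((prodFst X.str A').preimage_mono hW) ≫ L.hom ≫ prodFst Y.str A'

theorem le_toY (i : OpenPair f U) : ⊤ ≤ L.toY i.le ⁻¹ᵁ i.V := by
  intro z _
  have hz : (prodFst X.str A' ⁻¹ᵁ i.W).ι z ∈ prodFst X.str A' ⁻¹ᵁ i.W := z.2
  obtain ⟨x, hx⟩ := (prodIncl X.str A').surjective ((prodFst X.str A' ⁻¹ᵁ i.W).ι z)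
  have e1 : prodFst X.str A' (prodIncl X.str A' x) = x := by
    rw [← Scheme.Hom.comp_apply, prodIncl_fst]; rfl
  rw [← hx] at hz
  have hxW : x ∈ i.W := by rw [← e1]; exact hz
  have e2 : prodMap X.str φ (prodIncl X.str A x) = prodIncl X.str A' x := by
    rw [← Scheme.Hom.comp_apply, prodIncl_prodMap]
  obtain ⟨y, hy⟩ : ∃ y, (prodMap X.str φ ⁻¹ᵁ (prodFst X.str A' ⁻¹ᵁ U)).ι y = prodIncl X.str A x :=
    ⟨⟨prodIncl X.str A x, by
      change prodMap X.str φ (prodIncl X.str A x) ∈ prodFst X.str A' ⁻¹ᵁ U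
      rw [e2]; exact i.le hz⟩, rfl⟩
  have e4 : (prodSpec X.str A').homOfLE ((prodFst X.str A').preimage_mono i.le) z =
      (prodMap X.str φ ∣_ (prodFst X.str A' ⁻¹ᵁ U)) y := by
    apply (prodFst X.str A' ⁻¹ᵁ U).ι.isOpenEmbedding.injective
    rw [← Scheme.Hom.comp_apply, ← Scheme.Hom.comp_apply, morphismRestrict_ι, Scheme.homOfLE_ι,
      Scheme.Hom.comp_apply, hy, e2, hx]
  have e6 : prodFst Y.str A' (prodMap Y.str φ (prodIncl Y.str A (f.hom x))) = f.hom x := by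
    rw [← Scheme.Hom.comp_apply (prodIncl Y.str A), prodIncl_prodMap, ← Scheme.Hom.comp_apply,
      prodIncl_fst]
    rfl
  have e7 : L.toY i.le z = f.hom x := by
    rw [toY, Scheme.Hom.comp_apply, e4, Scheme.Hom.comp_apply, ← Scheme.Hom.comp_apply _ L.hom,
      L.lift, Scheme.Hom.comp_apply, Scheme.Hom.comp_apply, hy, ← Scheme.Hom.comp_apply _ Ψ.hom,
      Ψ.incl_hom, Scheme.Hom.comp_apply, e6]
  change L.toY i.le z ∈ i.V
  rw [e7]
  exact i.maps hxW

/-- The ring homomorphism `Γ(Y, V) → Γ(X × Spec A', W × Spec A')` given by a local lifting. -/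
def sharp (i : OpenPair f U) :
    Γ(Y.X, i.V) →+* Γ(prodSpec X.str A', prodFst X.str A' ⁻¹ᵁ i.W) :=
  (prodFst X.str A' ⁻¹ᵁ i.W).topIso.hom.hom.comp (PoissonDef.sharp (L.toY i.le) (L.le_toY i))

end LocalLift

/-- The map `Γ(X, W) → Γ(X × Spec A, W × Spec A)`, `b ↦ t b`, for `t ∈ A`. -/
def tmul (s : X.X ⟶ Spec (.of k)) (t : A) {W : X.X.Opens} (b : Γ(X.X, W)) :
    Γ(prodSpec s A, prodFst s A ⁻¹ᵁ W) :=
  scal (prodSnd s A) _ t * sharp (prodFst s A) le_rfl b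

/-- `α` is the cochain `(v)` of a first-order deformation `Ψ`: locally, `Ψ^♯ = f^♯ + ε v`. -/
def IsFirstOrderCochain (Ψ : Def f (DualNumber k)) {𝒰 : PointCover X.X}
    (α : (polyComplex f).Tot 𝒰 0) : Prop :=
  ∀ (s : Fin 1 → X.X) (i : OpenPair f (𝒰.inter s)) (a : Γ(Y.X, i.V)),
    sharp (Ψ.hom ≫ prodFst Y.str (DualNumber k))
        (((prodFst X.str (DualNumber k)).preimage_mono i.maps).trans (preimage_eq Ψ i.V).ge) a =
      sharp (prodFst X.str (DualNumber k)) le_rfl (sharp f.hom i.maps a) +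
        tmul X.str DualNumber.eps ((α ⟨(0, 0), rfl⟩ s).1 i ![a])

/-- `α = ({P_x}, {ξ_xy})` is the cochain given by local liftings `Φ_x` of `Ψ` along a small extension
with kernel `(t)`: `t P_x(a, b) = Φ_x({a, b}) - {Φ_x(a), Φ_x(b)}` and
`t ξ_xy(a) = Φ_y(a) - Φ_x(a)`. -/
def IsObstructionCochain {Ψ : Def f A} {φ : A' →ₐ[k] A} (t : A') {𝒰 : PointCover X.X}
    (L : ∀ x, LocalLift Ψ φ (𝒰.nhd x)) (α : (polyComplex f).Tot 𝒰 1) : Prop :=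
  (∀ (s : Fin 1 → X.X) (i : OpenPair f (𝒰.inter s)) (a b : Γ(Y.X, i.V)),
    tmul X.str t ((α ⟨(0, 1), rfl⟩ s).1 i ![a, b]) =
      (L (s 0)).sharp (i.mono (iInf_le _ 0)) ((Y.poisson.bracket i.V).br a b) -
      (X.poisson.prodBracket A' _).br ((L (s 0)).sharp (i.mono (iInf_le _ 0)) a)
        ((L (s 0)).sharp (i.mono (iInf_le _ 0)) b)) ∧
  ∀ (s : Fin 2 → X.X) (i : OpenPair f (𝒰.inter s)) (a : Γ(Y.X, i.V)),
    tmul X.str t ((α ⟨(1, 0), rfl⟩ s).1 i ![a]) =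
      (L (s 1)).sharp (i.mono (iInf_le _ 1)) a - (L (s 0)).sharp (i.mono (iInf_le _ 0)) a

end Deformations
end PoissonDef
end

noncomputable section
namespace PoissonDef

set_option linter.unusedSectionVars false

/-! ### Sections of `X × Spec A` over `W × Spec A` -/

section ProdFst

variable {k : Type u} [Field k] {X : PoissonScheme (Spec (.of k))}
  {A : Type u} [CommRing A] [Algebra k A] [IsArtAlg k A]

/-! The scheme `X × Spec A` has the points of `X`, and its sections over `W × Spec A` form `A ⊗ Γ(X,
W)`. A deformation of `f` has a prescribed map on points and a prescribed projection to `Spec A`. It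
is therefore the same as a compatible family of `k`-algebra homomorphisms `Γ(Y, V) → A ⊗ Γ(X, W)`,
for `W ⊆ f⁻¹(V)`, that preserve brackets and reduce to `f^♯` (`Def.ext_sharp`,
`IsDefFamily.exists_def`). The theorem becomes algebra with such families.

Let `t ≠ 0` lie in the maximal ideal and be killed by it. Multiplication by `t` identifies `Γ(X, W)`
with an ideal of `A ⊗ Γ(X, W)` (`tmul_injective`) on which all sections act, by multiplication and
by bracket, through their reduction to the closed fibre (`mul_tmul`, `tmul_bracket`). For a small
extension this ideal is the kernel of base change (`exists_tmul_of_baseChange_eq_zero`). Hence the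
difference of two families that agree modulo `t` is `t` times a derivation along `f^♯`, and the
failure of a family to preserve brackets, if divisible by `t`, is `t` times a biderivation
(`exists_isDiff`, `exists_isDefect`).

Let `α = (P, ξ)` be the cochain of a system of local families. Three facts carry both halves of the
theorem. By the Jacobi identities and the additivity of differences, `α` is a cocycle
(`IsObs.totD_eq_zero`). Replacing the families `Φ` by `Φ + t η` replaces `α` by `α - D η`, and every
`η` occurs (`IsObs.sub_totD`, `exists_isDiff_of_tot`). If `α = 0`, the families agree on overlaps
and preserve brackets, so they glue to a deformation (`IsObs.isDefFamily`).

For first-order deformations take `t = ε` and start from the constant family `f^♯`, whose cochain is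
`0`. The family `f^♯ + ε v` has cochain `-D v`, so it is a deformation if and only if `v` is a
cocycle; in degree `0` there are no coboundaries, so the class of `v` determines the deformation.

For obstructions, smoothness of `Y` gives local liftings. Two choices, compared on a common
refinement, differ by some `t η`, so their cocycles differ by `D η`. If the class vanishes, then `α
= D η` on a refinement, and the liftings changed by `t η` glue. Conversely, the restrictions of a
global lifting are local liftings with cochain `0`. -/

theorem res_res {Z : Scheme.{u}} {U V W : Z.Opens} (h : V ≤ U) (h' : W ≤ V) (a : Γ(Z, U)) :
    res Z h' (res Z h a) = res Z (h'.trans h) a := by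
  simp only [res, ← CommRingCat.comp_apply, ← Functor.map_comp]; rfl

theorem res_self {Z : Scheme.{u}} {U : Z.Opens} (h : U ≤ U) (a : Γ(Z, U)) : res Z h a = a := by
  simp [res]

theorem le_incl_preimage (s : X.X ⟶ Spec (.of k)) (W : X.X.Opens) :
    W ≤ prodIncl s A ⁻¹ᵁ (prodFst s A ⁻¹ᵁ W) := by
  rw [← Scheme.Hom.comp_preimage, prodIncl_fst]
  exact le_rfl

theorem incl_preimage_le (s : X.X ⟶ Spec (.of k)) (W : X.X.Opens) :
    prodIncl s A ⁻¹ᵁ (prodFst s A ⁻¹ᵁ W) ≤ W := by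
  rw [← Scheme.Hom.comp_preimage, prodIncl_fst]
  exact le_rfl

/-- The product `a x` of `a ∈ A` and `x ∈ Γ(X, W)` is `tmul X.str a x`; these span. -/
theorem tmul_induction {W : X.X.Opens} {P : Γ(prodSpec X.str A, prodFst X.str A ⁻¹ᵁ W) → Prop}
    (add : ∀ r r', P r → P r' → P (r + r')) (mul : ∀ a x, P (tmul X.str a x)) (r) : P r := by
  induction r using prod_induction with
  | add r r' h h' => exact add r r' h h'
  | mul a x =>
    -- The open sets `W` and `prodIncl⁻¹ (prodFst⁻¹ W)` are equal, but not by definition;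
    -- restriction passes from one to the other.
    have := mul a (res X.X (le_incl_preimage X.str W) x)
    rwa [tmul, sharp_res] at this

/-- This is the defining formula of the bracket for opens of the form `W × Spec A`, with factors
taken from `Γ(X, W)` itself instead of the sections over `prodIncl⁻¹ (prodFst⁻¹ W)`. -/
theorem prodBracket_tmul {W : X.X.Opens} (a a' : A) (x x' : Γ(X.X, W)) :
    (X.poisson.prodBracket A (prodFst X.str A ⁻¹ᵁ W)).br (tmul X.str a x) (tmul X.str a' x') =
      tmul X.str (a * a') ((X.poisson.bracket W).br x x') := by
  have h := X.poisson.prodBracket_mul A (prodFst X.str A ⁻¹ᵁ W) a a'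
    (res X.X (incl_preimage_le X.str W) x) (res X.X (incl_preimage_le X.str W) x')
  rw [← X.poisson.res_bracket, sharp_res, sharp_res, sharp_res] at h
  exact h

theorem tmul_add {W : X.X.Opens} (a : A) (x y : Γ(X.X, W)) :
    tmul X.str a (x + y) = tmul X.str a x + tmul X.str a y := by
  simp [tmul, mul_add]

theorem tmul_zero {W : X.X.Opens} (a : A) : tmul X.str a (0 : Γ(X.X, W)) = 0 := by
  simp [tmul]

theorem tmul_neg {W : X.X.Opens} (a : A) (x : Γ(X.X, W)) :
    tmul X.str a (-x) = - tmul X.str a x := by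
  simp [tmul]

theorem tmul_sub {W : X.X.Opens} (a : A) (x y : Γ(X.X, W)) :
    tmul X.str a (x - y) = tmul X.str a x - tmul X.str a y := by
  simp [tmul, mul_sub]

theorem tmul_mul_tmul {W : X.X.Opens} (a a' : A) (x x' : Γ(X.X, W)) :
    tmul X.str a x * tmul X.str a' x' = tmul X.str (a * a') (x * x') := by
  simp only [tmul, map_mul]; ring

theorem scal_prodFst {W : X.X.Opens} (c : k) :
    scal (prodSnd X.str A) (prodFst X.str A ⁻¹ᵁ W) (algebraMap k A c) =
      sharp (prodFst X.str A) le_rfl (scal X.str W c) := by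
  rw [scal_prod, ← res_scal X.str (incl_preimage_le X.str W), sharp_res]

theorem tmul_smul {W : X.X.Opens} (c : k) (a : A) (x : Γ(X.X, W)) :
    tmul X.str (c • a) x = tmul X.str a (scal X.str W c * x) := by
  rw [tmul, tmul, Algebra.smul_def, map_mul, map_mul, scal_prodFst]; ring

theorem tmul_one {W : X.X.Opens} (x : Γ(X.X, W)) :
    tmul X.str (1 : A) x = sharp (prodFst X.str A) le_rfl x := by
  rw [tmul, map_one, one_mul]

theorem res_tmul {W W' : X.X.Opens} (h : W' ≤ W) (a : A) (x : Γ(X.X, W)) :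
    res _ ((prodFst X.str A).preimage_mono h) (tmul X.str a x) = tmul X.str a (res X.X h x) := by
  rw [tmul, tmul, map_mul, res_scal, res_sharp, sharp_res]

/-- Restriction of sections to the closed fibre. -/
def red (W : X.X.Opens) : Γ(prodSpec X.str A, prodFst X.str A ⁻¹ᵁ W) →+* Γ(X.X, W) :=
  sharp (prodIncl X.str A) (le_incl_preimage X.str W)

theorem red_sharp {W : X.X.Opens} (x : Γ(X.X, W)) :
    red (A := A) W (sharp (prodFst X.str A) le_rfl x) = x := by
  rw [red, sharp_sharp]
  refine (sharp_congr (prodIncl_fst X.str A) _ le_rfl x).trans ?_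
  exact res_self le_rfl x

theorem scal_SpecMap {R S : Type u} [CommRing R] [CommRing S] (g : R →+* S) {Z : Scheme.{u}}
    (s : Z ⟶ Spec (.of S)) (U : Z.Opens) (a : R) :
    scal (s ≫ Spec.map (CommRingCat.ofHom g)) U a = scal s U (g a) := by
  rw [scal, scal, RingHom.comp_apply, RingHom.comp_apply]
  have h : (Scheme.ΓSpecIso (.of S)).inv.hom (g a) =
      sharp (Spec.map (CommRingCat.ofHom g)) (le_preimage_top _ ⊤)
        ((Scheme.ΓSpecIso (.of R)).inv.hom a) := by
    have := congr($(Scheme.ΓSpecIso_inv_naturality (CommRingCat.ofHom g)) a)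
    rw [Scheme.Hom.appTop, Scheme.Hom.app_eq_appLE] at this
    exact this
  rw [h, sharp_sharp]

theorem scal_congr {R : Type u} [CommRing R] {Z : Scheme.{u}} {s s' : Z ⟶ Spec (.of R)} (h : s = s')
    (U : Z.Opens) (a : R) : scal s U a = scal s' U a := by rw [h]

theorem red_scal (W : X.X.Opens) (a : A) :
    red W (scal (prodSnd X.str A) _ a) = scal X.str W (aug k A a) := by
  rw [red, sharp_scal]
  exact (scal_congr (pullback.lift_snd _ _ _) W a).trans
    (scal_SpecMap (aug k A).toRingHom X.str W a)

theorem red_tmul {W : X.X.Opens} (a : A) (x : Γ(X.X, W)) :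
    red W (tmul X.str a x) = scal X.str W (aug k A a) * x := by
  rw [tmul, map_mul, red_scal, red_sharp]

/-- The element `a - aug a` has augmentation zero, so it is not a unit and kills `t`. Thus the ideal
`A t` is the line `k t`. -/
theorem mul_eq_aug_smul {t : A} (ht : ∀ m ∈ IsLocalRing.maximalIdeal A, m * t = 0) (a : A) :
    a * t = aug k A a • t := by
  have h : a - algebraMap k A (aug k A a) ∈ IsLocalRing.maximalIdeal A := by
    rw [IsLocalRing.mem_maximalIdeal, mem_nonunits_iff]
    intro hu
    have := hu.map (aug k A)
    rw [map_sub, AlgHom.commutes] at this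
    simp at this
  have := ht _ h
  rw [sub_mul, sub_eq_zero] at this
  rw [this, Algebra.smul_def]

/-! ### The action of sections on multiples of a socle element -/

section Small

variable {t : A} {W : X.X.Opens}

/-- On a section `a y` with `a ∈ A` this is `a t = aug(a) t`: only the image of `a` in `k` survives.
This is why derivations obtained by dividing by `t` are derivations along `f^♯`. -/
theorem mul_tmul (ht : ∀ m ∈ IsLocalRing.maximalIdeal A, m * t = 0)
    (r : Γ(prodSpec X.str A, prodFst X.str A ⁻¹ᵁ W)) (x : Γ(X.X, W)) :
    r * tmul X.str t x = tmul X.str t (red W r * x) := by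
  induction r using tmul_induction with
  | add r r' h h' => rw [add_mul, h, h', map_add, add_mul, tmul_add]
  | mul a y =>
    rw [tmul_mul_tmul, mul_eq_aug_smul (k := k) ht, tmul_smul, red_tmul, mul_assoc]

theorem tmul_bracket (ht : ∀ m ∈ IsLocalRing.maximalIdeal A, m * t = 0)
    (x : Γ(X.X, W)) (r : Γ(prodSpec X.str A, prodFst X.str A ⁻¹ᵁ W)) :
    (X.poisson.prodBracket A _).br (tmul X.str t x) r =
      tmul X.str t ((X.poisson.bracket W).br x (red W r)) := by
  induction r using tmul_induction with
  | add r r' h h' => rw [map_add, h, h', map_add, map_add, tmul_add]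
  | mul a y =>
    -- The constant `aug(a)` comes out of the bracket because constants are Casimir.
    rw [prodBracket_tmul, mul_comm t a, mul_eq_aug_smul (k := k) ht, tmul_smul, red_tmul,
      (X.poisson.bracket W).leibniz, (X.poisson.bracket W).skew x (scal _ _ _),
      X.poisson.scal_bracket, neg_zero, mul_zero, add_zero]

theorem bracket_tmul (ht : ∀ m ∈ IsLocalRing.maximalIdeal A, m * t = 0)
    (r : Γ(prodSpec X.str A, prodFst X.str A ⁻¹ᵁ W)) (x : Γ(X.X, W)) :
    (X.poisson.prodBracket A _).br r (tmul X.str t x) =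
      tmul X.str t ((X.poisson.bracket W).br (red W r) x) := by
  rw [PoissonBracket.skew, tmul_bracket ht, ← tmul_neg, ← PoissonBracket.skew]

end Small

/-- The map `A ⊗ Γ(X, W) → Γ(X × Spec A, W × Spec A)` is bijective. -/
theorem exists_tensor_equiv (A : Type u) [CommRing A] [Algebra k A] [IsArtAlg k A] (W : X.X.Opens) :
    letI : Algebra k Γ(X.X, W) := (scal X.str W).toAlgebra
    ∃ e : A ⊗[k] Γ(X.X, W) ≃+ Γ(prodSpec X.str A, prodFst X.str A ⁻¹ᵁ W),
      ∀ a x, e (a ⊗ₜ x) = tmul X.str a x := by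
  have hW : prodIncl X.str A ⁻¹ᵁ (prodFst X.str A ⁻¹ᵁ W) = W :=
    le_antisymm (incl_preimage_le X.str W) (le_incl_preimage X.str W)
  have key : ∀ (W' : X.X.Opens) (h : W' = W)
      (h1 : prodFst X.str A ⁻¹ᵁ W ≤ prodFst X.str A ⁻¹ᵁ W'),
      (letI : Algebra k Γ(X.X, W') := (scal X.str W').toAlgebra
      ∃ e : A ⊗[k] Γ(X.X, W') ≃+ Γ(prodSpec X.str A, prodFst X.str A ⁻¹ᵁ W),
        ∀ a x, e (a ⊗ₜ x) = scal (prodSnd X.str A) _ a * sharp (prodFst X.str A) h1 x) →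
      letI : Algebra k Γ(X.X, W) := (scal X.str W).toAlgebra
      ∃ e : A ⊗[k] Γ(X.X, W) ≃+ Γ(prodSpec X.str A, prodFst X.str A ⁻¹ᵁ W),
        ∀ a x, e (a ⊗ₜ x) = tmul X.str a x := by
    rintro W' rfl h1 h; exact h
  refine key _ hW (le_preimage X.str A _) ?_
  let _ : Algebra k Γ(X.X, prodIncl X.str A ⁻¹ᵁ (prodFst X.str A ⁻¹ᵁ W)) := (scal X.str _).toAlgebra
  exact ⟨(RingEquiv.ofBijective _ (prodSections_bijective A X.str _)).toAddEquiv, fun _ _ => rfl⟩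

theorem tmul_injective {t : A} (ht : t ≠ 0) {W : X.X.Opens} :
    Function.Injective (tmul X.str t : Γ(X.X, W) → _) := by
  let _ : Algebra k Γ(X.X, W) := (scal X.str W).toAlgebra
  obtain ⟨e, he⟩ := exists_tensor_equiv (X := X) A W
  -- Applying `ψ ⊗ id` to `t ⊗ x` returns `ψ(t) x`, from which `x` is recovered.
  obtain ⟨ψ, hψ⟩ : ∃ ψ : Module.Dual k A, ψ t ≠ 0 := by
    by_contra! h
    exact ht ((Module.forall_dual_apply_eq_zero_iff k t).1 h)
  intro x y hxy
  rw [← he, ← he] at hxy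
  have h := congrArg (fun z => TensorProduct.lid k _ (ψ.rTensor Γ(X.X, W) z)) (e.injective hxy)
  simp only [LinearMap.rTensor_tmul, TensorProduct.lid_tmul] at h
  exact smul_right_injective _ hψ h

/-! ### Change of the artinian base and small extensions -/

variable {A' : Type u} [CommRing A'] [Algebra k A'] [IsArtAlg k A']

theorem prodMap_fst (s : X.X ⟶ Spec (.of k)) (φ : A' →ₐ[k] A) :
    prodMap s φ ≫ prodFst s A' = prodFst s A :=
  pullback.lift_fst _ _ _

theorem prodMap_snd (s : X.X ⟶ Spec (.of k)) (φ : A' →ₐ[k] A) :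
    prodMap s φ ≫ prodSnd s A' = prodSnd s A ≫ Spec.map (CommRingCat.ofHom φ.toRingHom) :=
  pullback.lift_snd _ _ _

theorem le_prodMap_preimage (φ : A' →ₐ[k] A) (W : X.X.Opens) :
    prodFst X.str A ⁻¹ᵁ W ≤ prodMap X.str φ ⁻¹ᵁ (prodFst X.str A' ⁻¹ᵁ W) := by
  rw [← Scheme.Hom.comp_preimage, prodMap_fst]

/-- The map `Γ(X × Spec A', W × Spec A') → Γ(X × Spec A, W × Spec A)` induced by `A' → A`. -/
def baseChange (φ : A' →ₐ[k] A) (W : X.X.Opens) :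
    Γ(prodSpec X.str A', prodFst X.str A' ⁻¹ᵁ W) →+* Γ(prodSpec X.str A, prodFst X.str A ⁻¹ᵁ W) :=
  sharp (prodMap X.str φ) (le_prodMap_preimage φ W)

theorem baseChange_tmul (φ : A' →ₐ[k] A) {W : X.X.Opens} (a : A') (x : Γ(X.X, W)) :
    baseChange φ W (tmul X.str a x) = tmul X.str (φ a) x := by
  rw [tmul, tmul, map_mul, baseChange, sharp_scal, scal_congr (prodMap_snd X.str φ), sharp_sharp,
    sharp_congr (prodMap_fst X.str φ) _ le_rfl]
  congr 1
  exact scal_SpecMap φ.toRingHom _ _ a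

theorem red_baseChange (φ : A' →ₐ[k] A) {W : X.X.Opens}
    (r : Γ(prodSpec X.str A', prodFst X.str A' ⁻¹ᵁ W)) :
    red W (baseChange φ W r) = red W r := by
  rw [baseChange, red, red, sharp_sharp]
  exact sharp_congr (prodIncl_prodMap X.str φ) _ _ _

theorem baseChange_surjective {φ : A' →ₐ[k] A} (hφ : Function.Surjective φ) (W : X.X.Opens) :
    Function.Surjective (baseChange (X := X) φ W) := by
  intro r
  induction r using tmul_induction with
  | add r r' h h' =>
    obtain ⟨z, rfl⟩ := h
    obtain ⟨z', rfl⟩ := h'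
    exact ⟨z + z', map_add _ _ _⟩
  | mul a x =>
    obtain ⟨a, rfl⟩ := hφ a
    exact ⟨_, baseChange_tmul φ a x⟩

/-- The sequence `k → A' → A → 0`, whose first map is `c ↦ c t`, is exact because the kernel `A' t`
equals `k t`. Tensoring with `Γ(X, W)` keeps it exact. -/
theorem exists_tmul_of_baseChange_eq_zero {φ : A' →ₐ[k] A} {t : A'} (h : IsSmallExt φ t)
    {W : X.X.Opens} {r : Γ(prodSpec X.str A', prodFst X.str A' ⁻¹ᵁ W)}
    (hr : baseChange φ W r = 0) : ∃ x, tmul X.str t x = r := by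
  let _ : Algebra k Γ(X.X, W) := (scal X.str W).toAlgebra
  obtain ⟨e, he⟩ := exists_tensor_equiv (X := X) A W
  obtain ⟨e', he'⟩ := exists_tensor_equiv (X := X) A' W
  have hcomm : ∀ z, baseChange φ W (e' z) = e (φ.toLinearMap.rTensor Γ(X.X, W) z) := fun z => by
    induction z with
    | zero => simp
    | tmul a x => rw [he', baseChange_tmul, LinearMap.rTensor_tmul, he]; rfl
    | add z z' h h' => simp only [map_add, h, h']
  obtain ⟨z, rfl⟩ := e'.surjective r
  have hz : φ.toLinearMap.rTensor Γ(X.X, W) z = 0 := by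
    rw [hcomm] at hr
    exact e.injective (hr.trans (map_zero e).symm)
  have hex : Function.Exact (LinearMap.toSpanSingleton k A' t) φ.toLinearMap := fun a => by
    have hm : φ.toLinearMap a = 0 ↔ a ∈ Ideal.span {t} := by rw [← h.ker]; rfl
    rw [hm, Ideal.mem_span_singleton']
    constructor
    · rintro ⟨b, rfl⟩
      exact ⟨aug k A' b, (mul_eq_aug_smul h.mul b).symm⟩
    · rintro ⟨c, rfl⟩
      exact ⟨algebraMap k A' c, (Algebra.smul_def _ _).symm⟩
  obtain ⟨y, rfl⟩ := (rTensor_exact Γ(X.X, W) hex h.surjective z).1 hz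
  refine ⟨TensorProduct.lid k _ y, ?_⟩
  rw [← he']
  congr 1
  obtain ⟨x, rfl⟩ := (TensorProduct.lid k Γ(X.X, W)).symm.surjective y
  simp

theorem baseChange_tmul_eq_zero {φ : A' →ₐ[k] A} {t : A'} (h : IsSmallExt φ t) {W : X.X.Opens}
    (x : Γ(X.X, W)) : baseChange φ W (tmul X.str t x) = 0 := by
  have : φ t = 0 := by
    rw [← RingHom.mem_ker, h.ker]
    exact Ideal.mem_span_singleton_self t
  rw [baseChange_tmul, this]
  simp [tmul]

theorem IsSmallExt.mem_maximalIdeal {φ : A' →ₐ[k] A} {t : A'} (h : IsSmallExt φ t) :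
    t ∈ IsLocalRing.maximalIdeal A' := by
  rw [IsLocalRing.mem_maximalIdeal, mem_nonunits_iff]
  intro hu
  have : φ t = 0 := by
    rw [← RingHom.mem_ker, h.ker]
    exact Ideal.mem_span_singleton_self t
  have := hu.map φ
  simp_all

theorem aug_eq_zero {t : A} (ht : t ∈ IsLocalRing.maximalIdeal A) : aug k A t = 0 := by
  have h : algebraMap A (IsLocalRing.ResidueField A) t = 0 := by
    rwa [IsLocalRing.ResidueField.algebraMap_eq, IsLocalRing.residue_eq_zero_iff]
  change (AlgEquiv.ofBijective (Algebra.ofId k (IsLocalRing.ResidueField A))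
    IsArtAlg.bijective).symm (algebraMap A (IsLocalRing.ResidueField A) t) = 0
  rw [h, map_zero]

theorem red_tmul_eq_zero {t : A} (ht : t ∈ IsLocalRing.maximalIdeal A) {W : X.X.Opens}
    (x : Γ(X.X, W)) : red W (tmul X.str t x) = 0 := by
  rw [red_tmul, aug_eq_zero ht, map_zero, zero_mul]

/-- With `eps_mem` and `eps_ne_zero`, this makes `ε` an admissible `t`, so that first-order
deformations fall under the same calculus as small extensions. -/
theorem eps_mul {m : DualNumber k} (hm : m ∈ IsLocalRing.maximalIdeal (DualNumber k)) :
    m * DualNumber.eps = 0 := by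
  rw [IsLocalRing.mem_maximalIdeal, mem_nonunits_iff,
    TrivSqZeroExt.isUnit_iff_isUnit_fst, isUnit_iff_ne_zero, not_not] at hm
  ext <;> simp [hm]

theorem eps_mem : (DualNumber.eps : DualNumber k) ∈ IsLocalRing.maximalIdeal (DualNumber k) := by
  rw [IsLocalRing.mem_maximalIdeal, mem_nonunits_iff, TrivSqZeroExt.isUnit_iff_isUnit_fst]
  simp

/-- The splitting `k[ε] = k ⊕ k ε` shows that two sections with the same reduction differ by a
multiple of `ε`. For `k[ε]` this replaces the description of the kernel of a base change. -/
theorem exists_eq_sharp_add_tmul_eps {W : X.X.Opens}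
    (r : Γ(prodSpec X.str (DualNumber k), prodFst X.str (DualNumber k) ⁻¹ᵁ W)) :
    ∃ x, r = sharp (prodFst X.str (DualNumber k)) le_rfl (red W r) + tmul X.str DualNumber.eps x := by
  induction r using tmul_induction with
  | add r r' h h' =>
    obtain ⟨x, hx⟩ := h
    obtain ⟨x', hx'⟩ := h'
    refine ⟨x + x', ?_⟩
    rw [tmul_add, map_add, map_add]
    nth_rw 1 [hx, hx']
    abel
  | mul a x =>
    refine ⟨scal X.str W a.snd * x, ?_⟩
    have h : aug k (DualNumber k) a = a.fst := by
      have : a - algebraMap k _ a.fst ∈ IsLocalRing.maximalIdeal (DualNumber k) := by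
        rw [IsLocalRing.mem_maximalIdeal, mem_nonunits_iff, TrivSqZeroExt.isUnit_iff_isUnit_fst]
        simp [TrivSqZeroExt.algebraMap_eq_inl]
      have := aug_eq_zero (k := k) this
      rwa [map_sub, AlgHom.commutes, sub_eq_zero] at this
    have ha : a = a.fst • (1 : DualNumber k) + a.snd • DualNumber.eps := by ext <;> simp
    rw [red_tmul, h, ← tmul_one, ← tmul_smul, ← tmul_smul]
    nth_rw 1 [ha]
    simp [tmul, add_mul]

end ProdFst

/-! ### Morphisms of schemes given by homomorphisms of rings of sections -/

section Morphisms

variable {Z Y : Scheme.{u}}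

/-- Once the maps on points agree, a morphism is its maps on sections, and these are compared
locally by the sheaf property. -/
theorem hom_ext_of_sharp {g g' : Z ⟶ Y} (hb : g.base = g'.base)
    (h : ∀ (V : Y.Opens) (z : Z), z ∈ g ⁻¹ᵁ V → ∃ (U : Z.Opens) (_ : z ∈ U) (h : U ≤ g ⁻¹ᵁ V)
      (h' : U ≤ g' ⁻¹ᵁ V), ∀ a, sharp g h a = sharp g' h' a) : g = g' := by
  have key : ∀ V (hV : g' ⁻¹ᵁ V ≤ g ⁻¹ᵁ V) a, sharp g hV a = sharp g' le_rfl a := fun V hV a => by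
    choose U hU h1 h2 h3 using fun z : (g' ⁻¹ᵁ V : Z.Opens) => h V z.1 (hV z.2)
    refine Z.sheaf.eq_of_locally_eq' U _ (fun z => homOfLE (h2 z))
      (fun z hz => Opens.mem_iSup.2 ⟨⟨z, hz⟩, hU _⟩) _ _ fun z => ?_
    have := h3 z a
    rw [← res_sharp g hV (h2 z), ← res_sharp g' le_rfl (h2 z)] at this
    exact this
  have hV : ∀ V : Y.Opens, g ⁻¹ᵁ V = g' ⁻¹ᵁ V := fun V => by
    change (Opens.map g.base).obj V = (Opens.map g'.base).obj V
    rw [hb]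
  refine Scheme.Hom.ext hb fun V => ?_
  ext a
  have h1 := key V (hV V).ge a
  have h2 : sharp g' le_rfl a = g'.app V a := congr($(g'.app_eq_appLE.symm) a)
  exact h1.trans h2

/-- A morphism of schemes is given by a continuous map and homomorphisms of rings of sections that
induce a morphism of schemes on a scheme with the same underlying space. -/
theorem exists_hom_of_sharp {X₀ : Scheme.{u}} (b : Z ⟶ Y) (i : X₀ ⟶ Z) [Surjective i]
    (Φ : ∀ V : Y.Opens, Γ(Y, V) →+* Γ(Z, b ⁻¹ᵁ V))
    (hres : ∀ {V V' : Y.Opens} (h : V' ≤ V) a,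
      Φ V' (res Y h a) = res Z (b.preimage_mono h) (Φ V a))
    (hΦ : ∀ V a, sharp i (le_refl (i ⁻¹ᵁ (b ⁻¹ᵁ V))) (Φ V a) =
      sharp (i ≫ b) (Scheme.Hom.comp_preimage i b V).ge a) :
    ∃ g : Z ⟶ Y, g.base = b.base ∧ ∀ (V : Y.Opens) (U : Z.Opens) (h : U ≤ g ⁻¹ᵁ V)
      (h' : U ≤ b ⁻¹ᵁ V) a, sharp g h a = res Z h' (Φ V a) := by
  let c : Y.presheaf ⟶ (TopCat.Presheaf.pushforward _ b.base).obj Z.presheaf :=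
    { app := fun V => CommRingCat.ofHom (Φ V.unop)
      naturality := fun V V' e => by
        ext a
        exact hres (leOfHom e.unop) a }
  let g₀ : Z.toPresheafedSpace.Hom Y.toPresheafedSpace := ⟨b.base, c⟩
  -- Write `z = i x`. If the image of `s` is invertible at `z`, then its pullback by `i` is
  -- invertible at `x`. By `hΦ` this is the pullback of `s` along the morphism of schemes `i ≫ b`,
  -- which is local on stalks, so `s` is invertible at `b z`.
  have hg : ∀ z, IsLocalHom (g₀.stalkMap z).hom := fun z => by
    constructor
    intro a ha
    obtain ⟨V, hV, s, rfl⟩ := Y.presheaf.exists_germ_eq a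
    have h1 : (g₀.stalkMap z).hom (Y.presheaf.germ V (b z) hV s) =
        Z.presheaf.germ (b ⁻¹ᵁ V) z hV (Φ V s) :=
      congr($(PresheafedSpace.stalkMap_germ g₀ V z hV) s)
    have h2 : z ∈ Z.basicOpen (Φ V s) := (Z.mem_basicOpen (Φ V s) z hV).2 (h1 ▸ ha)
    obtain ⟨x, rfl⟩ := i.surjective z
    have h3 : x ∈ X₀.basicOpen (sharp i (le_refl (i ⁻¹ᵁ (b ⁻¹ᵁ V))) (Φ V s)) := by
      rw [Scheme.basicOpen_appLE]
      exact ⟨hV, h2⟩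
    rw [hΦ] at h3
    exact (Y.mem_basicOpen s _ hV).1 ((Scheme.basicOpen_appLE _ _ _ _ _).le h3).2
  let g : Z ⟶ Y := ⟨⟨g₀, hg⟩⟩
  refine ⟨g, rfl, fun V U h h' a => rfl⟩

theorem section_ext {ι : Type*} (U : ι → Z.Opens) {V : Z.Opens} (hU : ∀ i, U i ≤ V)
    (hV : ∀ z ∈ V, ∃ i, z ∈ U i) {a b : Γ(Z, V)} (h : ∀ i, res Z (hU i) a = res Z (hU i) b) :
    a = b :=
  Z.sheaf.eq_of_locally_eq' U V (fun i => homOfLE (hU i))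
    (fun z hz => Opens.mem_iSup.2 (hV z hz)) a b h

theorem exists_glue {ι : Type u} (U : ι → Z.Opens) {V : Z.Opens} (hU : ∀ i, U i ≤ V)
    (hV : ∀ z ∈ V, ∃ i, z ∈ U i) (a : ∀ i, Γ(Z, U i))
    (h : ∀ i j, res Z (inf_le_left : U i ⊓ U j ≤ _) (a i) = res Z inf_le_right (a j)) :
    ∃ b : Γ(Z, V), ∀ i, res Z (hU i) b = a i := by
  obtain ⟨b, hb, -⟩ := Z.sheaf.existsUnique_gluing' U V (fun i => homOfLE (hU i))
    (fun z hz => Opens.mem_iSup.2 (hV z hz)) a (fun i j => h i j)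
  exact ⟨b, hb⟩

/-- The values are glued one by one; uniqueness of gluing makes the result a ring homomorphism. -/
theorem exists_glue_ringHom {ι R : Type u} [CommRing R] (U : ι → Z.Opens) {V : Z.Opens}
    (hU : ∀ i, U i ≤ V) (hV : ∀ z ∈ V, ∃ i, z ∈ U i) (Φ : ∀ i, R →+* Γ(Z, U i))
    (h : ∀ i j a, res Z (inf_le_left : U i ⊓ U j ≤ _) (Φ i a) = res Z inf_le_right (Φ j a)) :
    ∃ Ψ : R →+* Γ(Z, V), ∀ i a, res Z (hU i) (Ψ a) = Φ i a := by
  choose Ψ hΨ using fun a => exists_glue U hU hV (fun i => Φ i a) (fun i j => h i j a)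
  refine ⟨⟨⟨⟨Ψ, ?_⟩, ?_⟩, ?_, ?_⟩, fun i a => hΨ a i⟩
  all_goals
    intros
    refine section_ext U hU hV fun i => ?_
    simp only [map_one, map_zero, map_add, map_mul, hΨ]

theorem hom_Spec_ext {R : Type u} [CommRing R] {s s' : Z ⟶ Spec (.of R)}
    (h : ∀ a, scal s ⊤ a = scal s' ⊤ a) : s = s' := by
  refine ext_of_isAffine ?_
  ext a
  obtain ⟨a, rfl⟩ := (Scheme.ΓSpecIso (.of R)).symm.commRingCatIsoToRingEquiv.surjective a
  have e : ∀ s : Z ⟶ Spec (.of R), s.appTop = s.appLE ⊤ ⊤ (le_preimage_top s ⊤) := fun s => by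
    rw [Scheme.Hom.appTop, Scheme.Hom.app_eq_appLE]; rfl
  rw [e, e]
  exact h a

end Morphisms

/-! ### Deformations as families of homomorphisms of rings of sections -/

section Families

variable {k : Type u} [Field k] {X Y : PoissonScheme (Spec (.of k))} {f : PoissonScheme.Hom X Y}
  {A : Type u} [CommRing A] [Algebra k A] [IsArtAlg k A]

/-- The homomorphism `Γ(Y, V) → Γ(X × Spec A, W × Spec A)` given by a deformation of `f`. -/
def Def.sharp (Ψ : Def f A) {V : Y.X.Opens} {W : X.X.Opens} (h : W ≤ f.hom ⁻¹ᵁ V) :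
    Γ(Y.X, V) →+* Γ(prodSpec X.str A, prodFst X.str A ⁻¹ᵁ W) :=
  PoissonDef.sharp (Ψ.hom ≫ prodFst Y.str A)
    (((prodFst X.str A).preimage_mono h).trans (preimage_eq Ψ V).ge)

namespace Def

variable (Ψ : Def f A) {V V' : Y.X.Opens} {W W' : X.X.Opens} (h : W ≤ f.hom ⁻¹ᵁ V)

theorem sharp_res (hV : V' ≤ V) (hW : W' ≤ W) (h' : W' ≤ f.hom ⁻¹ᵁ V') (a : Γ(Y.X, V)) :
    Ψ.sharp h' (res Y.X hV a) = res _ ((prodFst X.str A).preimage_mono hW) (Ψ.sharp h a) := by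
  rw [Def.sharp, Def.sharp, PoissonDef.sharp_res, res_sharp]

theorem hom_snd : Ψ.hom ≫ prodSnd Y.str A = prodSnd X.str A := Ψ.1.w

theorem hom_fst_str : (Ψ.hom ≫ prodFst Y.str A) ≫ Y.str = prodFst X.str A ≫ X.str := by
  rw [Category.assoc, pullback.condition, reassoc_of% Ψ.hom_snd, ← pullback.condition]

theorem red_sharp (a : Γ(Y.X, V)) : red W (Ψ.sharp h a) = PoissonDef.sharp f.hom h a := by
  rw [red, Def.sharp, sharp_sharp]
  refine sharp_congr ?_ _ _ _
  rw [← Category.assoc, Ψ.incl_hom, Category.assoc, prodIncl_fst, Category.comp_id]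

theorem sharp_base {R : (Spec (.of k)).Opens} (hR : V ≤ Y.str ⁻¹ᵁ R)
    (hR' : prodFst X.str A ⁻¹ᵁ W ≤ (prodFst X.str A ≫ X.str) ⁻¹ᵁ R) (c : Γ(Spec (.of k), R)) :
    Ψ.sharp h (PoissonDef.sharp Y.str hR c) = PoissonDef.sharp (prodFst X.str A ≫ X.str) hR' c := by
  rw [Def.sharp, sharp_sharp]
  exact sharp_congr Ψ.hom_fst_str _ _ _

theorem sharp_bracket (a b : Γ(Y.X, V)) :
    Ψ.sharp h ((Y.poisson.bracket V).br a b) =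
      (X.poisson.prodBracket A _).br (Ψ.sharp h a) (Ψ.sharp h b) := by
  have h1 : prodFst X.str A ⁻¹ᵁ W ≤ Ψ.hom ⁻¹ᵁ (prodFst Y.str A ⁻¹ᵁ V) :=
    (((prodFst X.str A).preimage_mono h).trans (preimage_eq Ψ V).ge)
  have e : ∀ a, Ψ.sharp h a = PoissonDef.sharp Ψ.hom h1 (PoissonDef.sharp (prodFst Y.str A) le_rfl a) :=
    fun a => by rw [sharp_sharp]; rfl
  -- Functions pulled back from `Y` have coefficient `1 ∈ A`, so their bracket on `Y × Spec A` is
  -- the pullback of their bracket on `Y`.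
  have := prodBracket_tmul (X := Y) (1 : A) 1 a b
  rw [mul_one, tmul_one, tmul_one, tmul_one] at this
  rw [e, e, e, ← this]
  exact Ψ.1.sharp_bracket h1 _ _

/-- The closed fibre is surjective on points and the deformation is `f` there, so nothing on the
level of spaces can vary. -/
theorem hom_fst_base : (Ψ.hom ≫ prodFst Y.str A).base = (prodFst X.str A ≫ f.hom).base := by
  ext z
  obtain ⟨x, rfl⟩ := (prodIncl X.str A).surjective z
  rw [← Scheme.Hom.comp_apply, ← Scheme.Hom.comp_apply, ← Category.assoc, Ψ.incl_hom,
    Category.assoc, prodIncl_fst, reassoc_of% (prodIncl_fst X.str A), Category.comp_id]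

theorem ext_sharp {Ψ Ψ' : Def f A}
    (h : ∀ (V : Y.X.Opens) (x : X.X), x ∈ f.hom ⁻¹ᵁ V → ∃ (W : X.X.Opens) (_ : x ∈ W)
      (hW : W ≤ f.hom ⁻¹ᵁ V), ∀ a, Ψ.sharp hW a = Ψ'.sharp hW a) : Ψ = Ψ' := by
  refine Subtype.ext (PoissonScheme.Hom.ext ?_)
  refine pullback.hom_ext ?_ (Ψ.hom_snd.trans Ψ'.hom_snd.symm)
  refine hom_ext_of_sharp (g := Ψ.hom ≫ prodFst Y.str A) (g' := Ψ'.hom ≫ prodFst Y.str A) ?_ ?_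
  · rw [hom_fst_base, hom_fst_base]
  · intro V z hz
    rw [preimage_eq] at hz
    obtain ⟨W, hx, hW, e⟩ := h V _ hz
    exact ⟨prodFst X.str A ⁻¹ᵁ W, hx, _, _, e⟩

end Def

/-- A family of homomorphisms of rings of sections that is the family given by a deformation of
`f` over `A`. -/
structure IsDefFamily (𝒰 : PointCover X.X) (Φ : ∀ (x : X.X) (i : OpenPair f (𝒰.nhd x)),
    Γ(Y.X, i.V) →+* Γ(prodSpec X.str A, prodFst X.str A ⁻¹ᵁ i.W)) : Prop where
  map_res : ∀ {x y} (i : OpenPair f (𝒰.nhd x)) (j : OpenPair f (𝒰.nhd y)) (hV : j.V ≤ i.V)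
    (hW : j.W ≤ i.W) a, Φ y j (res Y.X hV a) = res _ ((prodFst X.str A).preimage_mono hW) (Φ x i a)
  map_scal : ∀ {x} (i : OpenPair f (𝒰.nhd x)) c, Φ x i (scal Y.str i.V c) =
    scal (prodSnd X.str A) _ (algebraMap k A c)
  red_eq : ∀ {x} (i : OpenPair f (𝒰.nhd x)) a, red i.W (Φ x i a) = sharp f.hom i.maps a
  map_bracket : ∀ {x} (i : OpenPair f (𝒰.nhd x)) a b, Φ x i ((Y.poisson.bracket i.V).br a b) =
    (X.poisson.prodBracket A _).br (Φ x i a) (Φ x i b)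

variable {𝒰 : PointCover X.X} {Φ : ∀ (x : X.X) (i : OpenPair f (𝒰.nhd x)),
    Γ(Y.X, i.V) →+* Γ(prodSpec X.str A, prodFst X.str A ⁻¹ᵁ i.W)}

/-- The largest pair for `𝒰.nhd x` over `V`. -/
abbrev OpenPair.ofPoint (f : PoissonScheme.Hom X Y) (𝒰 : PointCover X.X) (V : Y.X.Opens) (x : X.X) :
    OpenPair f (𝒰.nhd x) := ⟨V, f.hom ⁻¹ᵁ V ⊓ 𝒰.nhd x, inf_le_right, inf_le_left⟩

/-- For each `V` the homomorphisms glue over the cover to one on `f⁻¹(V) × Spec A`. The projection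
followed by `f` supplies the map on points, and since the family reduces to `f^♯` on the closed
fibre, the glued maps form a morphism of schemes by `exists_hom_of_sharp`. -/
theorem IsDefFamily.exists_hom (H : IsDefFamily 𝒰 Φ) :
    ∃ g : prodSpec X.str A ⟶ Y.X, g.base = (prodFst X.str A ≫ f.hom).base ∧
      ∀ x (i : OpenPair f (𝒰.nhd x)) (h : prodFst X.str A ⁻¹ᵁ i.W ≤ g ⁻¹ᵁ i.V) a,
        sharp g h a = Φ x i a := by
  have hcov : ∀ V, ∀ z ∈ (prodFst X.str A ≫ f.hom) ⁻¹ᵁ V,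
      ∃ x, z ∈ prodFst X.str A ⁻¹ᵁ (OpenPair.ofPoint f 𝒰 V x).W :=
    fun V z hz => ⟨prodFst X.str A z, hz, 𝒰.mem _⟩
  have hle : ∀ V x, prodFst X.str A ⁻¹ᵁ (OpenPair.ofPoint f 𝒰 V x).W ≤
      (prodFst X.str A ≫ f.hom) ⁻¹ᵁ V :=
    fun V x => (prodFst X.str A).preimage_mono inf_le_left
  choose G hG using fun V : Y.X.Opens => exists_glue_ringHom (R := Γ(Y.X, V))
    (fun x => prodFst X.str A ⁻¹ᵁ (OpenPair.ofPoint f 𝒰 V x).W) (hle V) (hcov V)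
    (fun x => Φ x (OpenPair.ofPoint f 𝒰 V x)) (fun x y a => by
      let j : OpenPair f (𝒰.nhd x) := ⟨V, (OpenPair.ofPoint f 𝒰 V x).W ⊓ (OpenPair.ofPoint f 𝒰 V y).W,
        inf_le_left.trans inf_le_right, inf_le_left.trans inf_le_left⟩
      have h1 := H.map_res (OpenPair.ofPoint f 𝒰 V x) j le_rfl inf_le_left a
      have h2 := H.map_res (OpenPair.ofPoint f 𝒰 V y) j le_rfl inf_le_right a
      exact h1.symm.trans h2)
  -- A pair `i` lies below the largest pair over the same `V`, so the glued map restricts to the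
  -- given one on every pair.
  have hG' : ∀ V x (i : OpenPair f (𝒰.nhd x)) (hV : i.V = V)
      (h : prodFst X.str A ⁻¹ᵁ i.W ≤ (prodFst X.str A ≫ f.hom) ⁻¹ᵁ V) a,
      res _ h (G V a) = Φ x i (res Y.X hV.le a) := by
    rintro _ x i rfl h a
    have hi : i.W ≤ (OpenPair.ofPoint f 𝒰 i.V x).W := le_inf i.maps i.le
    rw [H.map_res (OpenPair.ofPoint f 𝒰 i.V x) i le_rfl hi a, ← hG, res_res]
  obtain ⟨g, hg, hg'⟩ := exists_hom_of_sharp (prodFst X.str A ≫ f.hom) (prodIncl X.str A) G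
    (fun {V V'} h a => by
      refine section_ext _ (hle V') (hcov V') fun x => ?_
      rw [hG, res_res]
      have h1 := H.map_res (OpenPair.ofPoint f 𝒰 V x) (OpenPair.ofPoint f 𝒰 V' x) h
        (inf_le_inf_right _ (f.hom.preimage_mono h)) a
      rw [← hG V x a, res_res] at h1
      exact h1)
    (fun V a => by
      have hcov' : ∀ x ∈ prodIncl X.str A ⁻¹ᵁ ((prodFst X.str A ≫ f.hom) ⁻¹ᵁ V),
          ∃ y, x ∈ (OpenPair.ofPoint f 𝒰 V y).W := fun x hx =>
        ⟨x, incl_preimage_le X.str (f.hom ⁻¹ᵁ V) hx, 𝒰.mem _⟩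
      have hle' : ∀ y, (OpenPair.ofPoint f 𝒰 V y).W ≤
          prodIncl X.str A ⁻¹ᵁ ((prodFst X.str A ≫ f.hom) ⁻¹ᵁ V) := fun y =>
        inf_le_left.trans (le_incl_preimage X.str (f.hom ⁻¹ᵁ V))
      refine section_ext _ hle' hcov' fun y => ?_
      rw [res_sharp, res_sharp]
      have h1 := H.red_eq (OpenPair.ofPoint f 𝒰 V y) a
      rw [← hG V y a, red, PoissonDef.sharp_res] at h1
      refine h1.trans (sharp_congr ?_ _ _ _)
      rw [reassoc_of% (prodIncl_fst X.str A)])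
  refine ⟨g, hg, fun x i h a => ?_⟩
  have h' : prodFst X.str A ⁻¹ᵁ i.W ≤ (prodFst X.str A ≫ f.hom) ⁻¹ᵁ i.V :=
    (prodFst X.str A).preimage_mono i.maps
  rw [hg' i.V _ h h', hG' _ _ i rfl, PoissonDef.res_self]

theorem hom_prod_ext {Z : Scheme.{u}} {g g' : Z ⟶ prodSpec Y.str A}
    (h : g ≫ prodFst Y.str A = g' ≫ prodFst Y.str A)
    (h' : g ≫ prodSnd Y.str A = g' ≫ prodSnd Y.str A) : g = g' :=
  pullback.hom_ext h h'

theorem incl_fst (f : PoissonScheme.Hom X Y) :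
    (f.hom ≫ prodIncl Y.str A) ≫ prodFst Y.str A = f.hom := by
  rw [Category.assoc, prodIncl_fst, Category.comp_id]

theorem prodIncl_snd (Z : PoissonScheme (Spec (.of k))) : prodIncl Z.str A ≫ prodSnd Z.str A =
    Z.str ≫ Spec.map (CommRingCat.ofHom (aug k A).toRingHom) := pullback.lift_snd _ _ _

theorem incl_snd (f : PoissonScheme.Hom X Y) :
    (f.hom ≫ prodIncl Y.str A) ≫ prodSnd Y.str A = prodIncl X.str A ≫ prodSnd X.str A := by
  rw [Category.assoc, prodIncl_snd, prodIncl_snd, reassoc_of% f.w]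

/-- Sections of `Y × Spec A` are sums of products `c y` with `c ∈ A` and `y` from `Y`. Elements of
`A` are Casimir on both sides, so the brackets need only be compared on sections from `Y`, that is,
for `g`. -/
theorem sharp_bracket_of_fst {Ψ : prodSpec X.str A ⟶ prodSpec Y.str A}
    {g : prodSpec X.str A ⟶ Y.X} (hΨ1 : Ψ ≫ prodFst Y.str A = g)
    (hΨ2 : Ψ ≫ prodSnd Y.str A = prodSnd X.str A)
    (hloc : ∀ {V : Y.X.Opens} {U : (prodSpec X.str A).Opens} (h : U ≤ g ⁻¹ᵁ V) (a b),
      sharp g h ((Y.poisson.bracket V).br a b) =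
        (X.poisson.prodBracket A U).br (sharp g h a) (sharp g h b))
    {V : (prodSpec Y.str A).Opens} {U : (prodSpec X.str A).Opens} (h : U ≤ Ψ ⁻¹ᵁ V)
    (a b : Γ(prodSpec Y.str A, V)) :
    sharp Ψ h ((Y.poisson.prodBracket A V).br a b) =
      (X.poisson.prodBracket A U).br (sharp Ψ h a) (sharp Ψ h b) := by
  have hg2 : U ≤ g ⁻¹ᵁ (prodIncl Y.str A ⁻¹ᵁ V) := by
    rw [← hΨ1]
    exact h.trans (Ψ.preimage_mono (le_preimage Y.str A V))
  have hmul : ∀ (c : A) (y : Γ(Y.X, prodIncl Y.str A ⁻¹ᵁ V)),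
      sharp Ψ h (scal (prodSnd Y.str A) V c * sharp (prodFst Y.str A) (le_preimage Y.str A V) y) =
      scal (prodSnd X.str A) U c * sharp g hg2 y := fun c y => by
    rw [map_mul, sharp_scal, sharp_sharp, scal_congr hΨ2, sharp_congr hΨ1]
  have hc : ∀ (c : A) y, (X.poisson.prodBracket A U).br (scal (prodSnd X.str A) U c) y = 0 :=
    fun c y => (X.poisson.prod A).base_bracket (T := ⊤) (le_preimage_top _ _) _ y
  induction a using prod_induction with
  | add r₁ r₂ h₁ h₂ => simp only [map_add, LinearMap.add_apply, h₁, h₂]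
  | mul c y =>
    induction b using prod_induction with
    | add r₁ r₂ h₁ h₂ => simp only [map_add, h₁, h₂]
    | mul c' y' =>
      rw [Y.poisson.prodBracket_mul, hmul, hmul, hmul, hloc, PoissonBracket.leibniz,
        PoissonBracket.leibniz', PoissonBracket.leibniz', hc,
        PoissonBracket.skew _ (sharp g hg2 y) (scal _ _ _), hc, hc, map_mul]
      ring

theorem IsDefFamily.exists_def (H : IsDefFamily 𝒰 Φ) :
    ∃ Ψ : Def f A, ∀ x (i : OpenPair f (𝒰.nhd x)) a, Ψ.sharp i.maps a = Φ x i a := by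
  obtain ⟨g, hg, hg'⟩ := H.exists_hom
  have hpre : ∀ V, g ⁻¹ᵁ V = prodFst X.str A ⁻¹ᵁ (f.hom ⁻¹ᵁ V) := fun V => by
    change (Opens.map g.base).obj V = _
    rw [hg]; rfl
  have hmaps : ∀ {x} (i : OpenPair f (𝒰.nhd x)), prodFst X.str A ⁻¹ᵁ i.W ≤ g ⁻¹ᵁ i.V := fun i => by
    rw [hpre]; exact (prodFst X.str A).preimage_mono i.maps
  have hstr : g ≫ Y.str = prodSnd X.str A ≫ Spec.map (CommRingCat.ofHom (algebraMap k A)) := by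
    refine hom_Spec_ext fun c => ?_
    rw [← sharp_scal Y.str g (V := ⊤) (le_preimage_top g ⊤)]
    refine section_ext (fun x => prodFst X.str A ⁻¹ᵁ 𝒰.nhd x) (fun _ => le_top)
      (fun z _ => ⟨prodFst X.str A z, 𝒰.mem _⟩) fun x => ?_
    let i : OpenPair f (𝒰.nhd x) := ⟨⊤, 𝒰.nhd x, le_rfl, le_preimage_top _ _⟩
    rw [res_sharp, res_scal, scal_SpecMap]
    exact (hg' x i (hmaps i) _).trans (H.map_scal i c)
  have hg1 : prodIncl X.str A ≫ g = f.hom := by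
    have hb : (prodIncl X.str A ≫ g).base = f.hom.base := by
      have e : (prodIncl X.str A ≫ prodFst X.str A ≫ f.hom).base = f.hom.base := by
        rw [reassoc_of% (prodIncl_fst X.str A)]
      rw [← e, Scheme.Hom.comp_base, Scheme.Hom.comp_base, hg]
    refine hom_ext_of_sharp hb fun V x hx => ?_
    let i := OpenPair.ofPoint f 𝒰 V x
    have hxf : x ∈ f.hom ⁻¹ᵁ V := by
      change f.hom.base x ∈ V
      rw [← hb]; exact hx
    have h1 : i.W ≤ (prodIncl X.str A ≫ g) ⁻¹ᵁ V :=
      (le_incl_preimage X.str i.W).trans ((prodIncl X.str A).preimage_mono (hmaps i))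
    refine ⟨i.W, ⟨hxf, 𝒰.mem x⟩, h1, i.maps, fun a => ?_⟩
    rw [← H.red_eq i, ← hg' x i (hmaps i) a, red, sharp_sharp]
  let Ψ : prodSpec X.str A ⟶ prodSpec Y.str A := pullback.lift g (prodSnd X.str A) hstr
  have hΨ1 : Ψ ≫ prodFst Y.str A = g := pullback.lift_fst _ _ _
  have hΨ2 : Ψ ≫ prodSnd Y.str A = prodSnd X.str A := pullback.lift_snd _ _ _
  have hloc : ∀ {V : Y.X.Opens} {U : (prodSpec X.str A).Opens} (h : U ≤ g ⁻¹ᵁ V) (a b),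
      sharp g h ((Y.poisson.bracket V).br a b) =
        (X.poisson.prodBracket A U).br (sharp g h a) (sharp g h b) := fun {V U} h a b => by
    -- Every open `U` of `X × Spec A` is `W × Spec A` for `W = prodIncl⁻¹ U`. Intersecting `W` with
    -- the members of the cover gives pairs on which the bracket is known to be preserved.
    let i : ∀ x, OpenPair f (𝒰.nhd x) := fun x => ⟨V, prodIncl X.str A ⁻¹ᵁ U ⊓ 𝒰.nhd x, inf_le_right,
      inf_le_left.trans (((prodIncl X.str A).preimage_mono h).trans (by
        rw [hpre]; exact incl_preimage_le X.str (f.hom ⁻¹ᵁ V)))⟩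
    have hi : ∀ x, prodFst X.str A ⁻¹ᵁ (i x).W ≤ U := fun x =>
      ((prodFst X.str A).preimage_mono inf_le_left).trans (preimage_preimage X.str A U).le
    refine section_ext (fun x => prodFst X.str A ⁻¹ᵁ (i x).W) hi (fun z hz => ?_) fun x => ?_
    · exact ⟨prodFst X.str A z, (preimage_preimage X.str A U).ge hz, 𝒰.mem _⟩
    · have h1 := (X.poisson.prod A).res_bracket (hi x) (sharp g h a) (sharp g h b)
      refine Eq.trans ?_ h1.symm
      rw [res_sharp, res_sharp, res_sharp]
      have e := fun a => hg' x (i x) (hmaps (i x)) a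
      refine (e _).trans ((H.map_bracket (i x) a b).trans ?_)
      rw [← e, ← e]; rfl
  let F : PoissonScheme.Hom (X.prod A) (Y.prod A) :=
    { hom := Ψ, w := hΨ2, sharp_bracket := sharp_bracket_of_fst hΨ1 hΨ2 hloc }
  have hF : prodIncl X.str A ≫ Ψ = f.hom ≫ prodIncl Y.str A := hom_prod_ext
    ((Category.assoc _ _ _).trans ((congrArg (prodIncl X.str A ≫ ·) hΨ1).trans
      (hg1.trans (incl_fst f).symm)))
    ((Category.assoc _ _ _).trans ((congrArg (prodIncl X.str A ≫ ·) hΨ2).trans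
      (incl_snd f).symm))
  exact ⟨⟨F, hF⟩, fun x i a => (sharp_congr hΨ1 _ _ a).trans (hg' x i (hmaps i) a)⟩

end Families

/-! ### Infinitesimal families of homomorphisms and multiderivations -/

section Alt

variable {C B : Type u} [CommRing C] [CommRing B]

/-- An alternating map of two arguments from a bilinear map. -/
def altPair (g : C →ₗ[ℤ] C →ₗ[ℤ] B) (hg : ∀ x, g x x = 0) : C [⋀^Fin 2]→ₗ[ℤ] B where
  toFun v := g (v 0) (v 1)
  map_update_add' v i x y := by fin_cases i <;> simp
  map_update_smul' v i c x := by fin_cases i <;> simp [-zsmul_eq_mul]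
  map_eq_zero_of_eq' v i j hv hij := by
    fin_cases i <;> fin_cases j <;> simp_all

theorem vec_one (v : Fin 1 → C) : v = ![v 0] := by
  funext i; fin_cases i; rfl

theorem vec_two (v : Fin 2 → C) : v = ![v 0, v 1] := by
  funext i; fin_cases i <;> rfl

theorem vec_three (v : Fin 3 → C) : v = ![v 0, v 1, v 2] := by
  funext i; fin_cases i <;> rfl

variable (f : C →+* B) (βC : PoissonBracket C) (βB : PoissonBracket B)

theorem polyDiff_pair (Q : C [⋀^Fin 1]→ₗ[ℤ] B) (a b : C) :
    polyDiff f βC βB Q ![a, b] = βB.br (Q ![a]) (f b) - βB.br (Q ![b]) (f a) - Q ![βC.br a b] :=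
  polyDiff_vecCons_zero f βC βB Q ![b] a

/-- For `Q` a bracket defect, the two groups of three terms match the two Jacobi identities, in the
source and in the target of the homomorphism. -/
theorem polyDiff_triple (Q : C [⋀^Fin 2]→ₗ[ℤ] B) (a b c : C) :
    polyDiff f βC βB Q ![a, b, c] =
      βB.br (Q ![b, c]) (f a) - βB.br (Q ![a, c]) (f b) + βB.br (Q ![a, b]) (f c) +
      Q ![βC.br a b, c] - Q ![βC.br a c, b] + Q ![βC.br b c, a] := by
  have h := polyDiff_vecCons_succ f βC βB Q ![b, c] a
  have h1 : Matrix.vecCons a ![b, c] = ![a, b, c] := rfl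
  have h2 : (0 : Fin 2).removeNth ![b, c] = ![c] := by funext i; fin_cases i; rfl
  have h3 : (1 : Fin 2).removeNth ![b, c] = ![b] := by funext i; fin_cases i; rfl
  have h4 : Finset.Ici (0 : Fin 1) = {0} := rfl
  have h5 : ∀ (v : Fin 0 → C), v = ![] := fun v => Subsingleton.elim _ _
  have h6 : Q ![a, βC.br b c] = - Q ![βC.br b c, a] := map_vecCons_swap Q _ _ _
  rw [Fin.sum_univ_two, Fin.sum_univ_one, h2, h3] at h
  rw [h1] at h
  rw [h]
  simp only [h4, Finset.sum_singleton, h5 (Fin.removeNth (α := fun _ => C) (0 : Fin 1) _)]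
  simp [h6]
  abel

end Alt

/-! ### Differences and bracket defects of families of homomorphisms -/

section Families

variable {k : Type u} [Field k] {X Y : PoissonScheme (Spec (.of k))} {f : PoissonScheme.Hom X Y}
  {A : Type u} [CommRing A] [Algebra k A] [IsArtAlg k A]

variable (f A) in
/-- Families of homomorphisms of rings of sections from `Y` to `X × Spec A` over `U`. -/
abbrev Fam (U : X.X.Opens) : Type u := ∀ i : OpenPair f U,
  Γ(Y.X, i.V) →+* Γ(prodSpec X.str A, prodFst X.str A ⁻¹ᵁ i.W)

/-- A family of homomorphisms over `k`, compatible with restriction and inducing `f^♯` on the closed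
fibre. -/
structure IsLiftFamily {U : X.X.Opens} (Φ : Fam f A U) : Prop where
  map_res : ∀ (i j : OpenPair f U) (hV : j.V ≤ i.V) (hW : j.W ≤ i.W) a,
    Φ j (res Y.X hV a) = res _ ((prodFst X.str A).preimage_mono hW) (Φ i a)
  map_base : ∀ (i : OpenPair f U) {R : (Spec (.of k)).Opens} (hR : i.V ≤ Y.str ⁻¹ᵁ R)
    (hR' : i.W ≤ X.str ⁻¹ᵁ R) (c : Γ(Spec (.of k), R)),
    Φ i (sharp Y.str hR c) = sharp (prodFst X.str A) le_rfl (sharp X.str hR' c)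
  red_eq : ∀ (i : OpenPair f U) a, red i.W (Φ i a) = sharp f.hom i.maps a

theorem OpenPair.base_le {U : X.X.Opens} (i : OpenPair f U) {R : (Spec (.of k)).Opens}
    (hR : i.V ≤ Y.str ⁻¹ᵁ R) : i.W ≤ X.str ⁻¹ᵁ R := by
  rw [← f.w]; exact i.maps.trans (f.hom.preimage_mono hR)

theorem sharp_base_bracket {W : X.X.Opens} {R : (Spec (.of k)).Opens} (hR : W ≤ X.str ⁻¹ᵁ R)
    (c : Γ(Spec (.of k), R)) (r) :
    (X.poisson.prodBracket A _).br (sharp (prodFst X.str A) le_rfl (sharp X.str hR c)) r = 0 := by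
  rw [← tmul_one]
  induction r using tmul_induction with
  | add r r' h h' => rw [map_add, h, h', add_zero]
  | mul a x => rw [prodBracket_tmul, X.poisson.base_bracket, tmul_zero]

/-- `η = (Φ' - Φ) / t`. -/
def IsDiff (t : A) {U : X.X.Opens} (Φ Φ' : Fam f A U) (η : polyVec f 0 U) : Prop :=
  ∀ i a, tmul X.str t (η.1 i ![a]) = Φ' i a - Φ i a

/-- `P = (Φ({a, b}) - {Φ(a), Φ(b)}) / t`. -/
def IsDefect (t : A) {U : X.X.Opens} (Φ : Fam f A U) (P : polyVec f 1 U) : Prop :=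
  ∀ i a b, tmul X.str t (P.1 i ![a, b]) =
    Φ i ((Y.poisson.bracket i.V).br a b) - (X.poisson.prodBracket A _).br (Φ i a) (Φ i b)

variable {U : X.X.Opens} {t : A} {Φ Φ' : Fam f A U}

theorem polyVec_ext_zero {Q Q' : polyVec f 0 U} (h : ∀ i a, Q.1 i ![a] = Q'.1 i ![a]) : Q = Q' :=
  Subtype.ext (funext fun i => AlternatingMap.ext fun v => by rw [vec_one v]; exact h i _)

theorem polyVec_ext_one {Q Q' : polyVec f 1 U} (h : ∀ i a b, Q.1 i ![a, b] = Q'.1 i ![a, b]) :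
    Q = Q' :=
  Subtype.ext (funext fun i => AlternatingMap.ext fun v => by rw [vec_two v]; exact h i _ _)

theorem polyVec_ext_two {Q Q' : polyVec f 2 U}
    (h : ∀ i a b c, Q.1 i ![a, b, c] = Q'.1 i ![a, b, c]) : Q = Q' :=
  Subtype.ext (funext fun i => AlternatingMap.ext fun v => by rw [vec_three v]; exact h i _ _ _)

theorem IsDiff.unique (ht : t ≠ 0) {η η' : polyVec f 0 U} (h : IsDiff t Φ Φ' η)
    (h' : IsDiff t Φ Φ' η') : η = η' :=
  polyVec_ext_zero fun i a => tmul_injective ht ((h i a).trans (h' i a).symm)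

theorem IsDefect.unique (ht : t ≠ 0) {P P' : polyVec f 1 U} (h : IsDefect t Φ P)
    (h' : IsDefect t Φ P') : P = P' :=
  polyVec_ext_one fun i a b => tmul_injective ht ((h i a b).trans (h' i a b).symm)

/-- The derivation rule comes from `Φ'(ab) - Φ(ab) = Φ'(a)(Φ'(b) - Φ(b)) + Φ(b)(Φ'(a) - Φ(a))`: on
multiples of `t` both `Φ'(a)` and `Φ(b)` act through `f^♯`. All identities are checked after
multiplication by `t`, which is injective. -/
theorem exists_isDiff (ht : t ≠ 0) (hm : ∀ m ∈ IsLocalRing.maximalIdeal A, m * t = 0)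
    (H : IsLiftFamily Φ) (H' : IsLiftFamily Φ')
    (h : ∀ i a, ∃ x, tmul X.str t x = Φ' i a - Φ i a) : ∃ η, IsDiff t Φ Φ' η := by
  choose D hD using h
  let D' : ∀ i : OpenPair f U, Γ(Y.X, i.V) →ₗ[ℤ] Γ(X.X, i.W) := fun i =>
    (AddMonoidHom.mk' (D i) fun a b => tmul_injective ht (by
      simp only [tmul_add, hD, map_add]; ring)).toIntLinearMap
  have hD' : ∀ i a, tmul X.str t (D' i a) = Φ' i a - Φ i a := hD
  refine ⟨⟨fun i => AlternatingMap.ofSubsingleton ℤ _ _ (0 : Fin 1) (D' i), ?_, ?_, ?_⟩, hD'⟩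
  · intro i a b v
    change D' i (a * b) = _ * D' i b + _ * D' i a
    refine tmul_injective ht ?_
    rw [← H'.red_eq i a, ← H.red_eq i b, tmul_add, ← mul_tmul hm, ← mul_tmul hm]
    simp only [hD', map_mul]
    ring
  · intro i R hR c v
    refine tmul_injective ht ((hD' i (sharp Y.str hR c)).trans ?_)
    rw [tmul_zero, H'.map_base i hR (i.base_le hR), H.map_base i hR (i.base_le hR), sub_self]
  · intro i j hV hW v
    refine tmul_injective ht ((hD' j _).trans ?_)
    rw [← res_tmul hW, H'.map_res i j hV hW, H.map_res i j hV hW, ← map_sub, ← hD']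
    rfl

/-- By the Leibniz rules of both brackets, the defect at `(ab, c)` is `Φ(a)` times that at `(b, c)`
plus `Φ(b)` times that at `(a, c)`, and on multiples of `t` the factors `Φ(a)`, `Φ(b)` act as
`f^♯(a)`, `f^♯(b)`. -/
theorem exists_isDefect (ht : t ≠ 0) (hm : ∀ m ∈ IsLocalRing.maximalIdeal A, m * t = 0)
    (H : IsLiftFamily Φ)
    (h : ∀ i a b, ∃ x, tmul X.str t x = Φ i ((Y.poisson.bracket i.V).br a b) -
      (X.poisson.prodBracket A _).br (Φ i a) (Φ i b)) : ∃ P, IsDefect t Φ P := by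
  choose P hP using h
  let P' : ∀ i : OpenPair f U, Γ(Y.X, i.V) →ₗ[ℤ] Γ(Y.X, i.V) →ₗ[ℤ] Γ(X.X, i.W) := fun i =>
    (AddMonoidHom.mk' (fun a => (AddMonoidHom.mk' (P i a) fun b b' => tmul_injective ht (by
        simp only [tmul_add, hP, map_add]; ring)).toIntLinearMap) fun a a' => by
      ext b
      refine tmul_injective ht ?_
      change tmul X.str t (P i (a + a') b) = tmul X.str t (P i a b + P i a' b)
      simp only [tmul_add, hP, map_add, LinearMap.add_apply]
      ring).toIntLinearMap
  have hP' : ∀ i a b, tmul X.str t (P' i a b) = Φ i ((Y.poisson.bracket i.V).br a b) -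
      (X.poisson.prodBracket A _).br (Φ i a) (Φ i b) := hP
  have hself : ∀ i a, P' i a a = 0 := fun i a => tmul_injective ht (by
    rw [hP', PoissonBracket.self, PoissonBracket.self, map_zero, sub_zero, tmul_zero])
  refine ⟨⟨fun i => altPair (P' i) (hself i), ?_, ?_, ?_⟩, hP'⟩
  · intro i a b v
    change P' i (a * b) (v 0) = _ * P' i b (v 0) + _ * P' i a (v 0)
    refine tmul_injective ht ?_
    rw [← H.red_eq i a, ← H.red_eq i b, tmul_add, ← mul_tmul hm, ← mul_tmul hm]
    simp only [hP', map_mul, PoissonBracket.leibniz', map_add]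
    ring
  · intro i R hR c v
    refine tmul_injective ht ((hP' i _ _).trans ?_)
    change Φ i ((Y.poisson.bracket i.V).br (sharp Y.str hR c) _) -
      (X.poisson.prodBracket A _).br (Φ i (sharp Y.str hR c)) _ = _
    rw [tmul_zero, H.map_base i hR (i.base_le hR), sharp_base_bracket, Y.poisson.base_bracket,
      map_zero, sub_zero]
  · intro i j hV hW v
    refine tmul_injective ht ((hP' j _ _).trans ?_)
    have h1 := (X.poisson.prod A).res_bracket ((prodFst X.str A).preimage_mono hW)
      (Φ i (v 0)) (Φ i (v 1))
    change _ = (X.poisson.prodBracket A _).br _ _ at h1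
    rw [← res_tmul hW, ← Y.poisson.res_bracket hV, H.map_res i j hV hW, H.map_res i j hV hW,
      H.map_res i j hV hW, ← h1]
    exact ((congrArg _ (hP' i (v 0) (v 1))).trans (map_sub _ _ _)).symm

/-- Expand `{Φ(a) + t η(a), Φ(b) + t η(b)}`: the term `{t η(a), t η(b)}` vanishes because `t η(b)`
reduces to zero, and the linear terms, with `t η({a, b})`, form `-t π(η)(a, b)`. -/
theorem IsDefect.of_isDiff (hm : ∀ m ∈ IsLocalRing.maximalIdeal A, m * t = 0)
    (htm : t ∈ IsLocalRing.maximalIdeal A) (H : IsLiftFamily Φ)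
    {P : polyVec f 1 U} {η : polyVec f 0 U} (hP : IsDefect t Φ P) (hη : IsDiff t Φ Φ' η) :
    IsDefect t Φ' (P - polyVecD f 0 U η) := by
  intro i a b
  have h : ∀ a, Φ' i a = Φ i a + tmul X.str t (η.1 i ![a]) := fun a => by rw [hη]; ring
  have e : (P - polyVecD f 0 U η).1 i ![a, b] = P.1 i ![a, b] -
      polyDiff (sharp f.hom i.maps) (Y.poisson.bracket i.V) (X.poisson.bracket i.W) (η.1 i) ![a, b] :=
    rfl
  rw [e, polyDiff_pair, tmul_sub, hP, h, h, h]
  simp only [map_add, LinearMap.add_apply, tmul_bracket hm, bracket_tmul hm, red_tmul_eq_zero htm,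
    H.red_eq, map_zero, tmul_zero, tmul_sub]
  rw [(X.poisson.bracket i.W).skew (η.1 i ![b]), tmul_neg]
  ring

/-- In `t π(P)(a, b, c)` the mixed terms such as `{Φ({b, c}), Φ(a)}` occur twice with opposite
signs. What remains is `Φ` of the Jacobi identity on `Y` and the Jacobi identity on `X × Spec A` for
`Φ(a), Φ(b), Φ(c)`. -/
theorem IsDefect.polyVecD_eq_zero (ht : t ≠ 0) (hm : ∀ m ∈ IsLocalRing.maximalIdeal A, m * t = 0)
    (H : IsLiftFamily Φ) {P : polyVec f 1 U} (hP : IsDefect t Φ P) : polyVecD f 1 U P = 0 := by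
  refine polyVec_ext_two fun i a b c => tmul_injective ht ?_
  change tmul X.str t (polyDiff (sharp f.hom i.maps) (Y.poisson.bracket i.V)
    (X.poisson.bracket i.W) (P.1 i) ![a, b, c]) = tmul X.str t 0
  have hP' : ∀ a b, tmul X.str t ((P.1 i : Γ(Y.X, i.V) [⋀^Fin 2]→ₗ[ℤ] Γ(X.X, i.W)) ![a, b]) =
    Φ i ((Y.poisson.bracket i.V).br a b) - (X.poisson.prodBracket A _).br (Φ i a) (Φ i b) := hP i
  rw [polyDiff_triple]
  simp only [tmul_add, tmul_sub, ← H.red_eq, ← tmul_bracket hm, hP', tmul_zero, map_sub,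
    LinearMap.sub_apply]
  set β := X.poisson.prodBracket A (prodFst X.str A ⁻¹ᵁ i.W)
  set γ := Y.poisson.bracket i.V
  have h1 := congrArg (Φ i) (γ.jacobi a b c)
  rw [map_add, γ.skew a (γ.br b c), γ.skew b (γ.br a c), map_neg, map_neg] at h1
  have h2 := β.jacobi (Φ i a) (Φ i b) (Φ i c)
  rw [β.skew (Φ i a) (β.br (Φ i b) (Φ i c)), β.skew (Φ i b) (β.br (Φ i a) (Φ i c))] at h2
  linear_combination h2 - h1

/-- The family `Φ + t η` is multiplicative because `η` is a derivation along `f^♯` and `t² = 0`; it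
still induces `f^♯` on the closed fibre because `t` lies in the maximal ideal. -/
theorem exists_isLiftFamily_isDiff (hm : ∀ m ∈ IsLocalRing.maximalIdeal A, m * t = 0)
    (htm : t ∈ IsLocalRing.maximalIdeal A) (H : IsLiftFamily Φ) (η : polyVec f 0 U) :
    ∃ Φ' : Fam f A U, IsLiftFamily Φ' ∧ IsDiff t Φ Φ' η := by
  have hmul : ∀ i a b, η.1 i ![a * b] = sharp f.hom i.maps a * η.1 i ![b] +
      sharp f.hom i.maps b * η.1 i ![a] := fun i a b => η.2.1 i a b ![]
  -- The derivation rule at `1 · 1` gives `η(1) = 2 η(1)`.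
  have hone : ∀ i, η.1 i ![1] = 0 := fun i => by
    have := hmul i 1 1
    simpa using this
  have hzero : ∀ i, η.1 i ![0] = 0 := fun i => (η.1 i).map_coord_zero 0 rfl
  let Φ' : Fam f A U := fun i =>
    { toFun := fun a => Φ i a + tmul X.str t (η.1 i ![a])
      map_one' := by rw [hone, tmul_zero, map_one, add_zero]
      map_zero' := by rw [hzero, tmul_zero, map_zero, add_zero]
      map_add' := fun a b => by rw [map_one_add, tmul_add, map_add]; ring
      map_mul' := fun a b => by
        have h0 : tmul X.str t (η.1 i ![a]) * tmul X.str t (η.1 i ![b]) = 0 := by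
          rw [mul_tmul hm, red_tmul_eq_zero htm, zero_mul, tmul_zero]
        rw [hmul, tmul_add, ← H.red_eq, ← H.red_eq, ← mul_tmul hm, ← mul_tmul hm, map_mul]
        linear_combination -h0 }
  have hΦ' : ∀ i a, Φ' i a = Φ i a + tmul X.str t (η.1 i ![a]) := fun _ _ => rfl
  refine ⟨Φ', ⟨fun i j hV hW a => ?_, fun i R hR hR' c => ?_, fun i a => ?_⟩, fun i a => ?_⟩
  · have h1 := η.2.2.2 i j hV hW ![a]
    rw [vec_one fun l => res Y.X hV (![a] l)] at h1
    change η.1 j ![res Y.X hV a] = _ at h1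
    rw [hΦ', hΦ', h1, H.map_res i j hV hW, map_add, res_tmul]
  · have h1 := η.2.2.1 i R hR c ![]
    rw [hΦ', h1, H.map_base i hR hR', tmul_zero, add_zero]
  · rw [hΦ', map_add, red_tmul_eq_zero htm, add_zero, H.red_eq]
  · rw [hΦ']; ring

end Families

/-! ### Čech hypercohomology in low degrees -/

namespace PresheafComplex

section Limit

variable {T : Type u} [TopologicalSpace T] (K : PresheafComplex T) {n : ℕ} {𝒰 𝒱 : PointCover T}

/-- Functoriality of restriction is what allows a class that vanishes in the colimit to be killed on
some finer cover (`exists_of_cls_eq_zero`). -/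
instance (n : ℕ) : DirectedSystem (fun 𝒰 => K.CoverH 𝒰 n) (fun 𝒰 𝒱 h => K.coverHMap n 𝒰 𝒱 h) where
  map_self 𝒰 x := by
    obtain ⟨x, rfl⟩ := QuotientAddGroup.mk_surjective x
    refine congrArg QuotientAddGroup.mk (Subtype.ext ?_)
    funext i s
    exact K.res_self _ _
  map_map 𝒰 𝒱 𝒲 h h' x := by
    obtain ⟨x, rfl⟩ := QuotientAddGroup.mk_surjective x
    refine congrArg QuotientAddGroup.mk (Subtype.ext ?_)
    funext i s
    exact K.res_res _ _ _ _

theorem exists_cls (z : K.HyperH n) : ∃ 𝒰 α, K.cls n 𝒰 α = z := by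
  classical
  induction z using AddCommGroup.DirectLimit.induction_on with
  | ih 𝒰 x =>
    obtain ⟨x, rfl⟩ := QuotientAddGroup.mk_surjective x
    exact ⟨𝒰, x, rfl⟩

theorem cls_totRes (h : 𝒰 ≤ 𝒱) (α : (K.totD 𝒰 n).ker) :
    K.cls n 𝒱 ⟨K.totRes h n α.1, K.totRes_mem_ker h n α.1 α.2⟩ = K.cls n 𝒰 α := by
  classical
  exact AddCommGroup.DirectLimit.of_f (G := fun 𝒰 => K.CoverH 𝒰 n) (f := K.coverHMap n) h
    (QuotientAddGroup.mk α)

theorem cls_sub (α β : (K.totD 𝒰 n).ker) : K.cls n 𝒰 (α - β) = K.cls n 𝒰 α - K.cls n 𝒰 β := by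
  classical
  exact map_sub (AddCommGroup.DirectLimit.of (fun 𝒰 => K.CoverH 𝒰 n) (K.coverHMap n) 𝒰)
    (QuotientAddGroup.mk α : K.CoverH 𝒰 n) (QuotientAddGroup.mk β)

theorem cls_eq_zero_of_mem (α : (K.totD 𝒰 n).ker) (h : α.1 ∈ K.cobound 𝒰 n) :
    K.cls n 𝒰 α = 0 := by
  classical
  have : (QuotientAddGroup.mk α : K.CoverH 𝒰 n) = 0 := (QuotientAddGroup.eq_zero_iff _).2 h
  exact (congrArg (AddCommGroup.DirectLimit.of (fun 𝒰 => K.CoverH 𝒰 n) (K.coverHMap n) 𝒰) this).trans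
    (map_zero _)

theorem exists_of_cls_eq_zero (α : (K.totD 𝒰 n).ker) (h : K.cls n 𝒰 α = 0) :
    ∃ (𝒱 : PointCover T) (h : 𝒰 ≤ 𝒱), K.totRes h n α.1 ∈ K.cobound 𝒱 n := by
  classical
  obtain ⟨𝒱, h, h'⟩ := AddCommGroup.DirectLimit.of.zero_exact
    (G := fun 𝒰 => K.CoverH 𝒰 n) (f := K.coverHMap n) _ _ h
  exact ⟨𝒱, h, (QuotientAddGroup.eq_zero_iff
    (⟨K.totRes h n α.1, K.totRes_mem_ker h n α.1 α.2⟩ : (K.totD 𝒱 n).ker)).1 h'⟩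

end Limit

section Low

variable {T : Type u} [TopologicalSpace T] (K : PresheafComplex T) {𝒰 : PointCover T}

theorem tot_ext_zero {x y : K.Tot 𝒰 0} (h : ∀ s, x ⟨(0, 0), rfl⟩ s = y ⟨(0, 0), rfl⟩ s) : x = y := by
  funext ⟨⟨p, q⟩, e⟩
  obtain ⟨rfl, rfl⟩ : p = 0 ∧ q = 0 := by simp only at e; omega
  exact funext h

theorem tot_ext_one {x y : K.Tot 𝒰 1} (h : ∀ s, x ⟨(0, 1), rfl⟩ s = y ⟨(0, 1), rfl⟩ s)
    (h' : ∀ s, x ⟨(1, 0), rfl⟩ s = y ⟨(1, 0), rfl⟩ s) : x = y := by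
  funext ⟨⟨p, q⟩, e⟩
  obtain ⟨rfl, rfl⟩ | ⟨rfl, rfl⟩ : (p = 0 ∧ q = 1) ∨ (p = 1 ∧ q = 0) := by simp only at e; omega
  · exact funext h
  · exact funext h'

theorem tot_ext_two {x y : K.Tot 𝒰 2} (h : ∀ s, x ⟨(0, 2), rfl⟩ s = y ⟨(0, 2), rfl⟩ s)
    (h' : ∀ s, x ⟨(1, 1), rfl⟩ s = y ⟨(1, 1), rfl⟩ s)
    (h'' : ∀ s, x ⟨(2, 0), rfl⟩ s = y ⟨(2, 0), rfl⟩ s) : x = y := by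
  funext ⟨⟨p, q⟩, e⟩
  obtain ⟨rfl, rfl⟩ | ⟨rfl, rfl⟩ | ⟨rfl, rfl⟩ : (p = 0 ∧ q = 2) ∨ (p = 1 ∧ q = 1) ∨
    (p = 2 ∧ q = 0) := by simp only at e; omega
  · exact funext h
  · exact funext h'
  · exact funext h''

theorem totD_zero_vert (x : K.Tot 𝒰 0) (s : Fin 1 → T) :
    K.totD 𝒰 0 x ⟨(0, 1), rfl⟩ s = K.d 0 _ (x ⟨(0, 0), rfl⟩ s) := by
  simp [totD, totVert, totCech, vertD]

/-- In degree `0` the sign `(-1)^(n+1)` reverses `δ`: at `(x, y)` the value is that at `x` minus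
that at `y`. With this sign `P ↦ P - π(η)` and `ξ_xy ↦ ξ_xy + η_y - η_x` are together `α ↦ α - D η`.
-/
theorem totD_zero_cech (x : K.Tot 𝒰 0) (s : Fin 2 → T) :
    K.totD 𝒰 0 x ⟨(1, 0), rfl⟩ s =
      K.res 0 (𝒰.inter_removeNth s 1) (x ⟨(0, 0), rfl⟩ (Fin.removeNth 1 s)) -
      K.res 0 (𝒰.inter_removeNth s 0) (x ⟨(0, 0), rfl⟩ (Fin.removeNth 0 s)) := by
  simp [totD, totVert, totCech, cechD, Fin.sum_univ_two]
  abel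

theorem totD_one_vert (x : K.Tot 𝒰 1) (s : Fin 1 → T) :
    K.totD 𝒰 1 x ⟨(0, 2), rfl⟩ s = K.d 1 _ (x ⟨(0, 1), rfl⟩ s) := by
  simp [totD, totVert, totCech, vertD]

theorem totD_one_mid (x : K.Tot 𝒰 1) (s : Fin 2 → T) :
    K.totD 𝒰 1 x ⟨(1, 1), rfl⟩ s = K.d 0 _ (x ⟨(1, 0), rfl⟩ s) +
      (K.res 1 (𝒰.inter_removeNth s 0) (x ⟨(0, 1), rfl⟩ (Fin.removeNth 0 s)) -
      K.res 1 (𝒰.inter_removeNth s 1) (x ⟨(0, 1), rfl⟩ (Fin.removeNth 1 s))) := by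
  simp [totD, totVert, totCech, cechD, vertD, Fin.sum_univ_two]
  abel

theorem totD_one_cech (x : K.Tot 𝒰 1) (s : Fin 3 → T) :
    K.totD 𝒰 1 x ⟨(2, 0), rfl⟩ s =
      K.res 0 (𝒰.inter_removeNth s 0) (x ⟨(1, 0), rfl⟩ (Fin.removeNth 0 s)) -
      K.res 0 (𝒰.inter_removeNth s 1) (x ⟨(1, 0), rfl⟩ (Fin.removeNth 1 s)) +
      K.res 0 (𝒰.inter_removeNth s 2) (x ⟨(1, 0), rfl⟩ (Fin.removeNth 2 s)) := by
  simp [totD, totVert, totCech, cechD, Fin.sum_univ_three]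
  abel

end Low

end PresheafComplex

/-! ### Obstruction cochains of families of local liftings -/

section Obstruction

variable {k : Type u} [Field k] {X Y : PoissonScheme (Spec (.of k))} {f : PoissonScheme.Hom X Y}
  {A : Type u} [CommRing A] [Algebra k A] [IsArtAlg k A]

/-- The restriction to an intersection of members of a cover of the family with index `s j`. -/
def restr {𝒰 : PointCover X.X} (F : ∀ x, Fam f A (𝒰.nhd x)) {p : ℕ} (s : Fin (p + 1) → X.X)
    (j : Fin (p + 1)) : Fam f A (𝒰.inter s) :=
  fun i => F (s j) (i.mono (iInf_le _ j))

/-- `α = ({P_x}, {ξ_xy})` with `t P_x(a, b) = Φ_x({a, b}) - {Φ_x(a), Φ_x(b)}` and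
`t ξ_xy = Φ_y - Φ_x`. -/
def IsObs (t : A) {𝒰 : PointCover X.X} (F : ∀ x, Fam f A (𝒰.nhd x))
    (α : (polyComplex f).Tot 𝒰 1) : Prop :=
  (∀ s, IsDefect t (restr F s 0) (α ⟨(0, 1), rfl⟩ s)) ∧
  ∀ s, IsDiff t (restr F s 0) (restr F s 1) (α ⟨(1, 0), rfl⟩ s)

variable {t : A} {U U' : X.X.Opens}

theorem IsLiftFamily.mono (h : U' ≤ U) {Φ : Fam f A U} (H : IsLiftFamily Φ) :
    IsLiftFamily (fun i : OpenPair f U' => Φ (i.mono h)) :=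
  ⟨fun i j => H.map_res (i.mono h) (j.mono h), fun i => H.map_base (i.mono h),
    fun i => H.red_eq (i.mono h)⟩

variable {𝒰 𝒱 : PointCover X.X} {F F' : ∀ x, Fam f A (𝒰.nhd x)}

theorem isLiftFamily_restr (H : ∀ x, IsLiftFamily (F x)) {p : ℕ} (s : Fin (p + 1) → X.X)
    (j : Fin (p + 1)) : IsLiftFamily (restr F s j) :=
  (H (s j)).mono _

theorem IsDiff.res {Φ Φ' : Fam f A U} {η : polyVec f 0 U} (h : U' ≤ U) (hη : IsDiff t Φ Φ' η) :
    IsDiff t (fun i : OpenPair f U' => Φ (i.mono h)) (fun i => Φ' (i.mono h))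
      ((polyComplex f).res 0 h η) :=
  fun i a => hη (i.mono h) a

theorem IsDefect.res {Φ : Fam f A U} {P : polyVec f 1 U} (h : U' ≤ U) (hP : IsDefect t Φ P) :
    IsDefect t (fun i : OpenPair f U' => Φ (i.mono h)) ((polyComplex f).res 1 h P) :=
  fun i a b => hP (i.mono h) a b

theorem IsDiff.add {Φ Φ' Φ'' : Fam f A U} {η η' : polyVec f 0 U} (h : IsDiff t Φ Φ' η)
    (h' : IsDiff t Φ' Φ'' η') : IsDiff t Φ Φ'' (η + η') := fun i a => by
  change tmul X.str t (η.1 i ![a] + η'.1 i ![a]) = _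
  rw [tmul_add, h, h']; ring

theorem IsDiff.neg {Φ Φ' : Fam f A U} {η : polyVec f 0 U} (h : IsDiff t Φ Φ' η) :
    IsDiff t Φ' Φ (-η) := fun i a => by
  change tmul X.str t (- η.1 i ![a]) = _
  rw [tmul_neg, h]; ring

theorem IsObs.unique (ht : t ≠ 0) {α α' : (polyComplex f).Tot 𝒰 1} (h : IsObs t F α)
    (h' : IsObs t F α') : α = α' :=
  (polyComplex f).tot_ext_one (fun s => (h.1 s).unique ht (h'.1 s))
    (fun s => (h.2 s).unique ht (h'.2 s))

theorem IsObs.totRes (h : 𝒰 ≤ 𝒱) {α : (polyComplex f).Tot 𝒰 1} (hα : IsObs t F α) :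
    IsObs (𝒰 := 𝒱) t (fun x i => F x (i.mono (h x))) ((polyComplex f).totRes h 1 α) :=
  ⟨fun s => (hα.1 s).res (PointCover.inter_mono h s),
    fun s => (hα.2 s).res (PointCover.inter_mono h s)⟩

/-- Changing the liftings by `t η` changes the obstruction cochain by the coboundary of `-η`. -/
theorem IsObs.sub_totD (hm : ∀ m ∈ IsLocalRing.maximalIdeal A, m * t = 0)
    (htm : t ∈ IsLocalRing.maximalIdeal A) (H : ∀ x, IsLiftFamily (F x))
    {α : (polyComplex f).Tot 𝒰 1} (hα : IsObs t F α) {η : (polyComplex f).Tot 𝒰 0}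
    (hη : ∀ s, IsDiff t (restr F s 0) (restr F' s 0) (η ⟨(0, 0), rfl⟩ s)) :
    IsObs t F' (α - (polyComplex f).totD 𝒰 0 η) := by
  constructor
  · intro s
    have h := (hα.1 s).of_isDiff hm htm (isLiftFamily_restr H s 0) (hη s)
    have e : (α - (polyComplex f).totD 𝒰 0 η) ⟨(0, 1), rfl⟩ s =
        α ⟨(0, 1), rfl⟩ s - (polyComplex f).d 0 _ (η ⟨(0, 0), rfl⟩ s) :=
      congrArg (α ⟨(0, 1), rfl⟩ s - ·) ((polyComplex f).totD_zero_vert η s)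
    rw [e]
    exact h
  · intro s
    -- Removing the index `0` leaves `s 1`, and removing the index `1` leaves `s 0`.
    have h1 : IsDiff t (restr F s 1) (restr F' s 1) ((polyComplex f).res 0 (𝒰.inter_removeNth s 0)
        (η ⟨(0, 0), rfl⟩ (Fin.removeNth 0 s))) :=
      (hη (Fin.removeNth 0 s)).res (𝒰.inter_removeNth s 0)
    have h0 : IsDiff t (restr F s 0) (restr F' s 0) ((polyComplex f).res 0 (𝒰.inter_removeNth s 1)
        (η ⟨(0, 0), rfl⟩ (Fin.removeNth 1 s))) :=
      (hη (Fin.removeNth 1 s)).res (𝒰.inter_removeNth s 1)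
    have h := (h0.neg.add (hα.2 s)).add h1
    have e : (α - (polyComplex f).totD 𝒰 0 η) ⟨(1, 0), rfl⟩ s =
        α ⟨(1, 0), rfl⟩ s - ((polyComplex f).totD 𝒰 0 η) ⟨(1, 0), rfl⟩ s := rfl
    rw [e, (polyComplex f).totD_zero_cech]
    have e' : ∀ {G : Type u} [AddCommGroup G] (a b c : G), a - (b - c) = -b + a + c :=
      fun a b c => by abel
    exact Eq.mpr (congrArg (IsDiff t (restr F' s 0) (restr F' s 1))
      (e' (G := polyVec f 0 (𝒰.inter s)) _ _ _)) h

/-- The three bidegrees have three reasons: in `(0, 2)` the Jacobi identities; in `(1, 1)` the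
comparison of the defects of `Φ_x` and `Φ_y = Φ_x + t ξ_xy`; in `(2, 0)` the identity `(Φ_z - Φ_y) +
(Φ_y - Φ_x) = Φ_z - Φ_x`. -/
theorem IsObs.totD_eq_zero (ht : t ≠ 0) (hm : ∀ m ∈ IsLocalRing.maximalIdeal A, m * t = 0)
    (htm : t ∈ IsLocalRing.maximalIdeal A) (H : ∀ x, IsLiftFamily (F x))
    {α : (polyComplex f).Tot 𝒰 1} (hα : IsObs t F α) : (polyComplex f).totD 𝒰 1 α = 0 := by
  refine (polyComplex f).tot_ext_two (fun s => ?_) (fun s => ?_) (fun s => ?_)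
  · rw [(polyComplex f).totD_one_vert]
    exact (hα.1 s).polyVecD_eq_zero ht hm (isLiftFamily_restr H s 0)
  · rw [(polyComplex f).totD_one_mid]
    have h0 : IsDefect t (restr F s 0) ((polyComplex f).res 1 (𝒰.inter_removeNth s 1)
        (α ⟨(0, 1), rfl⟩ (Fin.removeNth 1 s))) :=
      (hα.1 (Fin.removeNth 1 s)).res (𝒰.inter_removeNth s 1)
    have h1 : IsDefect t (restr F s 1) ((polyComplex f).res 1 (𝒰.inter_removeNth s 0)
        (α ⟨(0, 1), rfl⟩ (Fin.removeNth 0 s))) :=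
      (hα.1 (Fin.removeNth 0 s)).res (𝒰.inter_removeNth s 0)
    have h := h1.unique ht (h0.of_isDiff hm htm (isLiftFamily_restr H s 0) (hα.2 s))
    have e : ∀ {G : Type u} [AddCommGroup G] {a b c : G}, b = c - a → a + (b - c) = 0 := by
      rintro G _ a b c rfl; abel
    exact e (G := polyVec f 1 (𝒰.inter s)) h
  · rw [(polyComplex f).totD_one_cech]
    have h0 : IsDiff t (restr F s 1) (restr F s 2) ((polyComplex f).res 0 (𝒰.inter_removeNth s 0)
        (α ⟨(1, 0), rfl⟩ (Fin.removeNth 0 s))) :=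
      (hα.2 (Fin.removeNth 0 s)).res (𝒰.inter_removeNth s 0)
    have h1 : IsDiff t (restr F s 0) (restr F s 2) ((polyComplex f).res 0 (𝒰.inter_removeNth s 1)
        (α ⟨(1, 0), rfl⟩ (Fin.removeNth 1 s))) :=
      (hα.2 (Fin.removeNth 1 s)).res (𝒰.inter_removeNth s 1)
    have h2 : IsDiff t (restr F s 0) (restr F s 1) ((polyComplex f).res 0 (𝒰.inter_removeNth s 2)
        (α ⟨(1, 0), rfl⟩ (Fin.removeNth 2 s))) :=
      (hα.2 (Fin.removeNth 2 s)).res (𝒰.inter_removeNth s 2)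
    have h := h1.unique ht (h2.add h0)
    have e : ∀ {G : Type u} [AddCommGroup G] {a b c : G}, b = c + a → a - b + c = 0 := by
      rintro G _ a b c rfl; abel
    exact e (G := polyVec f 0 (𝒰.inter s)) h

/-- Liftings with vanishing obstruction cochain glue to a deformation. -/
theorem IsObs.isDefFamily (H : ∀ x, IsLiftFamily (F x)) (h0 : IsObs t F 0) : IsDefFamily 𝒰 F := by
  -- The component `ξ = 0` says that the families of `x` and `y` agree wherever both are defined;
  -- the component `P = 0`, used below, says that each preserves brackets.
  have hdiff : ∀ (x y : X.X) (V : Y.X.Opens) (W : X.X.Opens) (hx : W ≤ 𝒰.nhd x) (hy : W ≤ 𝒰.nhd y)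
      (hV : W ≤ f.hom ⁻¹ᵁ V) a, F y ⟨V, W, hy, hV⟩ a = F x ⟨V, W, hx, hV⟩ a := by
    intro x y V W hx hy hV a
    have h := h0.2 ![x, y] ⟨V, W, le_iInf fun j => by fin_cases j <;> assumption, hV⟩ a
    exact (sub_eq_zero.1 (h.symm.trans (tmul_zero t)))
  refine ⟨fun {x y} i j hV hW a => ?_, fun {x} i c => ?_, fun {x} i a => (H x).red_eq i a,
    fun {x} i a b => ?_⟩
  · have h1 := (H x).map_res i ⟨j.V, j.W, hW.trans i.le, j.maps⟩ hV hW a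
    exact (hdiff x y j.V j.W (hW.trans i.le) j.le j.maps _).trans h1
  · have := (H x).map_base i (R := ⊤) (le_preimage_top _ _) (le_preimage_top _ _)
      ((Scheme.ΓSpecIso (.of k)).inv.hom c)
    exact this.trans (scal_prodFst (A := A) c).symm
  · have h := h0.1 (fun _ => x) ⟨i.V, i.W, le_iInf fun _ => i.le, i.maps⟩ a b
    exact sub_eq_zero.1 (h.symm.trans (tmul_zero t))

theorem exists_isObs_of_forall (ht : t ≠ 0) (hm : ∀ m ∈ IsLocalRing.maximalIdeal A, m * t = 0)
    (H : ∀ x, IsLiftFamily (F x))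
    (h : ∀ x i a b, ∃ c, tmul X.str t c = F x i ((Y.poisson.bracket i.V).br a b) -
      (X.poisson.prodBracket A _).br (F x i a) (F x i b))
    (h' : ∀ s : Fin 2 → X.X, ∀ i a, ∃ c, tmul X.str t c = restr F s 1 i a - restr F s 0 i a) :
    ∃ α : (polyComplex f).Tot 𝒰 1, IsObs t F α := by
  choose P hP using fun s : Fin 1 → X.X => exists_isDefect (Φ := restr F s 0) ht hm
    (isLiftFamily_restr H s 0) (fun i a b => h (s 0) (i.mono (iInf_le _ 0)) a b)
  choose ξ hξ using fun s : Fin 2 → X.X => exists_isDiff (Φ := restr F s 0) (Φ' := restr F s 1) ht hm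
    (isLiftFamily_restr H s 0) (isLiftFamily_restr H s 1) (h' s)
  -- Only the bidegrees `(0, 1)` and `(1, 0)` have total degree `1`; the other cases are excluded by
  -- `p + q = 1`, and `0` is a filler.
  let α : ∀ p q : ℕ, p + q = 1 → (polyComplex f).Cochain 𝒰 p q := fun p q =>
    match p, q with
    | 0, 1 => fun _ => P
    | 1, 0 => fun _ => ξ
    | 0, 0 => fun _ => 0
    | _ + 1, _ + 1 => fun _ => 0
    | _ + 2, 0 => fun _ => 0
    | 0, _ + 2 => fun _ => 0
  exact ⟨fun i => α i.1.1 i.1.2 i.2, hP, hξ⟩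

theorem exists_tot_zero (η : ∀ s : Fin 1 → X.X, polyVec f 0 (𝒰.inter s)) :
    ∃ α : (polyComplex f).Tot 𝒰 0, ∀ s, α ⟨(0, 0), rfl⟩ s = η s := by
  let α : ∀ p q : ℕ, p + q = 0 → (polyComplex f).Cochain 𝒰 p q := fun p q =>
    match p, q with
    | 0, 0 => fun _ => η
    | _ + 1, _ => fun _ => 0
    | 0, _ + 1 => fun _ => 0
  exact ⟨fun i => α i.1.1 i.1.2 i.2, fun s => rfl⟩

/-- Families can be changed by any `0`-cochain. -/
theorem exists_isDiff_of_tot (hm : ∀ m ∈ IsLocalRing.maximalIdeal A, m * t = 0)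
    (htm : t ∈ IsLocalRing.maximalIdeal A) (H : ∀ x, IsLiftFamily (F x))
    (η : (polyComplex f).Tot 𝒰 0) :
    ∃ F' : ∀ x, Fam f A (𝒰.nhd x), (∀ x, IsLiftFamily (F' x)) ∧
      ∀ s, IsDiff t (restr F s 0) (restr F' s 0) (η ⟨(0, 0), rfl⟩ s) := by
  have hle : ∀ x, 𝒰.nhd x ≤ 𝒰.inter (p := 0) (fun _ => x) := fun x => le_iInf fun _ => le_rfl
  choose F' hF' hη using fun x => exists_isLiftFamily_isDiff hm htm (H x)
    ((polyComplex f).res 0 (hle x) (η ⟨(0, 0), rfl⟩ fun _ => x))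
  refine ⟨F', hF', fun s => ?_⟩
  obtain ⟨x, rfl⟩ : ∃ x, s = fun _ => x := ⟨s 0, funext fun i => by fin_cases i; rfl⟩
  exact fun i a => hη x (i.mono (iInf_le _ 0)) a

end Obstruction

/-! ### Morphisms to affine opens and lifting along square-zero extensions -/

section Affine

variable {Z Y : Scheme.{u}}

theorem top_le_ι (O : Z.Opens) : ⊤ ≤ O.ι ⁻¹ᵁ O := by simp

theorem ι_sharp_topIso (O : Z.Opens) (b : Γ(O, ⊤)) :
    sharp O.ι (top_le_ι O) (O.topIso.hom.hom b) = b := by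
  have h3 : O ≤ O.ι ''ᵁ ⊤ := O.ι_image_top.ge
  have h2 : O.ι ''ᵁ (O.ι ⁻¹ᵁ O) ≤ O := O.ι.image_preimage_eq_opensRange_inf O ▸ inf_le_right
  have h1 : O.ι ''ᵁ ⊤ ≤ O.ι ''ᵁ (O.ι ⁻¹ᵁ O) := O.ι.image_mono (top_le_ι O)
  have h : ∀ b : Γ(Z, O.ι ''ᵁ ⊤), res Z h1 (res Z h2 (res Z h3 b)) = b := fun b => by
    rw [res_res, res_res, res_self]
  exact h b

theorem topIso_ι_sharp (O : Z.Opens) (b : Γ(Z, O)) :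
    O.topIso.hom.hom (sharp O.ι (top_le_ι O) b) = b := by
  obtain ⟨b, rfl⟩ := O.topIso.commRingCatIsoToRingEquiv.surjective b
  exact congrArg _ (ι_sharp_topIso O b)

/-- Sections over `O` are functions on the scheme `O`. This turns identities between sections given
by local liftings into identities between morphisms from open subschemes. -/
theorem ι_sharp_injective (O : Z.Opens) : Function.Injective (sharp O.ι (top_le_ι O)) :=
  Function.LeftInverse.injective (topIso_ι_sharp O)

/-- The morphism is the composite `Z ⟶ Spec Γ(Z, ⊤) ⟶ Spec Γ(Y, V) ⟶ Y`; the scheme `Z` need not be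
affine. -/
theorem exists_hom_of_isAffineOpen {V : Y.Opens} (hV : IsAffineOpen V) (g : Γ(Y, V) →+* Γ(Z, ⊤)) :
    ∃ (h : Z ⟶ Y) (hle : ⊤ ≤ h ⁻¹ᵁ V), ∀ a, sharp h hle a = g a := by
  have h1 : ⊤ ≤ hV.fromSpec ⁻¹ᵁ V := hV.fromSpec_preimage_self.ge
  have h2 : ⊤ ≤ (Spec.map (CommRingCat.ofHom g) ≫ hV.fromSpec) ⁻¹ᵁ V := by
    rw [Scheme.Hom.comp_preimage, hV.fromSpec_preimage_self]; simp
  have h3 : ⊤ ≤ (Z.toSpecΓ ≫ Spec.map (CommRingCat.ofHom g) ≫ hV.fromSpec) ⁻¹ᵁ V := by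
    rw [Scheme.Hom.comp_preimage, top_le_iff.1 h2]; simp
  refine ⟨Z.toSpecΓ ≫ Spec.map (CommRingCat.ofHom g) ≫ hV.fromSpec, h3, fun a => ?_⟩
  rw [← sharp_sharp Z.toSpecΓ _ (le_preimage_top _ _) h2,
    ← sharp_sharp (Spec.map (CommRingCat.ofHom g)) _ (le_preimage_top _ _) h1]
  have e1 : sharp hV.fromSpec h1 a = (Scheme.ΓSpecIso Γ(Y, V)).inv.hom a := by
    have : hV.fromSpec.appLE V ⊤ h1 = (Scheme.ΓSpecIso Γ(Y, V)).inv := by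
      rw [Scheme.Hom.appLE, hV.fromSpec_app_self, Category.assoc, ← Functor.map_comp]
      exact (congrArg _ ((Spec Γ(Y, V)).presheaf.map_id _)).trans (Category.comp_id _)
    exact congr($this a)
  have e2 : sharp (Spec.map (CommRingCat.ofHom g)) (le_preimage_top _ ⊤)
      ((Scheme.ΓSpecIso Γ(Y, V)).inv.hom a) = (Scheme.ΓSpecIso Γ(Z, ⊤)).inv.hom (g a) := by
    have := congr($(Scheme.ΓSpecIso_inv_naturality (CommRingCat.ofHom g)) a)
    rw [Scheme.Hom.appTop, Scheme.Hom.app_eq_appLE] at this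
    exact this.symm
  have e3 : sharp Z.toSpecΓ (le_preimage_top _ ⊤) ((Scheme.ΓSpecIso Γ(Z, ⊤)).inv.hom (g a)) =
      g a := by
    have h : (Scheme.ΓSpecIso Γ(Z, ⊤)).inv ≫ Z.toSpecΓ.appTop = 𝟙 _ := by
      rw [Scheme.toSpecΓ_appTop, Iso.inv_hom_id]
    rw [Scheme.Hom.appTop, Scheme.Hom.app_eq_appLE] at h
    exact congr($h (g a))
  rw [e1, e2, e3]

/-- Both morphisms factor through the affine scheme `V`, and a morphism to an affine scheme is
determined by its map on global sections. -/
theorem hom_ext_of_isAffineOpen {V : Y.Opens} (hV : IsAffineOpen V) {p q : Z ⟶ Y}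
    (hp : ⊤ ≤ p ⁻¹ᵁ V) (hq : ⊤ ≤ q ⁻¹ᵁ V) (h : ∀ a, sharp p hp a = sharp q hq a) : p = q := by
  have hr : ∀ {p : Z ⟶ Y}, ⊤ ≤ p ⁻¹ᵁ V → Set.range p ⊆ Set.range V.ι := by
    rintro p hp _ ⟨z, rfl⟩
    rw [Scheme.Opens.range_ι]
    exact hp trivial
  let l : ∀ (p : Z ⟶ Y) (_ : ⊤ ≤ p ⁻¹ᵁ V), Z ⟶ V := fun p hp => IsOpenImmersion.lift V.ι p (hr hp)
  have hl : ∀ p hp, l p hp ≫ V.ι = p := fun p hp => IsOpenImmersion.lift_fac _ _ _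
  have : IsAffine V := hV
  have key : l p hp = l q hq := by
    refine ext_of_isAffine ?_
    ext b
    have e : ∀ p hp, (l p hp).appTop b = sharp p hp (V.topIso.hom.hom b) := fun p hp => by
      rw [Scheme.Hom.appTop, Scheme.Hom.app_eq_appLE]
      have := sharp_sharp (l p hp) V.ι (le_preimage_top _ ⊤) (top_le_ι V) (V.topIso.hom.hom b)
      rw [ι_sharp_topIso] at this
      exact this.trans (sharp_congr (hl p hp) _ _ _)
    exact (e p hp).trans ((h _).trans (e q hq).symm)
  rw [← hl p hp, ← hl q hq, key]

end Affine

/-- This is the infinitesimal lifting property for a square-zero kernel, with the algebra structures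
given as ring homomorphisms so that it applies to rings of sections. -/
theorem exists_lift_of_formallySmooth {R C B B' : Type u} [CommRing R] [CommRing C] [CommRing B]
    [CommRing B'] {r : R →+* C} (hr : r.FormallySmooth) (b' : R →+* B') {π : B' →+* B}
    (hπ : Function.Surjective π) (hker : ∀ x y, π x = 0 → π y = 0 → x * y = 0) (ψ : C →+* B)
    (h : ∀ c, ψ (r c) = π (b' c)) :
    ∃ g : C →+* B', (∀ a, π (g a) = ψ a) ∧ ∀ c, g (r c) = b' c := by
  let _ : Algebra R C := r.toAlgebra
  let _ : Algebra R B' := b'.toAlgebra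
  let _ : Algebra R B := (π.comp b').toAlgebra
  have : Algebra.FormallySmooth R C := hr
  let π' : B' →ₐ[R] B := ⟨π, fun _ => rfl⟩
  let ψ' : C →ₐ[R] B := ⟨ψ, h⟩
  have hn : IsNilpotent (RingHom.ker (π' : B' →+* B)) := by
    refine ⟨2, ?_⟩
    rw [pow_two, Ideal.zero_eq_bot, eq_bot_iff, Ideal.mul_le]
    exact fun x hx y hy => hker x y hx hy
  let g := Algebra.FormallySmooth.liftOfSurjective ψ' π' hπ hn
  exact ⟨g.toRingHom, fun a => Algebra.FormallySmooth.liftOfSurjective_apply ψ' π' hπ hn a,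
    fun c => g.commutes c⟩

/-! ### Local liftings -/

section LocalLift

variable {k : Type u} [Field k] {X Y : PoissonScheme (Spec (.of k))} {f : PoissonScheme.Hom X Y}
  {A A' : Type u} [CommRing A] [Algebra k A] [IsArtAlg k A]
  [CommRing A'] [Algebra k A'] [IsArtAlg k A'] {Ψ : Def f A} {φ : A' →ₐ[k] A} {U : X.X.Opens}

namespace LocalLift

theorem ι_sharp_sharp (L : LocalLift Ψ φ U) (i : OpenPair f U) (a : Γ(Y.X, i.V)) :
    PoissonDef.sharp (prodFst X.str A' ⁻¹ᵁ i.W).ι (top_le_ι _) (L.sharp i a) =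
      PoissonDef.sharp (L.toY i.le) (L.le_toY i) a :=
  ι_sharp_topIso _ _

theorem toY_str (L : LocalLift Ψ φ U) {W : X.X.Opens} (hW : W ≤ U) :
    L.toY hW ≫ Y.str = (prodFst X.str A' ⁻¹ᵁ W).ι ≫ prodFst X.str A' ≫ X.str := by
  rw [toY, Category.assoc, Category.assoc, pullback.condition, reassoc_of% L.w, pullback.condition,
    Scheme.homOfLE_ι_assoc]

/-- This puts the lifting condition on `U` into a form for every smaller `W`, from which
`baseChange_sharp` reads off that the local lifting induces `Ψ` on sections. -/
theorem resLE_toY (L : LocalLift Ψ φ U) {W : X.X.Opens} (hW : W ≤ U) :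
    (prodMap X.str φ).resLE _ _ (le_prodMap_preimage φ W) ≫ L.toY hW =
      (prodFst X.str A ⁻¹ᵁ W).ι ≫ Ψ.hom ≫ prodFst Y.str A := by
  have hle : prodFst X.str A ⁻¹ᵁ W ≤ prodMap X.str φ ⁻¹ᵁ (prodFst X.str A' ⁻¹ᵁ U) :=
    (le_prodMap_preimage φ W).trans
      ((prodMap X.str φ).preimage_mono ((prodFst X.str A').preimage_mono hW))
  have e : (prodMap X.str φ).resLE _ _ (le_prodMap_preimage φ W) ≫
      (prodSpec X.str A').homOfLE ((prodFst X.str A').preimage_mono hW) =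
      (prodSpec X.str A).homOfLE hle ≫ prodMap X.str φ ∣_ (prodFst X.str A' ⁻¹ᵁ U) := by
    rw [← cancel_mono (prodFst X.str A' ⁻¹ᵁ U).ι, Category.assoc, Category.assoc, Scheme.homOfLE_ι,
      Scheme.Hom.resLE_comp_ι, morphismRestrict_ι, Scheme.homOfLE_ι_assoc]
  rw [toY, reassoc_of% e, reassoc_of% L.lift, Scheme.homOfLE_ι_assoc, prodMap_fst]

theorem baseChange_sharp (L : LocalLift Ψ φ U) (i : OpenPair f U) (a : Γ(Y.X, i.V)) :
    baseChange φ i.W (L.sharp i a) = Ψ.sharp i.maps a := by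
  apply ι_sharp_injective
  rw [baseChange, Def.sharp, sharp_sharp, sharp_sharp,
    ← sharp_congr (Scheme.Hom.resLE_comp_ι (prodMap X.str φ) (le_prodMap_preimage φ i.W)) (by
      rw [Scheme.Hom.comp_preimage]; simp),
    ← sharp_sharp _ _ (le_preimage_top _ _) (top_le_ι _), L.ι_sharp_sharp, sharp_sharp]
  exact sharp_congr (L.resLE_toY i.le) _ _ _

theorem isLiftFamily (L : LocalLift Ψ φ U) : IsLiftFamily (L.sharp) := by
  refine ⟨fun i j hV hW a => ?_, fun i R hR hR' c => ?_, fun i a => ?_⟩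
  · apply ι_sharp_injective
    have hle := (prodFst X.str A').preimage_mono hW
    have e : (prodSpec X.str A').homOfLE hle ≫ L.toY i.le = L.toY j.le := by
      rw [toY, toY, Scheme.homOfLE_homOfLE_assoc]
    rw [L.ι_sharp_sharp, sharp_res, sharp_res,
      ← sharp_congr ((prodSpec X.str A').homOfLE_ι hle) (by
        rw [Scheme.Hom.comp_preimage]; simp),
      ← sharp_sharp _ _ (le_preimage_top _ _) (top_le_ι _), L.ι_sharp_sharp, sharp_sharp]
    exact (sharp_congr e _ _ _).symm
  · apply ι_sharp_injective
    rw [L.ι_sharp_sharp, sharp_sharp, sharp_sharp, sharp_sharp]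
    exact sharp_congr (L.toY_str i.le) _ _ _
  · rw [← red_baseChange φ, L.baseChange_sharp, Ψ.red_sharp]

/-- The local lifting given by a lifting of a deformation. -/
def ofDef {Ψ' : Def f A'} (h : IsLifting Ψ φ Ψ') (U : X.X.Opens) : LocalLift Ψ φ U where
  hom := (prodFst X.str A' ⁻¹ᵁ U).ι ≫ Ψ'.hom
  w := by rw [Category.assoc, Ψ'.hom_snd]
  lift := by rw [morphismRestrict_ι_assoc, h]

theorem ofDef_sharp {Ψ' : Def f A'} (h : IsLifting Ψ φ Ψ') (U : X.X.Opens) (i : OpenPair f U)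
    (a : Γ(Y.X, i.V)) : (ofDef h U).sharp i a = Ψ'.sharp i.maps a := by
  apply ι_sharp_injective
  rw [ι_sharp_sharp, Def.sharp, sharp_sharp]
  refine sharp_congr ?_ _ _ _
  rw [toY, ofDef, Category.assoc, Scheme.homOfLE_ι_assoc]

/-- Only the target has to be affine. For any `W` the map `A' ⊗ Γ(X, W) → A ⊗ Γ(X, W)` is surjective
with square-zero kernel, so the ring homomorphism given by `Ψ` lifts by formal smoothness of `Γ(Y,
V)` over the sections of the base, and a morphism into `V` is such a ring homomorphism. -/
theorem nonempty_of_isAffineOpen [Smooth Y.str] {t : A'} (h : IsSmallExt φ t) (Ψ : Def f A)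
    {V : Y.X.Opens} (hV : IsAffineOpen V) : Nonempty (LocalLift Ψ φ (f.hom ⁻¹ᵁ V)) := by
  set W := f.hom ⁻¹ᵁ V
  have hsm : (PoissonDef.sharp Y.str (le_preimage_top Y.str V)).FormallySmooth :=
    (Y.str.smooth_appLE (isAffineOpen_top _) hV (le_preimage_top Y.str V)).1
  have hker : ∀ x y : Γ(prodSpec X.str A', prodFst X.str A' ⁻¹ᵁ W), baseChange φ W x = 0 →
      baseChange φ W y = 0 → x * y = 0 := fun x y hx hy => by
    obtain ⟨x, rfl⟩ := exists_tmul_of_baseChange_eq_zero h hx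
    obtain ⟨y, rfl⟩ := exists_tmul_of_baseChange_eq_zero h hy
    rw [mul_tmul h.mul, red_tmul_eq_zero h.mem_maximalIdeal, zero_mul, tmul_zero]
  obtain ⟨g, hg, hg'⟩ := exists_lift_of_formallySmooth hsm
    (PoissonDef.sharp (prodFst X.str A' ≫ X.str) (le_preimage_top _ (prodFst X.str A' ⁻¹ᵁ W)))
    (baseChange_surjective h.surjective W) hker (Ψ.sharp (le_refl W)) (fun c => by
      rw [Ψ.sharp_base _ _ (le_preimage_top _ _), baseChange, sharp_sharp]
      refine sharp_congr ?_ _ _ _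
      rw [← Category.assoc, prodMap_fst])
  obtain ⟨p, hp, hp'⟩ := exists_hom_of_isAffineOpen hV
    ((PoissonDef.sharp (prodFst X.str A' ⁻¹ᵁ W).ι (top_le_ι _)).comp g)
  -- The lift `g` is a homomorphism over the base, so `p` and the projection to `Spec A'` define a
  -- morphism to the fibre product `Y × Spec A'`.
  have hstr : p ≫ Y.str = ((prodFst X.str A' ⁻¹ᵁ W).ι ≫ prodSnd X.str A') ≫
      Spec.map (CommRingCat.ofHom (algebraMap k A')) := by
    rw [Category.assoc, ← pullback.condition]
    refine hom_ext_of_isAffineOpen (isAffineOpen_top _) (le_preimage_top _ _) (le_preimage_top _ _)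
      fun c => ?_
    rw [← sharp_sharp _ _ hp (le_preimage_top _ _), hp', RingHom.comp_apply, hg', sharp_sharp]
  refine ⟨⟨pullback.lift p ((prodFst X.str A' ⁻¹ᵁ W).ι ≫ prodSnd X.str A') hstr,
    pullback.lift_snd _ _ _, hom_prod_ext ?_ ?_⟩⟩
  · rw [Category.assoc, pullback.lift_fst, Category.assoc, Category.assoc, prodMap_fst]
    have hq : ⊤ ≤ ((prodMap X.str φ ⁻¹ᵁ (prodFst X.str A' ⁻¹ᵁ W)).ι ≫ Ψ.hom ≫ prodFst Y.str A) ⁻¹ᵁ V := by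
      rw [Scheme.Hom.comp_preimage, preimage_eq, ← Scheme.Hom.comp_preimage (prodMap X.str φ),
        prodMap_fst]
      simp [W]
    have hq' : ⊤ ≤ (prodMap X.str φ ∣_ (prodFst X.str A' ⁻¹ᵁ W) ≫ p) ⁻¹ᵁ V := by
      rw [Scheme.Hom.comp_preimage, top_le_iff.1 hp]; simp
    refine hom_ext_of_isAffineOpen hV hq' hq fun a => ?_
    rw [← sharp_sharp _ _ (le_preimage_top _ _) hp, hp', RingHom.comp_apply, sharp_sharp,
      sharp_congr (morphismRestrict_ι _ _) _ (by
        rw [Scheme.Hom.comp_preimage]; simp)]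
    rw [← sharp_sharp _ (prodMap X.str φ) (V := prodFst X.str A ⁻¹ᵁ W) (by
        rw [← prodMap_fst X.str φ, Scheme.Hom.comp_preimage]; simp) (le_prodMap_preimage φ W)]
    refine (congrArg _ (hg a)).trans ?_
    rw [Def.sharp, sharp_sharp]
  · rw [Category.assoc, pullback.lift_snd, Category.assoc, Category.assoc, prodMap_snd,
      morphismRestrict_ι_assoc, prodMap_snd, reassoc_of% Ψ.hom_snd]

theorem exists_pointCover [Smooth Y.str] {t : A'} (h : IsSmallExt φ t) (Ψ : Def f A) :
    ∃ 𝒰 : PointCover X.X, Nonempty (∀ x, LocalLift Ψ φ (𝒰.nhd x)) := by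
  have hV : ∀ y : Y.X, ∃ V : Y.X.Opens, IsAffineOpen V ∧ y ∈ V := fun y => by
    obtain ⟨_, ⟨V, hV, rfl⟩, hy, -⟩ :=
      Y.X.isBasis_affineOpens.exists_subset_of_mem_open (Set.mem_univ y) isOpen_univ
    exact ⟨V, hV, hy⟩
  choose V hV hy using hV
  exact ⟨⟨fun x => f.hom ⁻¹ᵁ V (f.hom x), fun x => hy (f.hom x)⟩,
    ⟨fun x => (nonempty_of_isAffineOpen h Ψ (hV (f.hom x))).some⟩⟩

end LocalLift

end LocalLift

section Main

variable {k : Type u} [Field k] {X Y : PoissonScheme (Spec (.of k))} {f : PoissonScheme.Hom X Y}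
  {A : Type u} [CommRing A] [Algebra k A] [IsArtAlg k A]

/-! ### First-order deformations -/

/-- The family given by the trivial deformation. -/
def constFam (U : X.X.Opens) : Fam f A U := fun i =>
  (sharp (prodFst X.str A) le_rfl).comp (sharp f.hom i.maps)

/-- The family given by a deformation. -/
def Def.fam (Ψ : Def f A) (U : X.X.Opens) : Fam f A U := fun i => Ψ.sharp i.maps

theorem isLiftFamily_constFam (U : X.X.Opens) : IsLiftFamily (constFam (f := f) (A := A) U) := by
  refine ⟨fun i j hV hW a => ?_, fun i R hR hR' c => ?_, fun i a => red_sharp _⟩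
  · simp only [constFam, RingHom.comp_apply]
    rw [sharp_res, res_sharp, sharp_sharp, sharp_sharp]
  · simp only [constFam, RingHom.comp_apply]
    rw [sharp_sharp (f.hom), sharp_congr f.w _ hR']

theorem Def.isLiftFamily_fam (Ψ : Def f A) (U : X.X.Opens) : IsLiftFamily (Ψ.fam U) := by
  refine ⟨fun i j hV hW a => Ψ.sharp_res i.maps hV hW j.maps a, fun i R hR hR' c => ?_,
    fun i a => Ψ.red_sharp i.maps a⟩
  rw [sharp_sharp]
  exact Ψ.sharp_base i.maps hR _ c

variable {𝒰 𝒱 : PointCover X.X}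

/-- The constant family is one global homomorphism, so there are no differences; it preserves
brackets because `f` does. -/
theorem isObs_constFam (t : A) :
    IsObs (f := f) (𝒰 := 𝒰) t (fun x => constFam (𝒰.nhd x)) 0 := by
  refine ⟨fun _ i a b => (tmul_zero t).trans (sub_eq_zero.2 ?_).symm,
    fun _ _ _ => (tmul_zero t).trans (sub_self _).symm⟩
  simp only [restr, constFam, RingHom.comp_apply]
  rw [f.sharp_bracket, ← tmul_one, ← tmul_one, ← tmul_one, prodBracket_tmul, mul_one]

theorem Def.isObs_fam (Ψ : Def f A) (t : A) : IsObs (𝒰 := 𝒰) t (fun x => Ψ.fam (𝒰.nhd x)) 0 :=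
  ⟨fun _ i a b => (tmul_zero t).trans (sub_eq_zero.2 (Ψ.sharp_bracket i.maps a b)).symm,
    fun _ _ _ => (tmul_zero t).trans (sub_self _).symm⟩

theorem eps_ne_zero : (DualNumber.eps : DualNumber k) ≠ 0 := fun h => by
  have := congrArg TrivSqZeroExt.snd h
  simp at this

variable {Ψ Ψ' : Def f (DualNumber k)} {α β : (polyComplex f).Tot 𝒰 0}

theorem isFirstOrderCochain_iff :
    IsFirstOrderCochain Ψ α ↔ ∀ s, IsDiff DualNumber.eps
      (restr (fun x => constFam (𝒰.nhd x)) s 0) (restr (fun x => Ψ.fam (𝒰.nhd x)) s 0)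
      (α ⟨(0, 0), rfl⟩ s) := by
  refine forall_congr' fun s => forall_congr' fun i => forall_congr' fun a => ?_
  rw [eq_sub_iff_add_eq, add_comm]
  exact eq_comm

variable (Ψ 𝒰) in
theorem exists_isFirstOrderCochain :
    ∃ α : (polyComplex f).Tot 𝒰 0, IsFirstOrderCochain Ψ α := by
  choose η hη using fun s : Fin 1 → X.X => exists_isDiff
    (Φ := restr (fun x => constFam (f := f) (𝒰.nhd x)) s 0)
    (Φ' := restr (fun x => Ψ.fam (𝒰.nhd x)) s 0) eps_ne_zero (fun _ => eps_mul)
    (isLiftFamily_restr (fun _ => isLiftFamily_constFam _) s 0)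
    (isLiftFamily_restr (fun _ => Ψ.isLiftFamily_fam _) s 0) (fun i a => by
      obtain ⟨x, hx⟩ := exists_eq_sharp_add_tmul_eps (Ψ.sharp i.maps a)
      rw [Ψ.red_sharp] at hx
      exact ⟨x, (sub_eq_of_eq_add' hx).symm⟩)
  obtain ⟨α, hα⟩ := exists_tot_zero η
  exact ⟨α, isFirstOrderCochain_iff.2 fun s => (hα s).symm ▸ hη s⟩

/-- The constant family and the family of `Ψ` both have obstruction cochain `0`, and passing from
one to the other changes it by `-D α`. -/
theorem IsFirstOrderCochain.mem_ker (h : IsFirstOrderCochain Ψ α) :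
    α ∈ ((polyComplex f).totD 𝒰 0).ker := by
  have h1 := (isObs_constFam DualNumber.eps).sub_totD (fun _ => eps_mul) eps_mem
    (fun _ => isLiftFamily_constFam _) (isFirstOrderCochain_iff.1 h)
  have h2 := h1.unique eps_ne_zero (Ψ.isObs_fam DualNumber.eps)
  rwa [zero_sub, neg_eq_zero] at h2

theorem IsFirstOrderCochain.unique (h : IsFirstOrderCochain Ψ α) (h' : IsFirstOrderCochain Ψ β) :
    α = β :=
  (polyComplex f).tot_ext_zero fun s =>
    (isFirstOrderCochain_iff.1 h s).unique eps_ne_zero (isFirstOrderCochain_iff.1 h' s)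

theorem IsFirstOrderCochain.totRes (h : 𝒰 ≤ 𝒱) (hα : IsFirstOrderCochain Ψ α) :
    IsFirstOrderCochain Ψ ((polyComplex f).totRes h 0 α) :=
  fun s i a => hα s (i.mono (PointCover.inter_mono h s)) a

theorem IsFirstOrderCochain.cls_eq (hα : IsFirstOrderCochain Ψ α) {β : (polyComplex f).Tot 𝒱 0}
    (hβ : IsFirstOrderCochain Ψ β) : (polyComplex f).cls 0 𝒰 ⟨α, hα.mem_ker⟩ =
      (polyComplex f).cls 0 𝒱 ⟨β, hβ.mem_ker⟩ := by
  obtain ⟨𝒲, h, h'⟩ := exists_ge_ge 𝒰 𝒱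
  rw [← (polyComplex f).cls_totRes h, ← (polyComplex f).cls_totRes h']
  congr 1
  exact Subtype.ext ((hα.totRes h).unique (hβ.totRes h'))

theorem IsFirstOrderCochain.injective (h : IsFirstOrderCochain Ψ α)
    (h' : IsFirstOrderCochain Ψ' α) : Ψ = Ψ' := by
  refine Def.ext_sharp fun V x hx => ⟨f.hom ⁻¹ᵁ V ⊓ 𝒰.nhd x, ⟨hx, 𝒰.mem x⟩, inf_le_left, fun a => ?_⟩
  let i : OpenPair f (𝒰.inter (p := 0) fun _ => x) :=
    ⟨V, f.hom ⁻¹ᵁ V ⊓ 𝒰.nhd x, le_iInf fun _ => inf_le_right, inf_le_left⟩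
  exact (h (fun _ => x) i a).trans (h' (fun _ => x) i a).symm

/-- The family `f^♯ + ε α` has obstruction cochain `0 - D α = 0`, so it glues to a deformation. -/
theorem exists_def_of_mem_ker (hα : α ∈ ((polyComplex f).totD 𝒰 0).ker) :
    ∃ Ψ : Def f (DualNumber k), IsFirstOrderCochain Ψ α := by
  obtain ⟨F, hF, hη⟩ := exists_isDiff_of_tot (t := (DualNumber.eps : DualNumber k))
    (fun _ => eps_mul) eps_mem
    (F := fun x => constFam (f := f) (𝒰.nhd x)) (fun _ => isLiftFamily_constFam _) α
  have h := (isObs_constFam DualNumber.eps).sub_totD (fun _ => eps_mul) eps_mem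
    (fun _ => isLiftFamily_constFam _) hη
  rw [(AddMonoidHom.mem_ker).1 hα, sub_zero] at h
  obtain ⟨Ψ, hΨ⟩ := (h.isDefFamily hF).exists_def
  refine ⟨Ψ, isFirstOrderCochain_iff.2 fun s i a => (hη s i a).trans ?_⟩
  exact congrArg (· - _) (hΨ (s 0) (i.mono (iInf_le _ 0)) a).symm

variable (f) in
theorem exists_equiv_hyperH_zero :
    ∃ e : Def f (DualNumber k) ≃ (polyComplex f).HyperH 0,
      ∀ Ψ : Def f (DualNumber k),
        (∃ (𝒰 : PointCover X.X) (α : (polyComplex f).Tot 𝒰 0), IsFirstOrderCochain Ψ α) ∧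
        ∀ (𝒰 : PointCover X.X) (α : (polyComplex f).Tot 𝒰 0), IsFirstOrderCochain Ψ α →
          ∃ hα : α ∈ ((polyComplex f).totD 𝒰 0).ker, (polyComplex f).cls 0 𝒰 ⟨α, hα⟩ = e Ψ := by
  let 𝒰₀ : PointCover X.X := Classical.arbitrary _
  choose α₀ hα₀ using fun Ψ : Def f (DualNumber k) => exists_isFirstOrderCochain 𝒰₀ Ψ
  let g : Def f (DualNumber k) → (polyComplex f).HyperH 0 := fun Ψ =>
    (polyComplex f).cls 0 𝒰₀ ⟨α₀ Ψ, (hα₀ Ψ).mem_ker⟩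
  have hg : Function.Bijective g := by
    constructor
    · intro Ψ Ψ' h
      have h1 : (polyComplex f).cls 0 𝒰₀ (⟨α₀ Ψ, (hα₀ Ψ).mem_ker⟩ - ⟨α₀ Ψ', (hα₀ Ψ').mem_ker⟩) = 0 := by
        rw [(polyComplex f).cls_sub, sub_eq_zero]; exact h
      obtain ⟨𝒱, hle, h2⟩ := (polyComplex f).exists_of_cls_eq_zero _ h1
      -- In degree `0` the group of coboundaries is trivial, so equal classes give equal cochains on
      -- a finer cover.
      have h3 : (polyComplex f).totRes hle 0 (α₀ Ψ - α₀ Ψ') = 0 := h2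
      rw [map_sub, sub_eq_zero] at h3
      exact ((hα₀ Ψ).totRes hle).injective (h3 ▸ (hα₀ Ψ').totRes hle)
    · intro z
      obtain ⟨𝒰, α, rfl⟩ := (polyComplex f).exists_cls z
      obtain ⟨Ψ, hΨ⟩ := exists_def_of_mem_ker α.2
      exact ⟨Ψ, (hα₀ Ψ).cls_eq hΨ⟩
  refine ⟨Equiv.ofBijective g hg, fun Ψ => ⟨⟨𝒰₀, α₀ Ψ, hα₀ Ψ⟩, fun 𝒰 α hα => ⟨hα.mem_ker, ?_⟩⟩⟩
  exact hα.cls_eq (hα₀ Ψ)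

/-! ### Obstructions -/

variable {A' : Type u} [CommRing A'] [Algebra k A'] [IsArtAlg k A'] {φ : A' →ₐ[k] A} {t : A'}

/-- The projections to `Spec A'` and the maps on points agree for any two deformations, so only the
maps on sections from `Y` have to be compared, and this is local. -/
theorem isLifting_of_sharp {Ψ : Def f A} {Ψ' : Def f A'}
    (h : ∀ (V : Y.X.Opens) (x : X.X), x ∈ f.hom ⁻¹ᵁ V → ∃ (W : X.X.Opens) (_ : x ∈ W)
      (hW : W ≤ f.hom ⁻¹ᵁ V), ∀ a, baseChange φ W (Ψ'.sharp hW a) = Ψ.sharp hW a) :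
    IsLifting Ψ φ Ψ' := by
  refine hom_prod_ext ?_ ?_
  · rw [Category.assoc, Category.assoc, prodMap_fst]
    refine hom_ext_of_sharp ?_ fun V z hz => ?_
    · rw [Scheme.Hom.comp_base, Ψ'.hom_fst_base, ← Scheme.Hom.comp_base, ← Category.assoc,
        prodMap_fst, Ψ.hom_fst_base]
    · have hz' : prodFst X.str A z ∈ f.hom ⁻¹ᵁ V := by
        rw [Scheme.Hom.comp_preimage, preimage_eq, ← Scheme.Hom.comp_preimage (prodMap X.str φ),
          prodMap_fst] at hz
        exact hz
      obtain ⟨W, hx, hW, e⟩ := h V _ hz'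
      refine ⟨prodFst X.str A ⁻¹ᵁ W, hx, ?_, ?_, fun a => ?_⟩
      · rw [Scheme.Hom.comp_preimage, preimage_eq, ← Scheme.Hom.comp_preimage (prodMap X.str φ),
          prodMap_fst]
        exact (prodFst X.str A).preimage_mono hW
      · rw [preimage_eq]
        exact (prodFst X.str A).preimage_mono hW
      · have := e a
        rw [baseChange, Def.sharp, sharp_sharp] at this
        exact this
  · rw [Category.assoc, Category.assoc, prodMap_snd, Ψ'.hom_snd, prodMap_snd,
      reassoc_of% Ψ.hom_snd]

theorem baseChange_bracket (φ : A' →ₐ[k] A) {W : X.X.Opens}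
    (r r' : Γ(prodSpec X.str A', prodFst X.str A' ⁻¹ᵁ W)) :
    baseChange φ W ((X.poisson.prodBracket A' _).br r r') =
      (X.poisson.prodBracket A _).br (baseChange φ W r) (baseChange φ W r') := by
  induction r using tmul_induction with
  | add r₁ r₂ h₁ h₂ => simp only [map_add, LinearMap.add_apply, h₁, h₂]
  | mul a x =>
    induction r' using tmul_induction with
    | add r₁ r₂ h₁ h₂ => simp only [map_add, h₁, h₂]
    | mul a' x' =>
      rw [prodBracket_tmul, baseChange_tmul, baseChange_tmul, baseChange_tmul, prodBracket_tmul,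
        map_mul]

theorem baseChange_restr {Ψ : Def f A} {F : ∀ x, Fam f A' (𝒰.nhd x)}
    (hF : ∀ x i a, baseChange φ i.W (F x i a) = Ψ.sharp i.maps a) {p : ℕ} {s : Fin (p + 1) → X.X}
    {j : Fin (p + 1)} {i : OpenPair f (𝒰.inter s)} {a : Γ(Y.X, i.V)} :
    baseChange φ i.W (restr F s j i a) = Ψ.sharp i.maps a :=
  hF (s j) (i.mono (iInf_le _ j)) a

section

variable {Ψ : Def f A} {L : ∀ x, LocalLift Ψ φ (𝒰.nhd x)} {M : ∀ x, LocalLift Ψ φ (𝒱.nhd x)}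
  {α : (polyComplex f).Tot 𝒰 1} {β : (polyComplex f).Tot 𝒱 1}

theorem isObstructionCochain_iff :
    IsObstructionCochain t L α ↔ IsObs t (fun x => (L x).sharp) α := Iff.rfl

variable (L) in
theorem exists_isObstructionCochain (h : IsSmallExt φ t) :
    ∃ α : (polyComplex f).Tot 𝒰 1, IsObstructionCochain t L α := by
  refine exists_isObs_of_forall (F := fun x => (L x).sharp) h.ne_zero h.mul
    (fun x => (L x).isLiftFamily) (fun x i a b => exists_tmul_of_baseChange_eq_zero h ?_)
    (fun s i a => exists_tmul_of_baseChange_eq_zero h ?_)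
  · rw [map_sub, baseChange_bracket, (L x).baseChange_sharp, (L x).baseChange_sharp,
      (L x).baseChange_sharp, Ψ.sharp_bracket, sub_self]
  · have hL : ∀ x i a, baseChange φ i.W ((L x).sharp i a) = Ψ.sharp i.maps a :=
      fun x => (L x).baseChange_sharp
    rw [map_sub, baseChange_restr hL, baseChange_restr hL, sub_self]

theorem IsObstructionCochain.mem_ker (h : IsSmallExt φ t) (hα : IsObstructionCochain t L α) :
    α ∈ ((polyComplex f).totD 𝒰 1).ker :=
  (isObstructionCochain_iff.1 hα).totD_eq_zero h.ne_zero h.mul h.mem_maximalIdeal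
    (fun x => (L x).isLiftFamily)

/-- On a common refinement both systems of liftings reduce to `Ψ`, so they differ by `t η` for a
`0`-cochain `η`, and the cocycles differ by `D η`. -/
theorem IsObstructionCochain.cls_eq (h : IsSmallExt φ t) (hα : IsObstructionCochain t L α)
    (hβ : IsObstructionCochain t M β) : (polyComplex f).cls 1 𝒰 ⟨α, hα.mem_ker h⟩ =
      (polyComplex f).cls 1 𝒱 ⟨β, hβ.mem_ker h⟩ := by
  obtain ⟨𝒲, h1, h2⟩ := exists_ge_ge 𝒰 𝒱
  rw [← (polyComplex f).cls_totRes h1, ← (polyComplex f).cls_totRes h2, ← sub_eq_zero,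
    ← (polyComplex f).cls_sub]
  refine (polyComplex f).cls_eq_zero_of_mem _ ?_
  let F : ∀ x, Fam f A' (𝒲.nhd x) := fun x i => (L x).sharp (i.mono (h1 x))
  let F' : ∀ x, Fam f A' (𝒲.nhd x) := fun x i => (M x).sharp (i.mono (h2 x))
  have hF : ∀ x, IsLiftFamily (F x) := fun x => (L x).isLiftFamily.mono (h1 x)
  have hF' : ∀ x, IsLiftFamily (F' x) := fun x => (M x).isLiftFamily.mono (h2 x)
  have hL : ∀ x i a, baseChange φ i.W (F x i a) = Ψ.sharp i.maps a :=
    fun x i => (L x).baseChange_sharp (i.mono (h1 x))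
  have hM : ∀ x i a, baseChange φ i.W (F' x i a) = Ψ.sharp i.maps a :=
    fun x i => (M x).baseChange_sharp (i.mono (h2 x))
  choose η hη using fun s : Fin 1 → X.X => exists_isDiff (Φ := restr F s 0) (Φ' := restr F' s 0)
    h.ne_zero h.mul (isLiftFamily_restr hF s 0) (isLiftFamily_restr hF' s 0) (fun i a => by
      refine exists_tmul_of_baseChange_eq_zero h ?_
      rw [map_sub, baseChange_restr hM, baseChange_restr hL, sub_self])
  obtain ⟨η', hη'⟩ := exists_tot_zero η
  have h3 := ((isObstructionCochain_iff.1 hα).totRes h1).sub_totD h.mul h.mem_maximalIdeal hF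
    (F' := F') (η := η') (fun s => (hη' s).symm ▸ hη s)
  have h4 := h3.unique h.ne_zero ((isObstructionCochain_iff.1 hβ).totRes h2)
  exact ⟨η', (sub_eq_iff_eq_add.2 (sub_eq_iff_eq_add'.1 h4)).symm⟩

/-- On a finer cover the cocycle is `D η`. Changing the liftings there by `t η` makes the cochain
zero, so they glue; the change is invisible over `A` because `t` maps to zero. -/
theorem IsObstructionCochain.exists_isLifting (h : IsSmallExt φ t)
    (hα : IsObstructionCochain t L α)
    (h0 : (polyComplex f).cls 1 𝒰 ⟨α, hα.mem_ker h⟩ = 0) :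
    ∃ Ψ' : Def f A', IsLifting Ψ φ Ψ' := by
  obtain ⟨𝒱, hle, η, hη⟩ := (polyComplex f).exists_of_cls_eq_zero _ h0
  let F : ∀ x, Fam f A' (𝒱.nhd x) := fun x i => (L x).sharp (i.mono (hle x))
  have hF : ∀ x, IsLiftFamily (F x) := fun x => (L x).isLiftFamily.mono (hle x)
  have hL : ∀ x i a, baseChange φ i.W (F x i a) = Ψ.sharp i.maps a :=
    fun x i => (L x).baseChange_sharp (i.mono (hle x))
  obtain ⟨F', hF', hη'⟩ := exists_isDiff_of_tot h.mul h.mem_maximalIdeal hF η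
  have h1 := ((isObstructionCochain_iff.1 hα).totRes hle).sub_totD h.mul h.mem_maximalIdeal hF hη'
  rw [hη, sub_self] at h1
  obtain ⟨Ψ', hΨ'⟩ := (h1.isDefFamily hF').exists_def
  refine ⟨Ψ', isLifting_of_sharp fun V x hx =>
    ⟨f.hom ⁻¹ᵁ V ⊓ 𝒱.nhd x, ⟨hx, 𝒱.mem x⟩, inf_le_left, fun a => ?_⟩⟩
  have e1 := hΨ' x (OpenPair.ofPoint f 𝒱 V x) a
  have e2 := hη' (fun _ => x) ⟨V, f.hom ⁻¹ᵁ V ⊓ 𝒱.nhd x, le_iInf fun _ => inf_le_right, inf_le_left⟩ a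
  have e3 : F' x (OpenPair.ofPoint f 𝒱 V x) a = _ := (sub_eq_iff_eq_add.1 e2.symm)
  refine (congrArg _ (e1.trans e3)).trans ?_
  rw [map_add, baseChange_tmul_eq_zero h, zero_add]
  exact hL x (OpenPair.ofPoint f 𝒱 V x) a

theorem isObstructionCochain_ofDef {Ψ' : Def f A'} (h : IsLifting Ψ φ Ψ') :
    IsObstructionCochain t (fun x => LocalLift.ofDef h (𝒰.nhd x)) 0 := by
  have e : (fun x => (LocalLift.ofDef h (𝒰.nhd x)).sharp) = fun x => Ψ'.fam (𝒰.nhd x) := by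
    funext x i
    exact RingHom.ext fun a => LocalLift.ofDef_sharp h _ i a
  rw [isObstructionCochain_iff, e]
  exact Ψ'.isObs_fam t

end

theorem exists_obstruction [Smooth Y.str] (h : IsSmallExt φ t) (Ψ : Def f A) :
    ∃ o : (polyComplex f).HyperH 1,
      (∃ (𝒰 : PointCover X.X) (L : ∀ x, LocalLift Ψ φ (𝒰.nhd x))
        (α : (polyComplex f).Tot 𝒰 1), IsObstructionCochain t L α) ∧
      (∀ (𝒰 : PointCover X.X) (L : ∀ x, LocalLift Ψ φ (𝒰.nhd x))
        (α : (polyComplex f).Tot 𝒰 1), IsObstructionCochain t L α →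
          ∃ hα : α ∈ ((polyComplex f).totD 𝒰 1).ker, (polyComplex f).cls 1 𝒰 ⟨α, hα⟩ = o) ∧
      (o = 0 ↔ ∃ Ψ' : Def f A', IsLifting Ψ φ Ψ') := by
  obtain ⟨𝒰, ⟨L⟩⟩ := LocalLift.exists_pointCover h Ψ
  obtain ⟨α, hα⟩ := exists_isObstructionCochain L h
  refine ⟨(polyComplex f).cls 1 𝒰 ⟨α, hα.mem_ker h⟩, ⟨𝒰, L, α, hα⟩,
    fun 𝒱 M β hβ => ⟨hβ.mem_ker h, hβ.cls_eq h hα⟩, hα.exists_isLifting h, ?_⟩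
  rintro ⟨Ψ', hΨ'⟩
  -- Since the class is independent of the local liftings, it may be computed from the restrictions
  -- of `Ψ'`, whose cochain is `0`.
  have h0 := isObstructionCochain_ofDef (𝒰 := 𝒰) (t := t) hΨ'
  rw [hα.cls_eq h h0]
  exact (polyComplex f).cls_eq_zero_of_mem _ (zero_mem _)

end Main

end PoissonDef
end

/-- First-order deformations and obstructions for deformations of a Poisson morphism of nonsingular
Poisson varieties leaving domain and target fixed. -/
theorem mainTheorem11 {k : Type u} [Field k] [IsAlgClosed k] [CharZero k]
    (X Y : PoissonDef.PoissonScheme (Spec (.of k)))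
    [Smooth X.str] [IsSeparated X.str] [QuasiCompact X.str]
    [Smooth Y.str] [IsSeparated Y.str] [QuasiCompact Y.str]
    (f : PoissonDef.PoissonScheme.Hom X Y) :
    (∃ e : PoissonDef.Def f (DualNumber k) ≃ (PoissonDef.polyComplex f).HyperH 0,
      ∀ Ψ : PoissonDef.Def f (DualNumber k),
        (∃ (𝒰 : PoissonDef.PointCover X.X) (α : (PoissonDef.polyComplex f).Tot 𝒰 0),
          PoissonDef.IsFirstOrderCochain Ψ α) ∧
        ∀ (𝒰 : PoissonDef.PointCover X.X) (α : (PoissonDef.polyComplex f).Tot 𝒰 0),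
          PoissonDef.IsFirstOrderCochain Ψ α →
            ∃ hα : α ∈ ((PoissonDef.polyComplex f).totD 𝒰 0).ker,
              (PoissonDef.polyComplex f).cls 0 𝒰 ⟨α, hα⟩ = e Ψ) ∧
    ∀ (A A' : Type u) [CommRing A] [Algebra k A] [PoissonDef.IsArtAlg k A]
      [CommRing A'] [Algebra k A'] [PoissonDef.IsArtAlg k A'] (φ : A' →ₐ[k] A) (t : A'),
      PoissonDef.IsSmallExt φ t → ∀ Ψ : PoissonDef.Def f A,
        ∃ o : (PoissonDef.polyComplex f).HyperH 1,
          (∃ (𝒰 : PoissonDef.PointCover X.X) (L : ∀ x, PoissonDef.LocalLift Ψ φ (𝒰.nhd x))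
            (α : (PoissonDef.polyComplex f).Tot 𝒰 1), PoissonDef.IsObstructionCochain t L α) ∧
          (∀ (𝒰 : PoissonDef.PointCover X.X) (L : ∀ x, PoissonDef.LocalLift Ψ φ (𝒰.nhd x))
            (α : (PoissonDef.polyComplex f).Tot 𝒰 1), PoissonDef.IsObstructionCochain t L α →
              ∃ hα : α ∈ ((PoissonDef.polyComplex f).totD 𝒰 1).ker,
                (PoissonDef.polyComplex f).cls 1 𝒰 ⟨α, hα⟩ = o) ∧
          (o = 0 ↔ ∃ Ψ' : PoissonDef.Def f A', PoissonDef.IsLifting Ψ φ Ψ') := by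
  exact ⟨PoissonDef.exists_equiv_hyperH_zero f,
    fun _ _ _ _ _ _ _ _ _ _ h Ψ => PoissonDef.exists_obstruction h Ψ⟩
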